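/- Fix an infinite set $\mathbb P$ of propositional variables. The formulas of the modal $\mu$-calculus $\mathcal L_\mu$ are given by $\varphi ::= \top \mid x \mid \neg\varphi \mid \varphi\wedge\varphi \mid \Diamond\varphi \mid \nu x.\varphi$, where $x\in\mathbb P$ and, in $\nu x.\varphi$, the formula $\varphi$ is positive in $x$ ($x$ occurs free in it only under an even number of negations); formulas are identified up to renaming of bound variables, and $\vee,\Rightarrow,\Box$ are the usual abbreviations. They are interpreted on Kripke frames $(W,\to)$ in the usual way: $\Diamond$ by $\to$, and $\nu x.\varphi$ by the union of all $X\subseteq W$ that are included in the value of $\varphi$ when $x$ has the value $X$. Let $\mathcal L_\Diamond$ be the fragment without $\nu$. A *natural sublanguage* is a set $\mathcal L\subseteq\mathcal L_\mu$ that contains $\top$ and is closed under substitution (of formulas of $\mathcal L$ for free variables), under $\neg$, $\wedge$, $\Diamond$, and under subformulas (for $\nu x.\theta$: with $x$ chosen suitably among the variables not otherwise occurring in $\theta$). Let $\Lambda\subseteq\mathcal L_\Diamond$ be a normal modal logic. A *$\Lambda$-frame* is a frame on which all formulas of $\Lambda$ are valid. $\Lambda$ is *over $\mathsf{wK4}$*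 if it contains all $\Diamond\Diamond\varphi\Rightarrow\varphi\vee\Diamond\varphi$, and *over $\mathsf{K4}$* if it contains all $\Diamond\Diamond\varphi\Rightarrow\Diamond\varphi$. It is *canonical* if the frame of its canonical model (over the variables $\mathbb P$) is a $\Lambda$-frame. A set $U\subseteq W$ is *cofinal* in $(W,\to)$ if for all $y\in U$ and $x$ with $y\to x$ there is $z\in U$ with $x=z$ or $x\to z$. A canonical logic $\Lambda$ over $\mathsf{wK4}$ is a *cofinal subframe logic* if the restriction of any $\Lambda$-frame to any cofinal subset is a $\Lambda$-frame. For a natural sublanguage $\mathcal L$, the logic $\mu\text{-}\Lambda^{\mathcal L}$ is the least set of formulas that contains the following axioms and is closed under the following rules, where all formulas involved are in $\mathcal L$: propositional tautologies and modus ponens; necessitation (from $\varphi$ infer $\Box\varphi$); $\Box(\varphi\Rightarrow\psi)\Rightarrow(\Box\varphi\Rightarrow\Box\psi)$; $\Diamond\Diamond\varphi\Rightarrow(\varphi\vee\Diamond\varphi)$; all substitution instances, by formulas of $\mathcal L$, of formulas of $\Lambda$; $\nu x.\theta\Rightarrow\theta(\nu x.\theta)$; and the rule: from $\varphi\Rightarrow\theta(\varphi)$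 infer $\varphi\Rightarrow\nu x.\theta$. **Theorem.** (1) Let $\Lambda$ be a canonical cofinal subframe logic over $\mathsf{wK4}$ and $\mathcal L$ a natural sublanguage of $\mathcal L_\mu$. Then $\mu\text{-}\Lambda^{\mathcal L}$ is sound for the class of $\Lambda$-frames (every theorem is valid on every $\Lambda$-frame) and complete for the class of finite $\Lambda$-frames (every $\varphi\in\mathcal L$ that is valid on all finite $\Lambda$-frames is a theorem). Consequently it has the finite model property: a formula $\varphi\in\mathcal L$ is a theorem of $\mu\text{-}\Lambda^{\mathcal L}$ if and only if $\varphi$ is valid on every finite frame that validates all theorems of $\mu\text{-}\Lambda^{\mathcal L}$. (2) This covers continuum many logics: the set of canonical cofinal subframe logics over $\mathsf{K4}$ has the cardinality $2^{\aleph_0}$ of the continuum, and for every natural sublanguage $\mathcal L$ that contains all propositional variables the set of the logics $\mu\text{-}\Lambda^{\mathcal L}$, for $\Lambda$ a canonical cofinal subframe logic over $\mathsf{K4}$, also has cardinality $2^{\aleph_0}$. -/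

import Mathlib

universe u v

/-- Raw formulas over the set `P` of propositional variables, in locally nameless form: free
variables are elements of `P`, a bound variable is the number (`bvar i`) of fixed-point binders
between it and its own binder. So formulas that differ only in the names of bound variables are
equal, and no clash between free and bound variables can occur. -/
inductive Fm (P : Type u) : Type u
  | top : Fm P
  | var : P → Fm P
  | bvar : ℕ → Fm P
  | neg : Fm P → Fm P
  | wedge : Fm P → Fm P → Fm P
  | dia : Fm P → Fm P
  | nu : Fm P → Fm P

namespace Fm

/-- `Pol true i φ`: the bound variable `i` occurs in `φ` only under an even number of negations;
`Pol false i φ`: only under an odd number of negations. -/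
def Pol {P : Type u} : Bool → ℕ → Fm P → Prop
  | _, _, top => True
  | _, _, var _ => True
  | b, i, bvar j => j = i → b = true
  | b, i, neg φ => Pol (!b) i φ
  | b, i, wedge φ ψ => Pol b i φ ∧ Pol b i ψ
  | b, i, dia φ => Pol b i φ
  | b, i, nu φ => Pol b (i + 1) φ

/-- All bound variables of `φ` that are not bound inside `φ` are among `0, …, k - 1`, and every
fixed-point operator in `φ` is applied to a formula that is positive in the variable it binds. -/
def IsFormulaAt {P : Type u} : ℕ → Fm P → Prop
  | _, top => True
  | _, var _ => True
  | k, bvar i => i < k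
  | k, neg φ => IsFormulaAt k φ
  | k, wedge φ ψ => IsFormulaAt k φ ∧ IsFormulaAt k ψ
  | k, dia φ => IsFormulaAt k φ
  | k, nu φ => IsFormulaAt (k + 1) φ ∧ Pol true 0 φ

/-- The formulas of the modal `μ`-calculus. -/
def IsFormula {P : Type u} (φ : Fm P) : Prop := IsFormulaAt 0 φ

/-- The formulas of the basic modal language. -/
def IsModal {P : Type u} : Fm P → Prop
  | top => True
  | var _ => True
  | bvar _ => False
  | neg φ => IsModal φ
  | wedge φ ψ => IsModal φ ∧ IsModal ψ
  | dia φ => IsModal φ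
  | nu _ => False

/-- The propositional variable `x` occurs (free) in `φ`. -/
def Occurs {P : Type u} (x : P) : Fm P → Prop
  | top => False
  | var y => y = x
  | bvar _ => False
  | neg φ => Occurs x φ
  | wedge φ ψ => Occurs x φ ∨ Occurs x ψ
  | dia φ => Occurs x φ
  | nu φ => Occurs x φ

/-- Simultaneous substitution for the free variables. The substituted formulas are always
formulas without loose bound variables, so that nothing has to be shifted. -/
def subst {P : Type u} (σ : P → Fm P) : Fm P → Fm P
  | top => top
  | var p => σ p
  | bvar i => bvar i
  | neg φ => neg (subst σ φ)
  | wedge φ ψ => wedge (subst σ φ) (subst σ ψ)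
  | dia φ => dia (subst σ φ)
  | nu φ => nu (subst σ φ)

/-- Substitution of `ψ` (without loose bound variables) for the loose bound variable `k`. -/
def instAt {P : Type u} (ψ : Fm P) : ℕ → Fm P → Fm P
  | _, top => top
  | _, var p => var p
  | k, bvar i => if i = k then ψ else bvar i
  | k, neg φ => neg (instAt ψ k φ)
  | k, wedge φ χ => wedge (instAt ψ k φ) (instAt ψ k χ)
  | k, dia φ => dia (instAt ψ k φ)
  | k, nu φ => nu (instAt ψ (k + 1) φ)

/-- For the body `θ` of a fixed-point formula `nu θ`, that is `νx.θ(x)`, this is `θ(ψ)`. -/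
def inst {P : Type u} (θ ψ : Fm P) : Fm P := instAt ψ 0 θ

def bot {P : Type u} : Fm P := neg top
def vee {P : Type u} (φ ψ : Fm P) : Fm P := neg (wedge (neg φ) (neg ψ))
def imp {P : Type u} (φ ψ : Fm P) : Fm P := neg (wedge φ (neg ψ))
def iff {P : Type u} (φ ψ : Fm P) : Fm P := wedge (imp φ ψ) (imp ψ φ)
def box {P : Type u} (φ : Fm P) : Fm P := neg (dia (neg φ))

/-- Finite conjunctions. -/
def bigWedge {P : Type u} : List (Fm P) → Fm P
  | [] => top
  | φ :: l => wedge φ (bigWedge l)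

/-- Truth value under a Boolean valuation `b` of the formulas that are not Boolean compounds. -/
def boolEval {P : Type u} (b : Fm P → Prop) : Fm P → Prop
  | top => True
  | neg φ => ¬ boolEval b φ
  | wedge φ ψ => boolEval b φ ∧ boolEval b ψ
  | var p => b (var p)
  | bvar i => b (bvar i)
  | dia φ => b (dia φ)
  | nu φ => b (nu φ)

/-- Instances of propositional tautologies. -/
def IsTautology {P : Type u} (φ : Fm P) : Prop := ∀ b : Fm P → Prop, boolEval b φ

/-- The environment that gives the bound variable `0` the value `X`. -/
def push {W : Type v} (X : Set W) (e : ℕ → Set W) : ℕ → Set W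
  | 0 => X
  | i + 1 => e i

/-- The extension of a formula in the Kripke model with accessibility relation `R` and valuation
`val`; `e` gives the values of the loose bound variables. -/
def eval {P : Type u} {W : Type v} (R : W → W → Prop) (val : P → Set W) :
    (ℕ → Set W) → Fm P → Set W
  | _, top => Set.univ
  | _, var p => val p
  | e, bvar i => e i
  | e, neg φ => (eval R val e φ)ᶜ
  | e, wedge φ ψ => eval R val e φ ∩ eval R val e ψ
  | e, dia φ => {w | ∃ s, R w s ∧ s ∈ eval R val e φ}
  | e, nu φ => ⋃₀ {X : Set W | X ⊆ eval R val (push X e) φ}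

end Fm

open Fm

/-- The formula `φ` is valid on the Kripke frame `(W, R)`. A formula has no loose bound variables,
so the environment is irrelevant. -/
def ValidOn {P : Type u} {W : Type v} (R : W → W → Prop) (φ : Fm P) : Prop :=
  ∀ (val : P → Set W) (w : W), w ∈ eval R val (fun _ => ∅) φ

/-- The frame `(W, R)` validates all formulas in `Λ`. -/
def IsFrameOf {P : Type u} {W : Type v} (Λ : Set (Fm P)) (R : W → W → Prop) : Prop :=
  ∀ φ ∈ Λ, ValidOn R φ

/-- Normal modal logics in the basic modal language. The axiom `dual` is needed because `◇` is
primitive and `□` abbreviates `¬◇¬`. -/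
structure IsNormalLogic {P : Type u} (Λ : Set (Fm P)) : Prop where
  isModal : ∀ φ ∈ Λ, IsModal φ
  taut : ∀ φ, IsModal φ → IsTautology φ → φ ∈ Λ
  distr : ∀ φ ψ, IsModal φ → IsModal ψ → imp (box (imp φ ψ)) (imp (box φ) (box ψ)) ∈ Λ
  dual : ∀ φ, IsModal φ → iff (dia φ) (neg (box (neg φ))) ∈ Λ
  mp : ∀ φ ψ, φ ∈ Λ → imp φ ψ ∈ Λ → ψ ∈ Λ
  nec : ∀ φ ∈ Λ, box φ ∈ Λ
  unifSubst : ∀ φ ∈ Λ, ∀ σ : P → Fm P, (∀ p, IsModal (σ p)) → subst σ φ ∈ Λ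

/-- `Λ` contains the weak transitivity axiom of `wK4`. -/
def ContainsWK4 {P : Type u} (Λ : Set (Fm P)) : Prop :=
  ∀ φ, IsModal φ → imp (dia (dia φ)) (vee φ (dia φ)) ∈ Λ

/-- `Λ` contains the transitivity axiom of `K4`. -/
def ContainsK4 {P : Type u} (Λ : Set (Fm P)) : Prop :=
  ∀ φ, IsModal φ → imp (dia (dia φ)) (dia φ) ∈ Λ

/-- `Γ` is a `Λ`-consistent set of formulas of the basic modal language. -/
def IsConsistent {P : Type u} (Λ Γ : Set (Fm P)) : Prop :=
  (∀ φ ∈ Γ, IsModal φ) ∧ ∀ l : List (Fm P), (∀ φ ∈ l, φ ∈ Γ) → neg (bigWedge l) ∉ Λ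

/-- `Γ` is a maximal `Λ`-consistent set. -/
def IsTheory {P : Type u} (Λ Γ : Set (Fm P)) : Prop :=
  IsConsistent Λ Γ ∧ ∀ Δ : Set (Fm P), IsConsistent Λ Δ → Γ ⊆ Δ → Δ = Γ

/-- The worlds of the canonical model of `Λ`. -/
def CanonicalWorld {P : Type u} (Λ : Set (Fm P)) : Type u := {Γ : Set (Fm P) // IsTheory Λ Γ}

/-- The accessibility relation of the canonical model of `Λ`. -/
def canonicalRel {P : Type u} (Λ : Set (Fm P)) (T T' : CanonicalWorld Λ) : Prop :=
  ∀ φ, box φ ∈ T.1 → φ ∈ T'.1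

/-- `Λ` is canonical: the frame of its canonical model is a `Λ`-frame. -/
def IsCanonical {P : Type u} (Λ : Set (Fm P)) : Prop := IsFrameOf Λ (canonicalRel Λ)

/-- Cofinal subsets of a (weakly transitive) frame: every successor of a point of `U` lies in `U`
or has a successor in `U`. -/
def IsCofinalIn {W : Type v} (R : W → W → Prop) (U : Set W) : Prop :=
  ∀ x, (∃ y ∈ U, R y x) → ∃ z ∈ U, x = z ∨ R x z

/-- The restriction of a `Λ`-frame to a cofinal subset is a `Λ`-frame. -/
def IsCofinalSubframe {P : Type u} (Λ : Set (Fm P)) : Prop :=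
  ∀ (W : Type u) (R : W → W → Prop), IsFrameOf Λ R → ∀ U : Set W, IsCofinalIn R U →
    IsFrameOf Λ (fun x y : U => R x.1 y.1)

/-- Canonical cofinal subframe logics over `wK4`. -/
structure IsCanonicalCofinalSubframeLogic {P : Type u} (Λ : Set (Fm P)) : Prop where
  normal : IsNormalLogic Λ
  wk4 : ContainsWK4 Λ
  canonical : IsCanonical Λ
  cofinalSubframe : IsCofinalSubframe Λ

/-- Natural sublanguages of the modal `μ`-calculus: sets of formulas that contain `⊤` and are
closed under substitution, the Boolean connectives, `◇`, and subformulas. The subformula of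
`νx.θ` is `θ(x)`, for some variable `x` with no other occurrence in it. -/
structure IsNaturalSublanguage {P : Type u} (L : Set (Fm P)) : Prop where
  isFormula : ∀ φ ∈ L, IsFormula φ
  top_mem : top ∈ L
  neg_mem : ∀ φ ∈ L, neg φ ∈ L
  wedge_mem : ∀ φ ∈ L, ∀ ψ ∈ L, wedge φ ψ ∈ L
  dia_mem : ∀ φ ∈ L, dia φ ∈ L
  subst_mem : ∀ φ ∈ L, ∀ σ : P → Fm P, (∀ p, σ p ∈ L ∨ σ p = var p) → subst σ φ ∈ L
  of_neg : ∀ φ, neg φ ∈ L → φ ∈ L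
  of_wedge : ∀ φ ψ, wedge φ ψ ∈ L → φ ∈ L ∧ ψ ∈ L
  of_dia : ∀ φ, dia φ ∈ L → φ ∈ L
  of_nu : ∀ θ, nu θ ∈ L → ∃ x : P, ¬ Occurs x θ ∧ inst θ (var x) ∈ L

/-- Derivability in the logic `μ-Λ`, restricted to the natural sublanguage `L`. -/
inductive MuProvable {P : Type u} (Λ L : Set (Fm P)) : Fm P → Prop
  | taut (φ : Fm P) : φ ∈ L → IsTautology φ → MuProvable Λ L φ
  | mp (φ ψ : Fm P) : φ ∈ L → ψ ∈ L → MuProvable Λ L φ → MuProvable Λ L (imp φ ψ) →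
      MuProvable Λ L ψ
  | nec (φ : Fm P) : φ ∈ L → MuProvable Λ L φ → MuProvable Λ L (box φ)
  | distr (φ ψ : Fm P) : φ ∈ L → ψ ∈ L →
      MuProvable Λ L (imp (box (imp φ ψ)) (imp (box φ) (box ψ)))
  | weakTrans (φ : Fm P) : φ ∈ L → MuProvable Λ L (imp (dia (dia φ)) (vee φ (dia φ)))
  | fixedPoint (θ : Fm P) : nu θ ∈ L → MuProvable Λ L (imp (nu θ) (inst θ (nu θ)))
  | induction (φ θ : Fm P) : φ ∈ L → nu θ ∈ L → MuProvable Λ L (imp φ (inst θ φ)) →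
      MuProvable Λ L (imp φ (nu θ))
  | ax (χ : Fm P) (σ : P → Fm P) : χ ∈ Λ → (∀ p, σ p ∈ L) → MuProvable Λ L (subst σ χ)

/-- The logic `μ-Λ^L`, as the set of its theorems. -/
def muLogic {P : Type u} (Λ L : Set (Fm P)) : Set (Fm P) := {φ | MuProvable Λ L φ}

/-- The finite model property of a logic `T` in the language `L`: a formula of `L` is a theorem
of `T` iff it is valid on all finite frames of `T`. -/
def HasFMP {P : Type u} (T L : Set (Fm P)) : Prop :=
  ∀ φ ∈ L, φ ∈ T ↔
    ∀ (W : Type u) (R : W → W → Prop), Finite W → IsFrameOf T R → ValidOn R φ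

-- Soundness is a check of the rules; the frames are weakly transitive because `Λ` contains the
-- axiom of `wK4`. For completeness, let `φ` be unprovable and work in the canonical model whose
-- points are the maximal consistent subsets of `L`. The truth lemma may fail there for fixed
-- points, so one passes to a submodel. Let `Δ` be a finite set that contains `⊤` and a closure of
-- `¬φ` under subformulas and unfolding. A point is final if, for some `ψ ∈ Δ`, it lies in a last
-- cluster in which `ψ` holds here or later. A Zorn argument (`exists_maximal`, `exists_final`) puts
-- a final point for `ψ` above every point with `ψ`, and along final points the set of `ψ ∈ Δ` still
-- to come shrinks strictly from cluster to cluster. So the final submodel has bounded depth.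
--
-- The truth lemma for the final submodel (`truthLemma`) is by induction on formulas. For `νx.θ` one
-- must show that a post-fixed point `X` of `θ` is contained in the value of `νx.θ`. This is a
-- second induction, on depth (`TruthLemma.mem_nu`). In the cluster of a final point `T`, points
-- that agree on finitely many formulas cannot be distinguished, so the trace of `X` on that cluster
-- can be replaced by a definable set. Together with `νx.θ`, which takes care of later points, this
-- gives one formula `χ` with `χ ⇒ θ(χ)` everywhere above `T`, and a local form of the induction
-- rule yields `νx.θ` at `T`.
--
-- The final submodel is based on a `Λ`-frame. With the variables of `Λ` read as names for all
-- formulas of `L`, the canonical frame becomes a generated subframe of the canonical frame of `Λ`,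
-- and the final points form a cofinal subset (`isFrameOf_finalRel`). A weakly transitive model of
-- bounded depth with finitely many colours has a finite bounded morphic image
-- (`exists_finite_quotient`); this refutes `φ` on a finite `Λ`-frame.
--
-- For the cardinality, a normal logic is determined by its formulas in countably many variables, so
-- there are at most continuum many. Conversely, each `S ⊆ ℕ` gives the logic of transitive frames
-- of width two that omit the orders `ForkLt n`, `n ∈ S`. Width two makes these omission conditions
-- definable and canonical, and the orders do not embed into each other, so different `S` give
-- different logics. Passing to `μ-Λ^L` loses nothing, because its modal part is `Λ` again.

universe w

/-! ### Maximal consistent sets and Lindenbaum's lemma -/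

/-- A normal modal logic `Th` in a language `L` closed under the connectives and subformulas. -/
structure IsNormalIn {P : Type u} (L Th : Set (Fm P)) : Prop where
  top_mem : top ∈ L
  neg_mem : ∀ {φ}, neg φ ∈ L ↔ φ ∈ L
  wedge_mem : ∀ {φ ψ}, wedge φ ψ ∈ L ↔ φ ∈ L ∧ ψ ∈ L
  dia_mem : ∀ {φ}, dia φ ∈ L ↔ φ ∈ L
  sub : Th ⊆ L
  taut : ∀ φ ∈ L, IsTautology φ → φ ∈ Th
  mp : ∀ φ ψ, φ ∈ Th → imp φ ψ ∈ Th → ψ ∈ Th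
  nec : ∀ φ ∈ Th, box φ ∈ Th
  distr : ∀ φ ψ, φ ∈ L → ψ ∈ L → imp (box (imp φ ψ)) (imp (box φ) (box ψ)) ∈ Th
  dual : ∀ φ ∈ L, iff (dia φ) (neg (box (neg φ))) ∈ Th

/-- Maximal consistent sets, described by how they treat the Boolean connectives. -/
structure IsMCS {P : Type u} (L Th Γ : Set (Fm P)) : Prop where
  sub : Γ ⊆ L
  thm : Th ⊆ Γ
  neg : ∀ φ ∈ L, neg φ ∈ Γ ↔ φ ∉ Γ
  wedge : ∀ φ ∈ L, ∀ ψ ∈ L, wedge φ ψ ∈ Γ ↔ φ ∈ Γ ∧ ψ ∈ Γ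

/-- The type of maximal consistent sets. -/
def MCS {P : Type u} (L Th : Set (Fm P)) : Type u := {Γ : Set (Fm P) // IsMCS L Th Γ}

/-- The canonical accessibility relation. -/
def MCS.rel {P : Type u} {L Th : Set (Fm P)} (T S : MCS L Th) : Prop :=
  ∀ φ, box φ ∈ T.1 → φ ∈ S.1

/-- `φ` follows from finitely many elements of `Γ`. -/
def Entails {P : Type u} (Th Γ : Set (Fm P)) (φ : Fm P) : Prop :=
  ∃ l : List (Fm P), (∀ ψ ∈ l, ψ ∈ Γ) ∧ imp (bigWedge l) φ ∈ Th

namespace Fm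
variable {P : Type u}

@[simp] theorem boolEval_top (b : Fm P → Prop) : boolEval b top ↔ True := Iff.rfl
@[simp] theorem boolEval_neg (b : Fm P → Prop) (φ : Fm P) :
    boolEval b (neg φ) ↔ ¬ boolEval b φ := Iff.rfl
@[simp] theorem boolEval_wedge (b : Fm P → Prop) (φ ψ : Fm P) :
    boolEval b (wedge φ ψ) ↔ boolEval b φ ∧ boolEval b ψ := Iff.rfl
@[simp] theorem boolEval_imp (b : Fm P → Prop) (φ ψ : Fm P) :
    boolEval b (imp φ ψ) ↔ (boolEval b φ → boolEval b ψ) := by simp [imp]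
@[simp] theorem boolEval_bot (b : Fm P → Prop) : boolEval b (bot : Fm P) ↔ False := by simp [bot]
theorem boolEval_bigWedge (b : Fm P → Prop) (l : List (Fm P)) :
    boolEval b (bigWedge l) ↔ ∀ φ ∈ l, boolEval b φ := by
  induction l with
  | nil => simp [bigWedge]
  | cons a l ih => simp [bigWedge, ih]

end Fm

namespace IsNormalIn
variable {P : Type u} {L Th : Set (Fm P)} (h : IsNormalIn L Th)
include h

theorem imp_mem {φ ψ : Fm P} : imp φ ψ ∈ L ↔ φ ∈ L ∧ ψ ∈ L := by
  simp [imp, h.neg_mem, h.wedge_mem]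

theorem vee_mem {φ ψ : Fm P} : vee φ ψ ∈ L ↔ φ ∈ L ∧ ψ ∈ L := by
  simp [vee, h.neg_mem, h.wedge_mem]

theorem iff_mem {φ ψ : Fm P} : iff φ ψ ∈ L ↔ φ ∈ L ∧ ψ ∈ L := by
  simp only [iff, h.imp_mem, h.wedge_mem]; tauto

theorem box_mem {φ : Fm P} : box φ ∈ L ↔ φ ∈ L := by
  simp [box, h.neg_mem, h.dia_mem]

theorem bot_mem : (bot : Fm P) ∈ L := h.neg_mem.2 h.top_mem

theorem bigWedge_mem {l : List (Fm P)} : bigWedge l ∈ L ↔ ∀ φ ∈ l, φ ∈ L := by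
  induction l with
  | nil => simp [bigWedge, h.top_mem]
  | cons a l ih => simp [bigWedge, h.wedge_mem, ih]

theorem of_taut_one {φ ψ : Fm P} (hφ : φ ∈ Th) (hψ : ψ ∈ L)
    (H : ∀ b, boolEval b φ → boolEval b ψ) : ψ ∈ Th :=
  h.mp φ ψ hφ (h.taut _ (h.imp_mem.2 ⟨h.sub hφ, hψ⟩) fun b => by simpa using H b)

theorem of_taut_two {φ φ' ψ : Fm P} (hφ : φ ∈ Th) (hφ' : φ' ∈ Th) (hψ : ψ ∈ L)
    (H : ∀ b, boolEval b φ → boolEval b φ' → boolEval b ψ) : ψ ∈ Th :=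
  h.mp φ' ψ hφ' (h.of_taut_one hφ (h.imp_mem.2 ⟨h.sub hφ', hψ⟩) fun b => by simpa using H b)

theorem entails_of_mem {Γ : Set (Fm P)} {φ : Fm P} (hφ : φ ∈ Γ) (hL : φ ∈ L) :
    Entails Th Γ φ :=
  ⟨[φ], by simpa using hφ, h.taut _ (h.imp_mem.2 ⟨h.bigWedge_mem.2 (by simpa using hL), hL⟩)
    fun b => by simp [boolEval_bigWedge]⟩

theorem entails_of_thm {Γ : Set (Fm P)} {φ : Fm P} (hφ : φ ∈ Th) : Entails Th Γ φ :=
  ⟨[], by simp, h.of_taut_one hφ (h.imp_mem.2 ⟨h.top_mem, h.sub hφ⟩) fun b => by simp; tauto⟩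

theorem Entails.mem_L {Γ : Set (Fm P)} {φ : Fm P} (hφ : Entails Th Γ φ) : φ ∈ L := by
  obtain ⟨l, -, hl⟩ := hφ
  exact (h.imp_mem.1 (h.sub hl)).2

theorem entails_taut {Γ : Set (Fm P)} {φ φ' ψ : Fm P} (hφ : Entails Th Γ φ)
    (hφ' : Entails Th Γ φ') (hψ : ψ ∈ L) (H : ∀ b, boolEval b φ → boolEval b φ' → boolEval b ψ) :
    Entails Th Γ ψ := by
  obtain ⟨l, hl, hl'⟩ := hφ
  obtain ⟨m, hm, hm'⟩ := hφ'
  refine ⟨l ++ m, ?_, h.of_taut_two hl' hm' (h.imp_mem.2 ⟨h.bigWedge_mem.2 ?_, hψ⟩) ?_⟩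
  · intro ψ hψ
    rcases List.mem_append.1 hψ with h1 | h1
    · exact hl _ h1
    · exact hm _ h1
  · intro ψ hψ
    rcases List.mem_append.1 hψ with h1 | h1
    · exact h.bigWedge_mem.1 (h.imp_mem.1 (h.sub hl')).1 _ h1
    · exact h.bigWedge_mem.1 (h.imp_mem.1 (h.sub hm')).1 _ h1
  · intro b h1 h2
    simp only [boolEval_imp, boolEval_bigWedge, List.mem_append] at *
    exact fun h3 => H b (h1 fun φ hφ => h3 φ (.inl hφ)) (h2 fun φ hφ => h3 φ (.inr hφ))

theorem entails_insert {Γ : Set (Fm P)} {φ ψ : Fm P} (hψ : ψ ∈ L)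
    (H : Entails Th (insert ψ Γ) φ) : Entails Th Γ (imp ψ φ) := by
  classical
  obtain ⟨l, hl, hl'⟩ := H
  have hL := h.imp_mem.1 (h.sub hl')
  refine ⟨l.filter (· ≠ ψ), ?_, h.of_taut_one hl' (h.imp_mem.2 ⟨h.bigWedge_mem.2 ?_,
    h.imp_mem.2 ⟨hψ, hL.2⟩⟩) ?_⟩
  · intro χ hχ
    simp only [ne_eq, decide_not, List.mem_filter, Bool.not_eq_eq_eq_not, Bool.not_true,
      decide_eq_false_iff_not] at hχ
    exact (hl χ hχ.1).resolve_left hχ.2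
  · intro χ hχ
    exact h.bigWedge_mem.1 hL.1 χ (List.mem_filter.1 hχ).1
  · intro b h1
    simp only [boolEval_imp, boolEval_bigWedge] at *
    intro h2 h3
    refine h1 fun χ hχ => ?_
    by_cases hc : χ = ψ
    · exact hc ▸ h3
    · exact h2 χ (List.mem_filter.2 ⟨hχ, by simpa using hc⟩)

/-- Lindenbaum's lemma. -/
theorem exists_mcs {Γ : Set (Fm P)} {φ : Fm P} (hΓ : Γ ⊆ L) (hφ : φ ∈ L)
    (H : ¬ Entails Th Γ φ) : ∃ T : MCS L Th, Γ ⊆ T.1 ∧ φ ∉ T.1 := by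
  obtain ⟨T, hΓT, hT⟩ := zorn_subset_nonempty {Δ | Δ ⊆ L ∧ ¬ Entails Th Δ φ} (by
    intro c hc hch hne
    refine ⟨⋃₀ c, ⟨Set.sUnion_subset fun Δ hΔ => (hc hΔ).1, ?_⟩, fun Δ hΔ =>
      Set.subset_sUnion_of_mem hΔ⟩
    rintro ⟨l, hl, hl'⟩
    have : ∃ Δ ∈ c, ∀ ψ ∈ l, ψ ∈ Δ := by
      clear hl'
      induction l with
      | nil => exact ⟨hne.choose, hne.choose_spec, by simp⟩
      | cons a l ih =>
        obtain ⟨Δ, hΔ, h1⟩ := ih fun ψ hψ => hl ψ (List.mem_cons_of_mem _ hψ)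
        obtain ⟨Δ', hΔ', h2⟩ := hl a List.mem_cons_self
        rcases hch.total hΔ hΔ' with hs | hs
        · exact ⟨Δ', hΔ', by simpa using ⟨h2, fun ψ hψ => hs (h1 ψ hψ)⟩⟩
        · exact ⟨Δ, hΔ, by simpa using ⟨hs h2, h1⟩⟩
    obtain ⟨Δ, hΔ, h1⟩ := this
    exact (hc hΔ).2 ⟨l, h1, hl'⟩) Γ ⟨hΓ, H⟩
  have hTL := hT.prop.1
  have hcons := hT.prop.2
  -- Maximality: a formula outside `T` would make `φ` derivable if it were added. All closure
  -- properties of `T` follow from this by propositional reasoning.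
  have key : ∀ ψ ∈ L, ψ ∉ T → Entails Th T (imp ψ φ) := by
    intro ψ hψ hn
    refine h.entails_insert hψ ?_
    by_contra hc
    exact hn (hT.le_of_ge ⟨Set.insert_subset hψ hTL, hc⟩ (Set.subset_insert _ _)
      (Set.mem_insert _ _))
  have closed : ∀ ψ, Entails Th T ψ → ψ ∈ T := by
    intro ψ hψ
    by_contra hn
    exact hcons (h.entails_taut hψ (key ψ (Entails.mem_L h hψ) hn) hφ fun b h1 h2 => by
      simp at h2; exact h2 h1)
  have ent : ∀ ψ ∈ T, Entails Th T ψ := fun ψ hψ => h.entails_of_mem hψ (hTL hψ)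
  refine ⟨⟨T, hTL, fun ψ hψ => closed ψ (h.entails_of_thm hψ), ?_, ?_⟩, hΓT,
    fun hc => hcons (ent φ hc)⟩
  · intro ψ hψ
    constructor
    · intro h1 h2
      exact hcons (h.entails_taut (ent _ h1) (ent _ h2) hφ fun b h3 h4 => by
        simp at h3; exact absurd h4 h3)
    · intro h1
      by_contra h2
      exact hcons (h.entails_taut (key _ hψ h1) (key _ (h.neg_mem.2 hψ) h2) hφ fun b h3 h4 => by
        simp at h3 h4; tauto)
  · intro ψ hψ χ hχ
    constructor
    · intro h1
      exact ⟨closed _ (h.entails_taut (ent _ h1) (ent _ h1) hψ fun b h2 _ => by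
          simp at h2; exact h2.1),
        closed _ (h.entails_taut (ent _ h1) (ent _ h1) hχ fun b h2 _ => by
          simp at h2; exact h2.2)⟩
    · rintro ⟨h1, h2⟩
      exact closed _ (h.entails_taut (ent _ h1) (ent _ h2) (h.wedge_mem.2 ⟨hψ, hχ⟩)
        fun b h3 h4 => by simp; exact ⟨h3, h4⟩)

end IsNormalIn

namespace MCS
variable {P : Type u} {L Th : Set (Fm P)} (h : IsNormalIn L Th) (T : MCS L Th)
include h

theorem mem_top : top ∈ T.1 :=
  T.2.thm (h.taut _ h.top_mem fun b => by simp)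

omit h in
theorem mem_neg {φ : Fm P} (hφ : φ ∈ L) : neg φ ∈ T.1 ↔ φ ∉ T.1 := T.2.neg φ hφ

theorem mem_wedge {φ ψ : Fm P} : wedge φ ψ ∈ T.1 ↔ φ ∈ T.1 ∧ ψ ∈ T.1 := by
  constructor
  · intro h1
    have := h.wedge_mem.1 (T.2.sub h1)
    exact (T.2.wedge φ this.1 ψ this.2).1 h1
  · exact fun h1 => (T.2.wedge φ (T.2.sub h1.1) ψ (T.2.sub h1.2)).2 h1

theorem mem_imp {φ ψ : Fm P} (hφ : φ ∈ L) (hψ : ψ ∈ L) :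
    imp φ ψ ∈ T.1 ↔ (φ ∈ T.1 → ψ ∈ T.1) := by
  rw [imp, mem_neg T (h.wedge_mem.2 ⟨hφ, h.neg_mem.2 hψ⟩), mem_wedge h, mem_neg T hψ]
  tauto

theorem mem_vee {φ ψ : Fm P} (hφ : φ ∈ L) (hψ : ψ ∈ L) :
    vee φ ψ ∈ T.1 ↔ (φ ∈ T.1 ∨ ψ ∈ T.1) := by
  rw [vee, mem_neg T (h.wedge_mem.2 ⟨h.neg_mem.2 hφ, h.neg_mem.2 hψ⟩), mem_wedge h,
    mem_neg T hψ, mem_neg T hφ]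
  tauto

theorem mem_iff {φ ψ : Fm P} (hφ : φ ∈ L) (hψ : ψ ∈ L) :
    iff φ ψ ∈ T.1 ↔ (φ ∈ T.1 ↔ ψ ∈ T.1) := by
  rw [iff, mem_wedge h, mem_imp h T hφ hψ, mem_imp h T hψ hφ]
  tauto

theorem mem_bigWedge {l : List (Fm P)} : bigWedge l ∈ T.1 ↔ ∀ φ ∈ l, φ ∈ T.1 := by
  induction l with
  | nil => simp [bigWedge, mem_top h T]
  | cons a l ih => simp [bigWedge, mem_wedge h, ih]

theorem mem_of_entails {Γ : Set (Fm P)} {φ : Fm P} (hΓ : Γ ⊆ T.1) (H : Entails Th Γ φ) :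
    φ ∈ T.1 := by
  obtain ⟨l, hl, hl'⟩ := H
  have hL := h.imp_mem.1 (h.sub hl')
  exact (mem_imp h T hL.1 hL.2).1 (T.2.thm hl') ((mem_bigWedge h T).2 fun ψ hψ => hΓ (hl ψ hψ))

omit T in
theorem thm_of_forall_mem {φ : Fm P} (hφ : φ ∈ L) (H : ∀ T : MCS L Th, φ ∈ T.1) : φ ∈ Th := by
  by_contra hn
  obtain ⟨T, -, hT⟩ := h.exists_mcs (Γ := ∅) (by simp) hφ (by
    rintro ⟨l, hl, hl'⟩
    have hl0 : l = [] := List.eq_nil_iff_forall_not_mem.2 fun a ha => hl a ha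
    subst hl0
    exact hn (h.of_taut_one hl' hφ fun b => by simp [bigWedge]))
  exact hT (H T)

theorem mem_box_of_imp (l : List (Fm P)) (φ : Fm P) (hl : ∀ ψ ∈ l, box ψ ∈ T.1)
    (H : imp (bigWedge l) φ ∈ Th) : box φ ∈ T.1 := by
  induction l generalizing φ with
  | nil =>
    exact T.2.thm (h.nec _ (h.of_taut_one H (h.imp_mem.1 (h.sub H)).2 fun b => by
      simp [bigWedge]))
  | cons a l ih =>
    have hL := h.imp_mem.1 (h.sub H)
    have hL' := h.wedge_mem.1 hL.1
    have h1 : box (imp a φ) ∈ T.1 := by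
      refine ih _ (fun ψ hψ => hl ψ (List.mem_cons_of_mem _ hψ)) (h.of_taut_one H
        (h.imp_mem.2 ⟨hL'.2, h.imp_mem.2 ⟨hL'.1, hL.2⟩⟩) fun b => ?_)
      simp [bigWedge]
      tauto
    have h2 := T.2.thm (h.distr a φ hL'.1 hL.2)
    rw [mem_imp h T (h.box_mem.2 (h.imp_mem.2 ⟨hL'.1, hL.2⟩))
      (h.imp_mem.2 ⟨h.box_mem.2 hL'.1, h.box_mem.2 hL.2⟩),
      mem_imp h T (h.box_mem.2 hL'.1) (h.box_mem.2 hL.2)] at h2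
    exact h2 h1 (hl a List.mem_cons_self)

theorem mem_box {φ : Fm P} (hφ : φ ∈ L) : box φ ∈ T.1 ↔ ∀ S, rel T S → φ ∈ S.1 := by
  refine ⟨fun h1 S hS => hS φ h1, fun H => ?_⟩
  by_contra hn
  obtain ⟨S, hS, hS'⟩ := h.exists_mcs (Γ := {ψ | box ψ ∈ T.1})
    (fun ψ hψ => h.box_mem.1 (T.2.sub hψ)) hφ (by
      rintro ⟨l, hl, hl'⟩
      exact hn (mem_box_of_imp h T l φ hl hl'))
  exact hS' (H S fun ψ hψ => hS hψ)

theorem mem_dia {φ : Fm P} (hφ : φ ∈ L) : dia φ ∈ T.1 ↔ ∃ S, rel T S ∧ φ ∈ S.1 := by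
  have h1 := T.2.thm (h.dual φ hφ)
  rw [mem_iff h T (h.dia_mem.2 hφ) (h.neg_mem.2 (h.box_mem.2 (h.neg_mem.2 hφ))),
    mem_neg T (h.box_mem.2 (h.neg_mem.2 hφ)), mem_box h T (h.neg_mem.2 hφ)] at h1
  rw [h1]
  push Not
  refine exists_congr fun S => and_congr_right fun _ => ?_
  rw [mem_neg S hφ, not_not]

omit h in
theorem ext_mem {T S : MCS L Th} (H : ∀ φ ∈ L, φ ∈ T.1 → φ ∈ S.1) : T = S := by
  refine Subtype.ext (Set.Subset.antisymm (fun φ hφ => H φ (T.2.sub hφ) hφ) fun φ hφ => ?_)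
  by_contra hn
  have hL := S.2.sub hφ
  exact (mem_neg S hL).1 (H _ (T.2.sub ((mem_neg T hL).2 hn)) ((mem_neg T hL).2 hn)) hφ

end MCS

theorem IsNormalLogic.isNormalIn {P : Type u} {Λ : Set (Fm P)} (h : IsNormalLogic Λ) :
    IsNormalIn {φ | IsModal φ} Λ where
  top_mem := trivial
  neg_mem := Iff.rfl
  wedge_mem := Iff.rfl
  dia_mem := Iff.rfl
  sub := h.isModal
  taut := h.taut
  mp := h.mp
  nec := h.nec
  distr := h.distr
  dual := h.dual

/-- A maximal consistent set equals its Lindenbaum extension. Conversely, a set that decides every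
formula has no proper consistent extension, since that would contain some `φ` together with its
negation. -/
theorem isTheory_iff_isMCS {P : Type u} {Λ Γ : Set (Fm P)} (h : IsNormalLogic Λ) :
    IsTheory Λ Γ ↔ IsMCS {φ | IsModal φ} Λ Γ := by
  have hn := h.isNormalIn
  have cons_of_mcs : ∀ T : MCS {φ | IsModal φ} Λ, IsConsistent Λ T.1 := fun T =>
    ⟨T.2.sub, fun l hl hc => (T.2.neg _ (hn.neg_mem.1 (hn.sub hc))).1 (T.2.thm hc)
      ((MCS.mem_bigWedge hn T).2 hl)⟩
  constructor
  · rintro ⟨⟨h1, h2⟩, h3⟩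
    obtain ⟨T, hT, -⟩ := hn.exists_mcs (Γ := Γ) h1 hn.bot_mem (by
      rintro ⟨l, hl, hl'⟩
      exact h2 l hl (hn.of_taut_one hl' (hn.neg_mem.2 (hn.imp_mem.1 (hn.sub hl')).1)
        fun b => by simp))
    rw [← h3 T.1 (cons_of_mcs T) hT]
    exact T.2
  · intro hΓ
    refine ⟨cons_of_mcs ⟨Γ, hΓ⟩, fun Δ hΔ hs => Set.Subset.antisymm (fun φ hφ => ?_) hs⟩
    by_contra hc
    have hφL := hΔ.1 φ hφ
    have := hs ((hΓ.neg φ hφL).2 hc)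
    refine hΔ.2 [φ, neg φ] (by simp [hφ, this]) (hn.taut _ (hn.neg_mem.2 (hn.bigWedge_mem.2 ?_)) ?_)
    · simp only [List.mem_cons, List.not_mem_nil, or_false, forall_eq_or_imp, forall_eq]
      exact ⟨hφL, hφL⟩
    · intro b
      simp [boolEval_bigWedge]

/-! ### Substitution for bound variables -/

namespace Fm
variable {P : Type u}

/-- Extension of a sequence of formulas by a first entry. -/
def cons (χ : Fm P) (ρ : ℕ → Fm P) : ℕ → Fm P
  | 0 => χ
  | i + 1 => ρ i

/-- Simultaneous substitution of the formulas `ρ 0, ρ 1, …` (without loose bound variables) for the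
loose bound variables `k, k + 1, …`. -/
def close (ρ : ℕ → Fm P) : ℕ → Fm P → Fm P
  | _, top => top
  | _, var p => var p
  | k, bvar i => if i < k then bvar i else ρ (i - k)
  | k, neg φ => neg (close ρ k φ)
  | k, wedge φ ψ => wedge (close ρ k φ) (close ρ k ψ)
  | k, dia φ => dia (close ρ k φ)
  | k, nu φ => nu (close ρ (k + 1) φ)

theorem close_eq_self (ρ : ℕ → Fm P) (φ : Fm P) (k : ℕ) (h : IsFormulaAt k φ) :
    close ρ k φ = φ := by
  induction φ generalizing k with
  | top => rfl
  | var p => rfl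
  | bvar i => exact if_pos h
  | neg φ ih => simp [close, ih k h]
  | wedge φ ψ ih1 ih2 => simp [close, ih1 k h.1, ih2 k h.2]
  | dia φ ih => simp [close, ih k h]
  | nu φ ih => simp [close, ih (k + 1) h.1]

theorem instAt_eq_self (χ : Fm P) (φ : Fm P) (k j : ℕ) (hk : k ≤ j) (h : IsFormulaAt k φ) :
    instAt χ j φ = φ := by
  induction φ generalizing k j with
  | top => rfl
  | var p => rfl
  | bvar i => exact if_neg (by have : i < k := h; omega)
  | neg φ ih => simp [instAt, ih k j hk h]
  | wedge φ ψ ih1 ih2 => simp [instAt, ih1 k j hk h.1, ih2 k j hk h.2]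
  | dia φ ih => simp [instAt, ih k j hk h]
  | nu φ ih => simp [instAt, ih (k + 1) (j + 1) (by omega) h.1]

/-- The `ρ i` have no loose bound variables, so the later instantiation leaves them alone. This lets
the truth lemma pass under a binder by prefixing one formula to `ρ`. -/
theorem instAt_close (χ : Fm P) (ρ : ℕ → Fm P) (hρ : ∀ i, IsFormula (ρ i)) (φ : Fm P) (k : ℕ) :
    instAt χ k (close ρ (k + 1) φ) = close (cons χ ρ) k φ := by
  induction φ generalizing k with
  | top => rfl
  | var p => rfl
  | bvar i =>
    rcases lt_trichotomy i k with h | rfl | h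
    · simp [close, h, Nat.lt_succ_of_lt h, instAt, h.ne]
    · simp [close, instAt, cons]
    · obtain ⟨j, rfl⟩ : ∃ j, i = k + 1 + j := ⟨i - (k + 1), by omega⟩
      have h1 : k + 1 + j - k = j + 1 := by omega
      have h2 : ¬ k + 1 + j < k := by omega
      have h3 : ¬ k + 1 + j < k + 1 := by omega
      have h4 : k + 1 + j - (k + 1) = j := by omega
      simp only [close, h1, h2, h3, h4, cons, if_false]
      exact instAt_eq_self χ (ρ j) 0 k (Nat.zero_le _) (hρ j)
  | neg φ ih => simp [close, instAt, ih]
  | wedge φ ψ ih1 ih2 => simp [close, instAt, ih1, ih2]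
  | dia φ ih => simp [close, instAt, ih]
  | nu φ ih => simp [close, instAt, ih]

/-- Instantiation of a fixed-point body is thereby an ordinary substitution into `θ(x)`, for which a
natural sublanguage is closed. -/
theorem subst_instAt_var (σ : P → Fm P) (x : P) (θ : Fm P) (k : ℕ)
    (hσ : ∀ p, p ≠ x → σ p = var p) (hx : ¬ Occurs x θ) :
    subst σ (instAt (var x) k θ) = instAt (σ x) k θ := by
  induction θ generalizing k with
  | top => rfl
  | var p => exact hσ p hx
  | bvar i =>
    by_cases h : i = k <;> simp [instAt, h, subst]
  | neg φ ih => simp [instAt, subst, ih k hx]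
  | wedge φ ψ ih1 ih2 =>
    simp only [Occurs, not_or] at hx
    simp [instAt, subst, ih1 k hx.1, ih2 k hx.2]
  | dia φ ih => simp [instAt, subst, ih k hx]
  | nu φ ih => simp [instAt, subst, ih (k + 1) hx]

theorem subst_var (φ : Fm P) : subst var φ = φ := by
  induction φ with
  | top => rfl
  | var p => rfl
  | bvar i => rfl
  | neg φ ih => simp [subst, ih]
  | wedge φ ψ ih1 ih2 => simp [subst, ih1, ih2]
  | dia φ ih => simp [subst, ih]
  | nu φ ih => simp [subst, ih]

theorem IsModal.subst {φ : Fm P} (h : IsModal φ) {σ : P → Fm P} (hσ : ∀ p, IsModal (σ p)) :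
    IsModal (subst σ φ) := by
  induction φ with
  | top => trivial
  | var p => exact hσ p
  | bvar i => exact h.elim
  | neg φ ih => exact ih h
  | wedge φ ψ ih1 ih2 => exact ⟨ih1 h.1, ih2 h.2⟩
  | dia φ ih => exact ih h
  | nu φ ih => exact h.elim

theorem IsModal.isFormulaAt {φ : Fm P} (h : IsModal φ) (k : ℕ) : IsFormulaAt k φ := by
  induction φ with
  | top => trivial
  | var p => trivial
  | bvar i => exact h.elim
  | neg φ ih => exact ih h
  | wedge φ ψ ih1 ih2 => exact ⟨ih1 h.1, ih2 h.2⟩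
  | dia φ ih => exact ih h
  | nu φ ih => exact h.elim

/-! ### Monotonicity, substitution and bounded morphisms in the semantics -/

section Eval
variable {W : Type v} {W' : Type w}

/-- Both polarities are treated together because negation exchanges them. The alternative `e' i ⊆ e
i` covers variables whose value does not change, whatever their polarity. -/
theorem eval_mono (R : W → W → Prop) (val : P → Set W) (φ : Fm P) (b : Bool) (e e' : ℕ → Set W)
    (h : ∀ i, e i ⊆ e' i ∧ (Pol b i φ ∨ e' i ⊆ e i)) :
    bif b then eval R val e φ ⊆ eval R val e' φ else eval R val e' φ ⊆ eval R val e φ := by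
  induction φ generalizing b e e' with
  | top => cases b <;> exact subset_rfl
  | var p => cases b <;> exact subset_rfl
  | bvar i =>
    cases b
    · rcases (h i).2 with h1 | h1
      · exact absurd (h1 rfl) (by simp)
      · exact h1
    · exact (h i).1
  | neg φ ih =>
    have := ih (!b) e e' h
    cases b
    · exact Set.compl_subset_compl.2 this
    · exact Set.compl_subset_compl.2 this
  | wedge φ ψ ih1 ih2 =>
    have h1 := ih1 b e e' fun i => ⟨(h i).1, (h i).2.imp_left And.left⟩
    have h2 := ih2 b e e' fun i => ⟨(h i).1, (h i).2.imp_left And.right⟩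
    cases b
    · exact Set.inter_subset_inter h1 h2
    · exact Set.inter_subset_inter h1 h2
  | dia φ ih =>
    have h1 := ih b e e' h
    cases b
    · exact fun w ⟨s, hs, hs'⟩ => ⟨s, hs, h1 hs'⟩
    · exact fun w ⟨s, hs, hs'⟩ => ⟨s, hs, h1 hs'⟩
  | nu φ ih =>
    have h1 : ∀ X : Set W, _ := fun X => ih b (push X e) (push X e') fun i => by
      cases i with
      | zero => exact ⟨subset_rfl, .inr subset_rfl⟩
      | succ i => exact h i
    cases b
    · exact fun w ⟨X, hX, hw⟩ => ⟨X, hX.trans (h1 X), hw⟩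
    · exact fun w ⟨X, hX, hw⟩ => ⟨X, hX.trans (h1 X), hw⟩

theorem eval_push_mono (R : W → W → Prop) (val : P → Set W) {φ : Fm P} (e : ℕ → Set W)
    (h : Pol true 0 φ) {X Y : Set W} (hXY : X ⊆ Y) :
    eval R val (push X e) φ ⊆ eval R val (push Y e) φ :=
  eval_mono R val φ true _ _ fun i => by
    cases i with
    | zero => exact ⟨hXY, .inl h⟩
    | succ i => exact ⟨subset_rfl, .inr subset_rfl⟩

theorem eval_congr (R : W → W → Prop) (val : P → Set W) (φ : Fm P) (k : ℕ) (e e' : ℕ → Set W)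
    (hφ : IsFormulaAt k φ) (h : ∀ i < k, e i = e' i) : eval R val e φ = eval R val e' φ := by
  induction φ generalizing k e e' with
  | top => rfl
  | var p => rfl
  | bvar i => exact h i hφ
  | neg φ ih => simp [eval, ih k e e' hφ h]
  | wedge φ ψ ih1 ih2 => simp [eval, ih1 k e e' hφ.1 h, ih2 k e e' hφ.2 h]
  | dia φ ih => simp [eval, ih k e e' hφ h]
  | nu φ ih =>
    have : ∀ X : Set W, eval R val (push X e) φ = eval R val (push X e') φ := fun X =>
      ih (k + 1) _ _ hφ.1 fun i hi => by
        cases i with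
        | zero => rfl
        | succ i => exact h i (by omega)
    simp [eval, this]

theorem eval_closed (R : W → W → Prop) (val : P → Set W) {φ : Fm P} (hφ : IsFormula φ)
    (e e' : ℕ → Set W) : eval R val e φ = eval R val e' φ :=
  eval_congr R val φ 0 e e' hφ fun i hi => absurd hi (Nat.not_lt_zero i)

theorem eval_instAt (R : W → W → Prop) (val : P → Set W) {χ : Fm P} (hχ : IsFormula χ)
    (φ : Fm P) (k : ℕ) (e e' : ℕ → Set W) (hφ : IsFormulaAt (k + 1) φ)
    (h : ∀ i < k, e' i = e i) (hk : e' k = eval R val e χ) :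
    eval R val e (instAt χ k φ) = eval R val e' φ := by
  induction φ generalizing k e e' with
  | top => rfl
  | var p => rfl
  | bvar i =>
    by_cases hi : i = k
    · subst hi
      simp [instAt, eval, hk]
    · have : i < k + 1 := hφ
      simp only [instAt, hi, if_false, eval, h i (by omega)]
  | neg φ ih => simp [eval, instAt, ih k e e' hφ h hk]
  | wedge φ ψ ih1 ih2 => simp [eval, instAt, ih1 k e e' hφ.1 h hk, ih2 k e e' hφ.2 h hk]
  | dia φ ih => simp [eval, instAt, ih k e e' hφ h hk]
  | nu φ ih =>
    have : ∀ X : Set W, eval R val (push X e) (instAt χ (k + 1) φ) =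
        eval R val (push X e') φ := fun X =>
      ih (k + 1) _ _ hφ.1 (fun i hi => by
        cases i with
        | zero => rfl
        | succ i => exact h i (by omega)) (hk.trans (eval_closed R val hχ _ _))
    simp [eval, instAt, this]

theorem eval_subst (R : W → W → Prop) (val : P → Set W) (σ : P → Fm P)
    (φ : Fm P) (hφ : IsModal φ) (e : ℕ → Set W) :
    eval R val e (subst σ φ) = eval R (fun p => eval R val e (σ p)) e φ := by
  induction φ with
  | top => rfl
  | var p => rfl
  | bvar i => exact hφ.elim
  | neg φ ih => simp [eval, subst, ih hφ]
  | wedge φ ψ ih1 ih2 => simp [eval, subst, ih1 hφ.1, ih2 hφ.2]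
  | dia φ ih => simp [eval, subst, ih hφ]
  | nu φ ih => exact hφ.elim

/-- Truth is invariant under bounded morphisms. -/
theorem eval_preimage (R : W → W → Prop) (R' : W' → W' → Prop) (f : W → W')
    (forth : ∀ x y, R x y → R' (f x) (f y)) (back : ∀ x v, R' (f x) v → ∃ y, R x y ∧ f y = v)
    (val : P → Set W') (φ : Fm P) (k : ℕ) (e : ℕ → Set W') (hφ : IsFormulaAt k φ) :
    eval R (fun p => f ⁻¹' val p) (fun i => f ⁻¹' e i) φ = f ⁻¹' eval R' val e φ := by
  induction φ generalizing k e with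
  | top => rfl
  | var p => rfl
  | bvar i => rfl
  | neg φ ih => simp [eval, ih k e hφ]
  | wedge φ ψ ih1 ih2 => simp [eval, ih1 k e hφ.1, ih2 k e hφ.2]
  | dia φ ih =>
    ext x
    simp only [eval, ih k e hφ, Set.mem_ofPred_eq, Set.mem_preimage]
    constructor
    · rintro ⟨y, h1, h2⟩
      exact ⟨f y, forth _ _ h1, h2⟩
    · rintro ⟨v, h1, h2⟩
      obtain ⟨y, h3, rfl⟩ := back _ _ h1
      exact ⟨y, h3, h2⟩
  | nu φ ih =>
    have hpush : ∀ X : Set W', push (f ⁻¹' X) (fun i => f ⁻¹' e i) =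
        fun i => f ⁻¹' (push X e i) := fun X => by
      funext i
      cases i <;> rfl
    ext x
    constructor
    · rintro ⟨X, hX, hx⟩
      -- `X` need not be saturated for `f`, but it lies in the preimage of its image, and positivity
      -- of `φ` carries the inclusion over to the larger set.
      refine ⟨f '' X, ?_, ⟨x, hx, rfl⟩⟩
      rintro _ ⟨y, hy, rfl⟩
      have := eval_push_mono R (fun p => f ⁻¹' val p) (fun i => f ⁻¹' e i) hφ.2
        (Set.subset_preimage_image f X) (hX hy)
      rwa [hpush, ih (k + 1) _ hφ.1] at this
    · rintro ⟨X, hX, hx⟩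
      refine ⟨f ⁻¹' X, ?_, hx⟩
      show f ⁻¹' X ⊆ eval R _ (push (f ⁻¹' X) fun i => f ⁻¹' e i) φ
      rw [hpush, ih (k + 1) _ hφ.1]
      exact Set.preimage_mono hX

/-- The relation induced on the codomain of a map. -/
def mapRel (R : W → W → Prop) (f : W → W') (u v : W') : Prop :=
  ∃ x y, f x = u ∧ f y = v ∧ R x y

/-- Truth cannot distinguish points with the same value under `f`, if `f` induces a bounded
morphism and the valuation and the environment are `f`-invariant. -/
theorem eval_invariant (R : W → W → Prop) (f : W → W')
    (back : ∀ x₀ x y₀, f x₀ = f x → R x₀ y₀ → ∃ y, R x y ∧ f y = f y₀)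
    (val : P → Set W) (hval : ∀ p x y, f x = f y → x ∈ val p → y ∈ val p)
    (e : ℕ → Set W) (he : ∀ i x y, f x = f y → x ∈ e i → y ∈ e i)
    (φ : Fm P) (k : ℕ) (hφ : IsFormulaAt k φ) (x y : W) (hxy : f x = f y)
    (hx : x ∈ eval R val e φ) : y ∈ eval R val e φ := by
  have key : ∀ A : Set W, (∀ x y, f x = f y → x ∈ A → y ∈ A) → f ⁻¹' (f '' A) = A := by
    intro A hA
    refine Set.Subset.antisymm ?_ (Set.subset_preimage_image f A)
    rintro y ⟨x, hx, hxy⟩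
    exact hA x y hxy hx
  -- Invariant sets are preimages of their images, so the model is the pullback along `f` of a model
  -- on the codomain.
  have := eval_preimage R (mapRel R f) f (fun x y h => ⟨x, y, rfl, rfl, h⟩) (by
    rintro x v ⟨x₀, y₀, h1, rfl, h2⟩
    exact back x₀ x y₀ h1 h2) (fun p => f '' val p) φ k (fun i => f '' e i) hφ
  simp only [key _ (hval _), key _ (he _)] at this
  rw [this] at hx ⊢
  simpa [Set.mem_preimage, ← hxy] using hx

theorem eval_boolEval (R : W → W → Prop) (val : P → Set W) (e : ℕ → Set W) (w : W) (φ : Fm P) :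
    boolEval (fun ψ => w ∈ eval R val e ψ) φ ↔ w ∈ eval R val e φ := by
  induction φ with
  | top => simp [eval]
  | var p => rfl
  | bvar i => rfl
  | neg φ ih => simp [eval, ih]
  | wedge φ ψ ih1 ih2 => simp [eval, ih1, ih2]
  | dia φ ih => rfl
  | nu φ ih => rfl

variable (R : W → W → Prop) (val : P → Set W) (e : ℕ → Set W) (x : W) (φ ψ : Fm P)

theorem mem_eval_neg : x ∈ eval R val e (neg φ) ↔ x ∉ eval R val e φ := Iff.rfl
theorem mem_eval_wedge : x ∈ eval R val e (wedge φ ψ) ↔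
    x ∈ eval R val e φ ∧ x ∈ eval R val e ψ := Iff.rfl
theorem mem_eval_dia : x ∈ eval R val e (dia φ) ↔ ∃ y, R x y ∧ y ∈ eval R val e φ := Iff.rfl
theorem mem_eval_imp : x ∈ eval R val e (imp φ ψ) ↔
    (x ∈ eval R val e φ → x ∈ eval R val e ψ) := by
  simp [imp, mem_eval_neg, mem_eval_wedge]
theorem mem_eval_vee : x ∈ eval R val e (vee φ ψ) ↔
    (x ∈ eval R val e φ ∨ x ∈ eval R val e ψ) := by
  simp only [vee, mem_eval_neg, mem_eval_wedge]; tauto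
theorem mem_eval_iff : x ∈ eval R val e (iff φ ψ) ↔
    (x ∈ eval R val e φ ↔ x ∈ eval R val e ψ) := by
  simp only [iff, mem_eval_imp, mem_eval_wedge]; tauto
theorem mem_eval_box : x ∈ eval R val e (box φ) ↔ ∀ y, R x y → y ∈ eval R val e φ := by
  simp [box, mem_eval_neg, mem_eval_dia]
theorem mem_eval_bigWedge (l : List (Fm P)) : x ∈ eval R val e (bigWedge l) ↔
    ∀ φ ∈ l, x ∈ eval R val e φ := by
  induction l with
  | nil => simp [bigWedge, eval]
  | cons a l ih => simp [bigWedge, mem_eval_wedge, ih]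

end Eval
end Fm

section Frames
variable {P : Type u} {W : Type v} {W' : Type w}

/-- Surjective bounded morphisms preserve validity. -/
theorem ValidOn.map {R : W → W → Prop} {R' : W' → W' → Prop} {φ : Fm P} (hφ : IsFormula φ)
    (f : W → W') (hf : Function.Surjective f) (forth : ∀ x y, R x y → R' (f x) (f y))
    (back : ∀ x v, R' (f x) v → ∃ y, R x y ∧ f y = v) (h : ValidOn R φ) : ValidOn R' φ := by
  intro val v
  obtain ⟨x, rfl⟩ := hf v
  have := eval_preimage R R' f forth back val φ 0 (fun _ => ∅) hφ
  have h1 := h (fun p => f ⁻¹' val p) x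
  simp only [Set.preimage_empty] at this
  rw [this] at h1
  exact h1

theorem IsFrameOf.map {Λ : Set (Fm P)} (hΛ : ∀ φ ∈ Λ, IsFormula φ) {R : W → W → Prop}
    {R' : W' → W' → Prop} (f : W → W') (hf : Function.Surjective f)
    (forth : ∀ x y, R x y → R' (f x) (f y)) (back : ∀ x v, R' (f x) v → ∃ y, R x y ∧ f y = v)
    (h : IsFrameOf Λ R) : IsFrameOf Λ R' :=
  fun φ hφ => (h φ hφ).map (hΛ φ hφ) f hf forth back

end Frames

/-! ### Natural sublanguages and soundness -/

namespace IsNaturalSublanguage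
variable {P : Type u} {L : Set (Fm P)} (hL : IsNaturalSublanguage L)
include hL

theorem neg_mem_iff {φ : Fm P} : neg φ ∈ L ↔ φ ∈ L := ⟨hL.of_neg φ, hL.neg_mem φ⟩
theorem wedge_mem_iff {φ ψ : Fm P} : wedge φ ψ ∈ L ↔ φ ∈ L ∧ ψ ∈ L :=
  ⟨hL.of_wedge φ ψ, fun h => hL.wedge_mem φ h.1 ψ h.2⟩
theorem dia_mem_iff {φ : Fm P} : dia φ ∈ L ↔ φ ∈ L := ⟨hL.of_dia φ, hL.dia_mem φ⟩

theorem inst_mem {θ χ : Fm P} (hθ : nu θ ∈ L) (hχ : χ ∈ L) : inst θ χ ∈ L := by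
  classical
  obtain ⟨x, hx, hx'⟩ := hL.of_nu θ hθ
  have := hL.subst_mem _ hx' (fun p => if p = x then χ else var p) fun p => by
    by_cases h : p = x <;> simp [h, hχ]
  rw [inst, subst_instAt_var _ x θ 0 (fun p hp => if_neg hp) hx, if_pos rfl] at this
  exact this

theorem subst_mem_of_isModal {χ : Fm P} (h : IsModal χ) {σ : P → Fm P} (hσ : ∀ p, σ p ∈ L) :
    subst σ χ ∈ L := by
  induction χ with
  | top => exact hL.top_mem
  | var p => exact hσ p
  | bvar i => exact h.elim
  | neg φ ih => exact hL.neg_mem _ (ih h)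
  | wedge φ ψ ih1 ih2 => exact hL.wedge_mem _ (ih1 h.1) _ (ih2 h.2)
  | dia φ ih => exact hL.dia_mem _ (ih h)
  | nu φ ih => exact h.elim

theorem close_cons_mem {ρ : ℕ → Fm P} (hρ : ∀ i, ρ i ∈ L) {θ χ : Fm P}
    (hθ : nu (close ρ 1 θ) ∈ L) (hχ : χ ∈ L) : close (cons χ ρ) 0 θ ∈ L := by
  rw [← instAt_close χ ρ (fun i => hL.isFormula _ (hρ i)) θ 0]
  exact hL.inst_mem hθ hχ

theorem isNormalIn {Λ : Set (Fm P)} [Nonempty P] (hΛ : IsNormalLogic Λ) :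
    IsNormalIn L (muLogic Λ L) := by
  have hi : ∀ {φ ψ : Fm P}, imp φ ψ ∈ L ↔ φ ∈ L ∧ ψ ∈ L := by
    intro φ ψ; simp [imp, hL.neg_mem_iff, hL.wedge_mem_iff]
  have hb : ∀ {φ : Fm P}, box φ ∈ L ↔ φ ∈ L := by
    intro φ; simp [box, hL.neg_mem_iff, hL.dia_mem_iff]
  have hsub : muLogic Λ L ⊆ L := by
    intro φ hφ
    induction hφ with
    | taut φ h => exact h
    | mp φ ψ h1 h2 => exact h2
    | nec φ h => exact hb.2 h
    | distr φ ψ h1 h2 => simp [hi, hb, h1, h2]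
    | weakTrans φ h => simp [hi, vee, hL.neg_mem_iff, hL.wedge_mem_iff, hL.dia_mem_iff, h]
    | fixedPoint θ h => exact hi.2 ⟨h, hL.inst_mem h h⟩
    | induction φ θ h1 h2 => exact hi.2 ⟨h1, h2⟩
    | ax χ σ h1 h2 => exact hL.subst_mem_of_isModal (hΛ.isModal χ h1) h2
  exact {
    top_mem := hL.top_mem
    neg_mem := hL.neg_mem_iff
    wedge_mem := hL.wedge_mem_iff
    dia_mem := hL.dia_mem_iff
    sub := hsub
    taut := fun φ h1 h2 => .taut φ h1 h2
    mp := fun φ ψ h1 h2 => .mp φ ψ (hsub h1) (hi.1 (hsub h2)).2 h1 h2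
    nec := fun φ h => .nec φ (hsub h) h
    distr := .distr
    -- Duality of `◇` and `□` is not among the rules of `MuProvable`; it is obtained by substitution
    -- from the instance in `Λ` for a single variable.
    dual := fun φ hφ => by
      obtain ⟨p⟩ := ‹Nonempty P›
      exact .ax (iff (dia (var p)) (neg (box (neg (var p))))) (fun _ => φ)
        (hΛ.dual (var p) trivial) fun _ => hφ }

end IsNaturalSublanguage

/-- Frames with the weak transitivity axiom are weakly transitive. -/
theorem IsFrameOf.weakTrans {P : Type u} [Nonempty P] {Λ : Set (Fm P)} (hΛ : ContainsWK4 Λ)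
    {W : Type v} {R : W → W → Prop} (h : IsFrameOf Λ R) {x y z : W} (hxy : R x y) (hyz : R y z) :
    x = z ∨ R x z := by
  obtain ⟨p⟩ := ‹Nonempty P›
  have := h _ (hΛ (var p) trivial) (fun _ => {z}) x
  simp only [mem_eval_imp, mem_eval_vee, mem_eval_dia] at this
  rcases this ⟨y, hxy, z, hyz, rfl⟩ with h1 | ⟨s, h1, h2⟩
  · exact .inl h1
  · exact .inr (h2 ▸ h1)

/-- Soundness. -/
theorem IsFrameOf.muLogic {P : Type u} [Nonempty P] {Λ L : Set (Fm P)}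
    (hΛ : IsNormalLogic Λ) (hw : ContainsWK4 Λ) (hL : IsNaturalSublanguage L) {W : Type v}
    {R : W → W → Prop} (h : IsFrameOf Λ R) : IsFrameOf (muLogic Λ L) R := by
  have hn := hL.isNormalIn hΛ
  intro φ hφ
  induction hφ with
  | taut φ _ h2 => exact fun val x => (eval_boolEval R val _ x φ).1 (h2 _)
  | mp φ ψ _ _ _ _ ih1 ih2 =>
    intro val x
    exact (mem_eval_imp ..).1 (ih2 val x) (ih1 val x)
  | nec φ _ _ ih => exact fun val x => (mem_eval_box ..).2 fun y _ => ih val y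
  | distr φ ψ _ _ =>
    intro val x
    simp only [mem_eval_imp, mem_eval_box]
    exact fun h1 h2 y hy => h1 y hy (h2 y hy)
  | weakTrans φ _ =>
    intro val x
    simp only [mem_eval_imp, mem_eval_vee, mem_eval_dia]
    rintro ⟨y, hxy, z, hyz, hz⟩
    rcases h.weakTrans hw hxy hyz with rfl | h1
    · exact .inl hz
    · exact .inr ⟨z, h1, hz⟩
  | fixedPoint θ hθ =>
    intro val x
    have hf := hL.isFormula _ hθ
    rw [mem_eval_imp, inst, eval_instAt R val hf θ 0 _ (push (eval R val _ (nu θ)) fun _ => ∅)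
      hf.1 (fun i hi => absurd hi (Nat.not_lt_zero i)) rfl]
    rintro ⟨X, hX, hx⟩
    exact eval_push_mono R val _ hf.2 (Set.subset_sUnion_of_mem (t := X) hX) (hX hx)
  | induction φ θ hφ hθ _ ih =>
    intro val x
    have hf := hL.isFormula _ hθ
    rw [mem_eval_imp]
    refine fun hx => ⟨eval R val (fun _ => ∅) φ, fun y hy => ?_, hx⟩
    have := (mem_eval_imp ..).1 (ih val y) hy
    rwa [inst, eval_instAt R val (hL.isFormula _ hφ) θ 0 _ (push (eval R val _ φ) fun _ => ∅)
      hf.1 (fun i hi => absurd hi (Nat.not_lt_zero i)) rfl] at this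
  | ax χ σ hχ _ =>
    intro val x
    rw [eval_subst R val σ χ (hΛ.isModal χ hχ)]
    exact h χ hχ _ x

/-! ### Finite quotients of weakly transitive models of bounded depth -/

namespace FiniteQuotient

/-- The data of a cluster up to depth `k`, over a set `A` of labels. -/
def Data (A : Type u) : ℕ → Type u
  | 0 => PUnit
  | k + 1 => Set A × Set (Data A k)

instance finite_data (A : Type u) [Finite A] : ∀ k, Finite (Data A k)
  | 0 => inferInstanceAs (Finite PUnit)
  | k + 1 =>
    have := finite_data A k
    inferInstanceAs (Finite (Set A × Set (Data A k)))

variable {W : Type v} {A : Type u} (R : W → W → Prop) (τ : W → A)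

/-- `x` and `y` lie in the same cluster. -/
def Same (x y : W) : Prop := x = y ∨ (R x y ∧ R y x)

/-- The colour of a point, and whether the point sees this colour in its own cluster. -/
def label (x : W) : A × ULift.{u} Prop := (τ x, ⟨∃ y, R x y ∧ R y x ∧ τ y = τ x⟩)

/-- The data of the cluster of `x`: the labels in it, and the data of the later clusters. -/
def data : ∀ k, W → Data (A × ULift.{u} Prop) k
  | 0, _ => PUnit.unit
  | k + 1, x => ({a | ∃ y, Same R x y ∧ label R τ y = a}, {d | ∃ y, R x y ∧ ¬ R y x ∧ data k y = d})

variable {R τ} (trans : ∀ {x y z}, R x y → R y z → x = z ∨ R x z)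
include trans

theorem same_trans {x y z : W} (h1 : Same R x y) (h2 : Same R y z) : Same R x z := by
  rcases h1 with rfl | h1
  · exact h2
  rcases h2 with rfl | h2
  · exact .inr h1
  by_cases h : x = z
  · exact .inl h
  · exact .inr ⟨(trans h1.1 h2.1).resolve_left h,
      (trans h2.2 h1.2).resolve_left fun h' => h h'.symm⟩

omit trans in
theorem same_symm {x y : W} (h : Same R x y) : Same R y x := by
  rcases h with rfl | h
  · exact .inl rfl
  · exact .inr ⟨h.2, h.1⟩

/-- Weak transitivity behaves like transitivity here: if the end points were equal, the second arrow
could be reversed. -/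
theorem strict_of_same_left {x y z : W} (h : Same R x y) (h1 : R y z) (h2 : ¬ R z y) :
    R x z ∧ ¬ R z x := by
  rcases h with rfl | ⟨h3, h4⟩
  · exact ⟨h1, h2⟩
  have hxz : x ≠ z := fun e => h2 (e ▸ h3)
  refine ⟨(trans h3 h1).resolve_left hxz, fun h5 => ?_⟩
  rcases trans h5 h3 with rfl | h6
  · exact h2 h1
  · exact h2 h6

theorem strict_of_same_right {x y z : W} (h : Same R y z) (h1 : R x y) (h2 : ¬ R y x) :
    R x z ∧ ¬ R z x := by
  rcases h with rfl | ⟨h3, h4⟩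
  · exact ⟨h1, h2⟩
  have hxz : x ≠ z := fun e => h2 (e ▸ h3)
  refine ⟨(trans h1 h3).resolve_left hxz, fun h5 => ?_⟩
  rcases trans h3 h5 with rfl | h6
  · exact h2 h1
  · exact h2 h6

theorem data_eq_of_same {x y : W} (h : Same R x y) (k : ℕ) : data R τ k x = data R τ k y := by
  cases k with
  | zero => rfl
  | succ k =>
    refine Prod.ext (Set.ext fun a => ?_) (Set.ext fun d => ?_)
    · exact ⟨fun ⟨z, hz, ha⟩ => ⟨z, same_trans trans (same_symm h) hz, ha⟩,
        fun ⟨z, hz, ha⟩ => ⟨z, same_trans trans h hz, ha⟩⟩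
    · constructor
      · rintro ⟨z, h1, h2, hd⟩
        have := strict_of_same_left trans (same_symm h) h1 h2
        exact ⟨z, this.1, this.2, hd⟩
      · rintro ⟨z, h1, h2, hd⟩
        have := strict_of_same_left trans h h1 h2
        exact ⟨z, this.1, this.2, hd⟩

variable {rk : W → ℕ} (hrk : ∀ {x y}, R x y → ¬ R y x → rk y < rk x)
include hrk

-- Strict successors have smaller rank, so a point of rank at most `k` has nothing left to record
-- beyond level `k + 1`. Inductively, successors matched at one level are matched at the next.
omit trans in
theorem data_eq_succ {k : ℕ} {x y : W} (hx : rk x ≤ k) (hy : rk y ≤ k)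
    (h : data R τ (k + 1) x = data R τ (k + 1) y) :
    data R τ (k + 2) x = data R τ (k + 2) y := by
  induction k generalizing x y with
  | zero =>
    have h1 : ∀ z, rk z ≤ 0 → ∀ z', R z z' → ¬ R z' z → False := fun z hz z' h1 h2 => by
      have := hrk h1 h2
      omega
    have h0 : (data R τ 1 x).1 = (data R τ 1 y).1 := congrArg Prod.fst h
    refine Prod.ext h0 (Set.ext fun d => ?_)
    exact ⟨fun ⟨z, h2, h3, _⟩ => (h1 x hx z h2 h3).elim,
      fun ⟨z, h2, h3, _⟩ => (h1 y hy z h2 h3).elim⟩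
  | succ k ih =>
    have h1 : _ ∧ _ := ⟨congrArg Prod.fst h, congrArg Prod.snd h⟩
    refine Prod.ext h1.1 (Set.ext fun d => ?_)
    constructor
    · rintro ⟨z, hz, hz', rfl⟩
      obtain ⟨z', h2, h3, h4⟩ : data R τ (k + 1) z ∈ (data R τ (k + 2) y).2 :=
        h1.2 ▸ ⟨z, hz, hz', rfl⟩
      refine ⟨z', h2, h3, ih ?_ ?_ h4⟩
      · have := hrk h2 h3; omega
      · have := hrk hz hz'; omega
    · rintro ⟨z, hz, hz', rfl⟩
      obtain ⟨z', h2, h3, h4⟩ : data R τ (k + 1) z ∈ (data R τ (k + 2) x).2 :=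
        h1.2 ▸ ⟨z, hz, hz', rfl⟩
      refine ⟨z', h2, h3, ih ?_ ?_ h4⟩
      · have := hrk h2 h3; omega
      · have := hrk hz hz'; omega

/-- A successor in the same cluster is found through the labels recorded for the cluster. A strictly
later one is matched one level lower, and `data_eq_succ` restores the missing level. -/
theorem back {n : ℕ} (hn : ∀ x, rk x ≤ n) {x₀ x y₀ : W}
    (h : (label R τ x₀, data R τ (n + 2) x₀) = (label R τ x, data R τ (n + 2) x))
    (h₀ : R x₀ y₀) :
    ∃ y, R x y ∧ (label R τ y, data R τ (n + 2) y) = (label R τ y₀, data R τ (n + 2) y₀) := by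
  obtain ⟨hl, hd⟩ := Prod.ext_iff.1 h
  simp only at hl hd
  have hd1 : _ ∧ _ := ⟨congrArg Prod.fst hd, congrArg Prod.snd hd⟩
  by_cases h₁ : R y₀ x₀
  · obtain ⟨y, hy, hly⟩ : label R τ y₀ ∈ (data R τ (n + 2) x).1 :=
      hd1.1 ▸ ⟨y₀, .inr ⟨h₀, h₁⟩, rfl⟩
    have hdy : ∀ y, Same R x y → data R τ (n + 2) y = data R τ (n + 2) y₀ := fun y hy =>
      (data_eq_of_same trans (same_symm hy) _).trans
        (hd.symm.trans (data_eq_of_same trans (.inr ⟨h₀, h₁⟩) _))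
    rcases hy with rfl | hy
    -- The matching point is `x` itself, which may be irreflexive. But `y₀` shows that `x₀` sees its
    -- own colour within its cluster. The label of `x` records the same, and the point `y` obtained
    -- from it has the label of `x`, as `x` is the witness required at `y`.
    · have hτ : τ y₀ = τ x₀ := (congrArg Prod.fst hly).symm.trans (congrArg Prod.fst hl).symm
      have hex : ∃ y, R x y ∧ R y x ∧ τ y = τ x :=
        (congrArg (fun a => a.2.down) hl).mp ⟨y₀, h₀, h₁, hτ⟩
      obtain ⟨y, hy1, hy2, hy3⟩ := hex
      have hyx : label R τ y = label R τ x := by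
        refine Prod.ext hy3 (ULift.ext _ _ (propext ?_))
        exact ⟨fun _ => ⟨y, hy1, hy2, hy3⟩, fun _ => ⟨x, hy2, hy1, hy3.symm⟩⟩
      exact ⟨y, hy1, Prod.ext (hyx.trans hly) (hdy y (.inr ⟨hy1, hy2⟩))⟩
    · exact ⟨y, hy.1, Prod.ext hly (hdy y (.inr hy))⟩
  · obtain ⟨z, hz1, hz2, hz3⟩ : data R τ (n + 1) y₀ ∈ (data R τ (n + 2) x).2 :=
      hd1.2 ▸ ⟨y₀, h₀, h₁, rfl⟩
    obtain ⟨y, hy, hly⟩ : label R τ y₀ ∈ (data R τ (n + 1) z).1 :=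
      hz3 ▸ ⟨y₀, .inl rfl, rfl⟩
    have hxy := strict_of_same_right trans hy hz1 hz2
    have hzy : data R τ (n + 2) z = data R τ (n + 2) y₀ :=
      data_eq_succ (rk := rk) hrk (hn z) (hn y₀) hz3
    exact ⟨y, hxy.1, Prod.ext hly ((data_eq_of_same trans (same_symm hy) _).trans hzy)⟩

end FiniteQuotient

open FiniteQuotient in
/-- A weakly transitive model of bounded depth with finitely many colours has a bounded morphism
onto a finite frame that respects the colours. -/
theorem exists_finite_quotient {W : Type v} {A : Type u} [Finite A] (R : W → W → Prop) (τ : W → A)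
    (trans : ∀ {x y z}, R x y → R y z → x = z ∨ R x z) (rk : W → ℕ)
    (hrk : ∀ {x y}, R x y → ¬ R y x → rk y < rk x) (n : ℕ) (hn : ∀ x, rk x ≤ n) :
    ∃ (W' : Type u) (R' : W' → W' → Prop) (f : W → W'), Finite W' ∧ Function.Surjective f ∧
      (∀ x y, R x y → R' (f x) (f y)) ∧ (∀ x v, R' (f x) v → ∃ y, R x y ∧ f y = v) ∧
      ∀ x y, f x = f y → τ x = τ y := by
  let f : W → (A × ULift.{u} Prop) × Data (A × ULift.{u} Prop) (n + 2) :=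
    fun x => (label R τ x, data R τ (n + 2) x)
  refine ⟨Set.range f, mapRel R (Set.rangeFactorization f), Set.rangeFactorization f,
    inferInstance, Set.rangeFactorization_surjective, fun x y h => ⟨x, y, rfl, rfl, h⟩, ?_, ?_⟩
  · rintro x v ⟨x₀, y₀, h1, rfl, h2⟩
    obtain ⟨y, hy, hy'⟩ := back (R := R) (τ := τ) trans hrk hn (Subtype.ext_iff.1 h1) h2
    exact ⟨y, hy, Subtype.ext hy'⟩
  · intro x y h
    exact congrArg (fun a => a.1.1) (Subtype.ext_iff.1 h)

/-! ### Logics with fixed points and the closure of a formula -/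

/-- A normal logic in a natural language with the weak transitivity axiom, the fixed point axiom,
and the induction rule. -/
structure IsMuNormal {P : Type u} (L Th : Set (Fm P)) : Prop extends IsNormalIn L Th where
  natural : IsNaturalSublanguage L
  weakTrans : ∀ φ ∈ L, imp (dia (dia φ)) (vee φ (dia φ)) ∈ Th
  fixedPoint : ∀ θ, nu θ ∈ L → imp (nu θ) (inst θ (nu θ)) ∈ Th
  induction : ∀ φ θ, φ ∈ L → nu θ ∈ L → imp φ (inst θ φ) ∈ Th → imp φ (nu θ) ∈ Th

theorem IsNaturalSublanguage.isMuNormal {P : Type u} [Nonempty P] {Λ L : Set (Fm P)}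
    (hL : IsNaturalSublanguage L) (hΛ : IsNormalLogic Λ) : IsMuNormal L (muLogic Λ L) where
  toIsNormalIn := hL.isNormalIn hΛ
  natural := hL
  weakTrans := .weakTrans
  fixedPoint := .fixedPoint
  induction := .induction

namespace Fm
variable {P : Type u}

/-- `φ` holds here or at a successor. -/
def plus (φ : Fm P) : Fm P := vee φ (dia φ)

/-- `φ` holds here and at all successors. -/
def boxPlus (φ : Fm P) : Fm P := wedge φ (box φ)

/-- The finitely many formulas that control the truth of `φ` with its loose bound variables
replaced by `ρ`. -/
def cl : Fm P → (ℕ → Fm P) → Set (Fm P)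
  | top, _ => {top}
  | var p, _ => {var p}
  | bvar i, ρ => {ρ i}
  | neg φ, ρ => insert (neg (close ρ 0 φ)) (cl φ ρ)
  | wedge φ ψ, ρ => insert (wedge (close ρ 0 φ) (close ρ 0 ψ)) (cl φ ρ ∪ cl ψ ρ)
  | dia φ, ρ => insert (dia (close ρ 0 φ)) (cl φ ρ)
  | nu φ, ρ => insert (nu (close ρ 1 φ)) (cl φ (cons (nu (close ρ 1 φ)) ρ))

theorem finite_cl (φ : Fm P) (ρ : ℕ → Fm P) : (cl φ ρ).Finite := by
  induction φ generalizing ρ with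
  | top => exact Set.finite_singleton _
  | var p => exact Set.finite_singleton _
  | bvar i => exact Set.finite_singleton _
  | neg φ ih => exact (ih ρ).insert _
  | wedge φ ψ ih1 ih2 => exact ((ih1 ρ).union (ih2 ρ)).insert _
  | dia φ ih => exact (ih ρ).insert _
  | nu φ ih => exact (ih _).insert _

theorem close_mem_cl (φ : Fm P) (ρ : ℕ → Fm P) : close ρ 0 φ ∈ cl φ ρ := by
  cases φ <;> simp [cl, close]

theorem var_mem_cl {φ : Fm P} {p : P} (h : Occurs p φ) (ρ : ℕ → Fm P) : var p ∈ cl φ ρ := by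
  induction φ generalizing ρ with
  | top => exact h.elim
  | var q => exact congrArg var h.symm
  | bvar i => exact h.elim
  | neg φ ih => exact .inr (ih h ρ)
  | wedge φ ψ ih1 ih2 => exact .inr (h.imp (ih1 · ρ) (ih2 · ρ))
  | dia φ ih => exact .inr (ih h ρ)
  | nu φ ih => exact .inr (ih h _)

theorem cons_mem {L : Set (Fm P)} {χ : Fm P} {ρ : ℕ → Fm P} (hχ : χ ∈ L) (hρ : ∀ i, ρ i ∈ L) :
    ∀ i, cons χ ρ i ∈ L
  | 0 => hχ
  | i + 1 => hρ i

theorem cl_subset {L : Set (Fm P)} (hL : IsNaturalSublanguage L) (φ : Fm P) (ρ : ℕ → Fm P)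
    (hρ : ∀ i, ρ i ∈ L) (h : close ρ 0 φ ∈ L) : cl φ ρ ⊆ L := by
  induction φ generalizing ρ with
  | top => exact Set.singleton_subset_iff.2 h
  | var p => exact Set.singleton_subset_iff.2 h
  | bvar i => exact Set.singleton_subset_iff.2 h
  | neg φ ih => exact Set.insert_subset h (ih ρ hρ (hL.of_neg _ h))
  | wedge φ ψ ih1 ih2 =>
    have := hL.of_wedge _ _ h
    exact Set.insert_subset h (Set.union_subset (ih1 ρ hρ this.1) (ih2 ρ hρ this.2))
  | dia φ ih => exact Set.insert_subset h (ih ρ hρ (hL.of_dia _ h))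
  | nu φ ih =>
    exact Set.insert_subset h (ih _ (cons_mem h hρ) (hL.close_cons_mem hρ h h))

end Fm

/-! ### Final points, local replacement and definability in the canonical model -/

namespace MCS
variable {P : Type u} {L Th : Set (Fm P)}

/-- The reflexive closure of the accessibility relation. -/
def le (T S : MCS L Th) : Prop := T = S ∨ rel T S

variable (h : IsMuNormal L Th)
include h

theorem plus_mem_iff {φ : Fm P} : plus φ ∈ L ↔ φ ∈ L := by
  simp [plus, h.vee_mem, h.dia_mem]

theorem boxPlus_mem_iff {φ : Fm P} : boxPlus φ ∈ L ↔ φ ∈ L := by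
  simp [boxPlus, h.wedge_mem, h.box_mem]

theorem mem_plus {φ : Fm P} (hφ : φ ∈ L) {T : MCS L Th} :
    plus φ ∈ T.1 ↔ ∃ S, le T S ∧ φ ∈ S.1 := by
  rw [plus, mem_vee h.1 T hφ (h.dia_mem.2 hφ), mem_dia h.1 T hφ]
  constructor
  · rintro (h1 | ⟨S, h1, h2⟩)
    · exact ⟨T, .inl rfl, h1⟩
    · exact ⟨S, .inr h1, h2⟩
  · rintro ⟨S, rfl | h1, h2⟩
    · exact .inl h2
    · exact .inr ⟨S, h1, h2⟩

theorem mem_boxPlus {φ : Fm P} (hφ : φ ∈ L) {T : MCS L Th} :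
    boxPlus φ ∈ T.1 ↔ ∀ S, le T S → φ ∈ S.1 := by
  rw [boxPlus, mem_wedge h.1, mem_box h.1 T hφ]
  constructor
  · rintro ⟨h1, h2⟩ S (rfl | h3)
    · exact h1
    · exact h2 S h3
  · exact fun h1 => ⟨h1 T (.inl rfl), fun S hS => h1 S (.inr hS)⟩

/-- If `T ≠ U` and `U` is not a successor of `T`, take `χ` in `T` but not in `U`, and `φ` outside
`U` with `□φ` in `T`. The weak transitivity axiom for `¬(φ ∨ χ)` then fails at `T`. -/
theorem rel_trans {T S U : MCS L Th} (h1 : rel T S) (h2 : rel S U) : T = U ∨ rel T U := by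
  by_contra hc
  push Not at hc
  obtain ⟨hne, hr⟩ := hc
  obtain ⟨φ, hφ, hφ'⟩ : ∃ φ, box φ ∈ T.1 ∧ φ ∉ U.1 := by simpa [rel] using hr
  obtain ⟨χ, hχ, hχ', hχ''⟩ : ∃ χ ∈ L, χ ∈ T.1 ∧ χ ∉ U.1 := by
    by_contra hc
    push Not at hc
    exact hne (ext_mem hc)
  have hφL := h.box_mem.1 (T.2.sub hφ)
  have hvL : vee φ χ ∈ L := h.vee_mem.2 ⟨hφL, hχ⟩
  have hL : neg (vee φ χ) ∈ L := h.neg_mem.2 hvL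
  have h3 := T.2.thm (h.weakTrans _ hL)
  rw [mem_imp h.1 T (h.dia_mem.2 (h.dia_mem.2 hL)) (h.vee_mem.2 ⟨hL, h.dia_mem.2 hL⟩),
    mem_vee h.1 T hL (h.dia_mem.2 hL), mem_dia h.1 T (h.dia_mem.2 hL), mem_dia h.1 T hL] at h3
  have key : ∀ V : MCS L Th, neg (vee φ χ) ∈ V.1 ↔ φ ∉ V.1 ∧ χ ∉ V.1 := fun V => by
    rw [mem_neg V hvL, mem_vee h.1 V hφL hχ, not_or]
  rcases h3 ⟨S, h1, (mem_dia h.1 S hL).2 ⟨U, h2, (key U).2 ⟨hφ', hχ''⟩⟩⟩ with h4 | ⟨V, h4, h5⟩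
  · exact ((key T).1 h4).2 hχ'
  · exact ((key V).1 h5).1 (h4 φ hφ)

theorem le_trans {T S U : MCS L Th} (h1 : le T S) (h2 : le S U) : le T U := by
  rcases h1 with rfl | h1
  · exact h2
  rcases h2 with rfl | h2
  · exact .inr h1
  exact rel_trans h h1 h2

/-- The disjunction of a formula whose box is in `T` with a formula in `T` holds at `T` and all its
successors. So a single formula refutes both alternatives of `le T S`. -/
theorem le_of_boxPlus {T S : MCS L Th} (H : ∀ φ ∈ L, boxPlus φ ∈ T.1 → φ ∈ S.1) : le T S := by
  by_contra hc
  simp only [le, not_or] at hc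
  obtain ⟨hne, hr⟩ := hc
  obtain ⟨φ, hφ, hφ'⟩ : ∃ φ, box φ ∈ T.1 ∧ φ ∉ S.1 := by simpa [rel] using hr
  obtain ⟨χ, hχ, hχ', hχ''⟩ : ∃ χ ∈ L, χ ∈ T.1 ∧ χ ∉ S.1 := by
    by_contra hc
    push Not at hc
    exact hne (ext_mem hc)
  have hφL := h.box_mem.1 (T.2.sub hφ)
  have hvL : vee φ χ ∈ L := h.vee_mem.2 ⟨hφL, hχ⟩
  have := H _ hvL ((mem_boxPlus h hvL).2 fun V hV => by
    rw [mem_vee h.1 V hφL hχ]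
    rcases hV with rfl | hV
    · exact .inr hχ'
    · exact .inl (hV φ hφ))
  rw [mem_vee h.1 S hφL hχ] at this
  tauto

theorem boxPlus_mono {φ : Fm P} (hφ : φ ∈ L) {T S : MCS L Th} (hTS : le T S)
    (hT : boxPlus φ ∈ T.1) : boxPlus φ ∈ S.1 :=
  (mem_boxPlus h hφ).2 fun V hV => (mem_boxPlus h hφ).1 hT V (le_trans h hTS hV)

theorem plus_anti {φ : Fm P} (hφ : φ ∈ L) {T S : MCS L Th} (hTS : le T S)
    (hS : plus φ ∈ S.1) : plus φ ∈ T.1 := by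
  obtain ⟨V, hV, hV'⟩ := (mem_plus h hφ).1 hS
  exact (mem_plus h hφ).2 ⟨V, le_trans h hTS hV, hV'⟩

omit h in
/-- `T` lies in a last cluster with `plus ψ`, for some `ψ` in `Δ`. -/
def Final (Δ : Set (Fm P)) (T : MCS L Th) : Prop :=
  ∃ ψ ∈ Δ, plus ψ ∈ T.1 ∧ ∀ V, le T V → plus ψ ∈ V.1 → le V T

theorem Final.of_same {Δ : Set (Fm P)} (hΔ : Δ ⊆ L) {T S : MCS L Th} (hT : Final Δ T)
    (h1 : le T S) (h2 : le S T) : Final Δ S := by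
  obtain ⟨ψ, hψ, h3, h4⟩ := hT
  exact ⟨ψ, hψ, plus_anti h (hΔ hψ) h2 h3, fun V hV hV' =>
    le_trans h (h4 V (le_trans h h1 hV) hV') h1⟩

/-- Zorn's lemma for the points above `T` that contain `ψ`. Chains are bounded by compactness: any
finite part of what a chain forces on later points is already forced by one member, which contains
`ψ`. -/
theorem exists_maximal {ψ : Fm P} (hψ : ψ ∈ L) {T : MCS L Th} (hT : ψ ∈ T.1) :
    ∃ S, le T S ∧ ψ ∈ S.1 ∧ ∀ V, le S V → ψ ∈ V.1 → le V S := by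
  obtain ⟨m, hm⟩ := exists_maximal_of_chains_bounded
    (α := {V : MCS L Th // le T V ∧ ψ ∈ V.1}) (r := fun A B => le A.1 B.1) (by
      intro c hc
      rcases c.eq_empty_or_nonempty with rfl | ⟨V₀, hV₀⟩
      · exact ⟨⟨T, .inl rfl, hT⟩, by simp⟩
      -- Avoiding `¬ψ` is the same as containing `ψ`; containing this `Γ` puts `U` above the whole
      -- chain, by `le_of_boxPlus`.
      obtain ⟨U, hU, hU'⟩ := h.exists_mcs
        (Γ := {χ | χ ∈ L ∧ ∃ V ∈ c, boxPlus χ ∈ V.1.1}) (fun χ hχ => hχ.1)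
        (h.neg_mem.2 hψ) (by
          rintro ⟨l, hl, hl'⟩
          have : ∃ V ∈ c, ∀ χ ∈ l, boxPlus χ ∈ V.1.1 := by
            clear hl'
            induction l with
            | nil => exact ⟨V₀, hV₀, by simp⟩
            | cons a l ih =>
              obtain ⟨V, hV, h1⟩ := ih fun χ hχ => hl χ (List.mem_cons_of_mem _ hχ)
              obtain ⟨haL, V', hV', h2⟩ := hl a List.mem_cons_self
              have htot : le V.1 V'.1 ∨ le V'.1 V.1 := by
                by_cases hVV : V = V'
                · exact .inl (.inl (congrArg _ hVV))
                · exact hc hV hV' hVV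
              rcases htot with hs | hs
              · refine ⟨V', hV', fun χ hχ => ?_⟩
                rcases List.mem_cons.1 hχ with rfl | hχ
                · exact h2
                · exact boxPlus_mono h (hl χ (List.mem_cons_of_mem _ hχ)).1 hs (h1 χ hχ)
              · refine ⟨V, hV, fun χ hχ => ?_⟩
                rcases List.mem_cons.1 hχ with rfl | hχ
                · exact boxPlus_mono h haL hs h2
                · exact h1 χ hχ
          obtain ⟨V, hV, h1⟩ := this
          have h2 := mem_of_entails h.1 V.1 (Γ := {χ | χ ∈ l})
            (fun χ hχ => (mem_boxPlus h (hl χ hχ).1).1 (h1 χ hχ) _ (.inl rfl))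
            ⟨l, fun _ h => h, hl'⟩
          exact (mem_neg V.1 hψ).1 h2 V.2.2)
      have hle : ∀ V ∈ c, le V.1 U := fun V hV =>
        le_of_boxPlus h fun χ hχ hχ' => hU ⟨hχ, V, hV, hχ'⟩
      rw [mem_neg U hψ, not_not] at hU'
      exact ⟨⟨U, le_trans h V₀.2.1 (hle V₀ hV₀), hU'⟩, hle⟩)
    (fun {a b c} hab hbc => le_trans h hab hbc)
  exact ⟨m.1, m.2.1, m.2.2, fun V hV hψV => hm ⟨V, le_trans h m.2.1 hV, hψV⟩ hV⟩

/-- A point that is maximal for `ψ` is also maximal for `plus ψ`, since a point with `plus ψ` lies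
below one with `ψ`. -/
theorem exists_final {Δ : Set (Fm P)} (hΔ : Δ ⊆ L) {ψ : Fm P} (hψ : ψ ∈ Δ) {T : MCS L Th}
    (hT : ψ ∈ T.1) : ∃ S, le T S ∧ Final Δ S ∧ ψ ∈ S.1 := by
  obtain ⟨S, h1, h2, h3⟩ := exists_maximal h (hΔ hψ) hT
  refine ⟨S, h1, ⟨ψ, hψ, (mem_plus h (hΔ hψ)).2 ⟨S, .inl rfl, h2⟩, fun V hV hV' => ?_⟩, h2⟩
  obtain ⟨U, hU, hU'⟩ := (mem_plus h (hΔ hψ)).1 hV'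
  exact le_trans h hU (h3 U (le_trans h hV hU) hU')

/-- The number of formulas of `Δ` that hold here or later drops at strictly later points. -/
theorem ncard_lt {Δ : Set (Fm P)} (hΔ : Δ ⊆ L) (hfin : Δ.Finite) {T S : MCS L Th}
    (hT : Final Δ T) (h1 : le T S) (h2 : ¬ le S T) :
    {ψ ∈ Δ | plus ψ ∈ S.1}.ncard < {ψ ∈ Δ | plus ψ ∈ T.1}.ncard := by
  obtain ⟨ψ, hψ, h3, h4⟩ := hT
  refine Set.ncard_lt_ncard (Set.ssubset_iff_of_subset ?_ |>.2 ⟨ψ, ⟨hψ, h3⟩, ?_⟩)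
    (hfin.subset fun _ h => h.1)
  · exact fun χ hχ => ⟨hχ.1, plus_anti h (hΔ hχ.1) h1 hχ.2⟩
  · exact fun hc => h2 (h4 S h1 hc.2)

theorem mem_inst_of_mem_nu {θ : Fm P} {T : MCS L Th} (hT : nu θ ∈ T.1) :
    inst θ (nu θ) ∈ T.1 := by
  have hL := T.2.sub hT
  exact (mem_imp h.1 T hL (h.natural.inst_mem hL hL)).1 (T.2.thm (h.fixedPoint θ hL)) hT

/-- The induction rule, relative to a formula `δ` that holds here and later. -/
theorem mem_nu_of_local {A δ θ : Fm P} (hA : A ∈ L) (hδ : δ ∈ L) (hθ : nu θ ∈ L)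
    (H : ∀ V : MCS L Th, boxPlus δ ∈ V.1 → A ∈ V.1 → inst θ (wedge A (boxPlus δ)) ∈ V.1)
    {T : MCS L Th} (hT : boxPlus δ ∈ T.1) (hT' : A ∈ T.1) : nu θ ∈ T.1 := by
  have hL : wedge A (boxPlus δ) ∈ L := h.wedge_mem.2 ⟨hA, (boxPlus_mem_iff h).2 hδ⟩
  -- The rule applies to theorems only, so the local assumption `boxPlus δ` is made part of the
  -- invariant.
  have h1 := h.induction _ θ hL hθ (thm_of_forall_mem h.1
    (h.imp_mem.2 ⟨hL, h.natural.inst_mem hθ hL⟩) fun V => by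
      rw [mem_imp h.1 V hL (h.natural.inst_mem hθ hL), mem_wedge h.1]
      exact fun h1 => H V h1.2 h1.1)
  exact (mem_imp h.1 T hL hθ).1 (T.2.thm h1) ((mem_wedge h.1 T).2 ⟨hT', hT⟩)

theorem inst_close {ρ : ℕ → Fm P} (hρ : ∀ i, ρ i ∈ L) (θ χ : Fm P) :
    inst (close ρ 1 θ) χ = close (cons χ ρ) 0 θ :=
  instAt_close χ ρ (fun i => h.natural.isFormula _ (hρ i)) θ 0

/-- Replacement of formulas that are related here and later. -/
theorem close_mono {δ : Fm P} (hδ : δ ∈ L) (φ : Fm P) (b : Bool) (ρ₁ ρ₂ : ℕ → Fm P)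
    (hρ₁ : ∀ i, ρ₁ i ∈ L) (hρ₂ : ∀ i, ρ₂ i ∈ L) (h₁ : close ρ₁ 0 φ ∈ L) (h₂ : close ρ₂ 0 φ ∈ L)
    (H : ∀ i, (∀ T : MCS L Th, boxPlus δ ∈ T.1 → ρ₁ i ∈ T.1 → ρ₂ i ∈ T.1) ∧
      (Pol b i φ ∨ ∀ T : MCS L Th, boxPlus δ ∈ T.1 → ρ₂ i ∈ T.1 → ρ₁ i ∈ T.1))
    (T : MCS L Th) (hT : boxPlus δ ∈ T.1) :
    bif b then close ρ₁ 0 φ ∈ T.1 → close ρ₂ 0 φ ∈ T.1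
      else close ρ₂ 0 φ ∈ T.1 → close ρ₁ 0 φ ∈ T.1 := by
  induction φ generalizing b ρ₁ ρ₂ T with
  | top => cases b <;> exact id
  | var p => cases b <;> exact id
  | bvar i =>
    cases b
    · rcases (H i).2 with h1 | h1
      · exact absurd (h1 rfl) (by simp)
      · exact h1 T hT
    · exact (H i).1 T hT
  | neg φ ih =>
    have h₁' := h.neg_mem.1 h₁
    have h₂' := h.neg_mem.1 h₂
    have := ih (!b) ρ₁ ρ₂ hρ₁ hρ₂ h₁' h₂' H T hT
    simp only [close, mem_neg T h₁', mem_neg T h₂']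
    cases b
    · exact fun h1 h2 => h1 (this h2)
    · exact fun h1 h2 => h1 (this h2)
  | wedge φ ψ ih1 ih2 =>
    have h₁' := h.wedge_mem.1 h₁
    have h₂' := h.wedge_mem.1 h₂
    have h3 := ih1 b ρ₁ ρ₂ hρ₁ hρ₂ h₁'.1 h₂'.1 (fun i => ⟨(H i).1, (H i).2.imp_left And.left⟩) T hT
    have h4 := ih2 b ρ₁ ρ₂ hρ₁ hρ₂ h₁'.2 h₂'.2 (fun i => ⟨(H i).1, (H i).2.imp_left And.right⟩) T hT
    simp only [close, mem_wedge h.1]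
    cases b
    · exact And.imp h3 h4
    · exact And.imp h3 h4
  | dia φ ih =>
    have h₁' := h.dia_mem.1 h₁
    have h₂' := h.dia_mem.1 h₂
    have h3 := ih b ρ₁ ρ₂ hρ₁ hρ₂ h₁' h₂' H
    simp only [close, mem_dia h.1 T h₁', mem_dia h.1 T h₂']
    cases b
    · exact fun ⟨S, h4, h5⟩ => ⟨S, h4, h3 S (boxPlus_mono h hδ (.inr h4) hT) h5⟩
    · exact fun ⟨S, h4, h5⟩ => ⟨S, h4, h3 S (boxPlus_mono h hδ (.inr h4) hT) h5⟩
  | nu φ ih =>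
    have hδ' := (boxPlus_mem_iff h).2 hδ
    cases b
    -- Replacement under `ν` is an application of the local induction rule. The invariant is the
    -- fixed point to be included, conjoined with `boxPlus δ`; where `boxPlus δ` holds the two
    -- agree, so the induction hypothesis for the body applies in either polarity.
    · have hA : wedge (nu (close ρ₂ 1 φ)) (boxPlus δ) ∈ L := h.wedge_mem.2 ⟨h₂, hδ'⟩
      refine fun h3 => mem_nu_of_local h h₂ hδ h₁ (fun V hV hV' => ?_) hT h3
      rw [inst_close h hρ₁]
      have h4 := mem_inst_of_mem_nu h hV'
      rw [inst_close h hρ₂] at h4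
      refine ih false _ _ (cons_mem hA hρ₁) (cons_mem h₂ hρ₂)
        (h.natural.close_cons_mem hρ₁ h₁ hA) (h.natural.close_cons_mem hρ₂ h₂ h₂) (fun i => ?_) V hV h4
      cases i with
      | zero => exact ⟨fun U hU hU' => ((mem_wedge h.1 U).1 hU').1, .inr fun U hU hU' =>
          (mem_wedge h.1 U).2 ⟨hU', hU⟩⟩
      | succ i => exact H i
    · have hA : wedge (nu (close ρ₁ 1 φ)) (boxPlus δ) ∈ L := h.wedge_mem.2 ⟨h₁, hδ'⟩
      refine fun h3 => mem_nu_of_local h h₁ hδ h₂ (fun V hV hV' => ?_) hT h3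
      rw [inst_close h hρ₂]
      have h4 := mem_inst_of_mem_nu h hV'
      rw [inst_close h hρ₁] at h4
      refine ih true _ _ (cons_mem h₁ hρ₁) (cons_mem hA hρ₂)
        (h.natural.close_cons_mem hρ₁ h₁ h₁) (h.natural.close_cons_mem hρ₂ h₂ hA) (fun i => ?_) V hV h4
      cases i with
      | zero => exact ⟨fun U hU hU' => (mem_wedge h.1 U).2 ⟨hU', hU⟩, .inr fun U hU hU' =>
          ((mem_wedge h.1 U).1 hU').1⟩
      | succ i => exact H i

theorem close_congr {δ : Fm P} (hδ : δ ∈ L) (φ : Fm P) (ρ₁ ρ₂ : ℕ → Fm P)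
    (hρ₁ : ∀ i, ρ₁ i ∈ L) (hρ₂ : ∀ i, ρ₂ i ∈ L) (h₁ : close ρ₁ 0 φ ∈ L) (h₂ : close ρ₂ 0 φ ∈ L)
    (H : ∀ i, ∀ T : MCS L Th, boxPlus δ ∈ T.1 → (ρ₁ i ∈ T.1 ↔ ρ₂ i ∈ T.1))
    (T : MCS L Th) (hT : boxPlus δ ∈ T.1) : close ρ₁ 0 φ ∈ T.1 ↔ close ρ₂ 0 φ ∈ T.1 :=
  ⟨close_mono h hδ φ true ρ₁ ρ₂ hρ₁ hρ₂ h₁ h₂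
      (fun i => ⟨fun U hU => (H i U hU).1, .inr fun U hU => (H i U hU).2⟩) T hT,
    close_mono h hδ φ true ρ₂ ρ₁ hρ₂ hρ₁ h₂ h₁
      (fun i => ⟨fun U hU => (H i U hU).2, .inr fun U hU => (H i U hU).1⟩) T hT⟩

/-- This serves to transfer `HasFinal` from one choice of `ρ` to another that is equivalent to it
from some point on. -/
theorem cl_congr {δ : Fm P} (hδ : δ ∈ L) (φ : Fm P) (ρ₁ ρ₂ : ℕ → Fm P)
    (hρ₁ : ∀ i, ρ₁ i ∈ L) (hρ₂ : ∀ i, ρ₂ i ∈ L) (h₁ : close ρ₁ 0 φ ∈ L) (h₂ : close ρ₂ 0 φ ∈ L)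
    (H : ∀ i, ∀ T : MCS L Th, boxPlus δ ∈ T.1 → (ρ₁ i ∈ T.1 ↔ ρ₂ i ∈ T.1)) :
    ∀ β ∈ cl φ ρ₁, ∃ β' ∈ cl φ ρ₂, ∀ T : MCS L Th, boxPlus δ ∈ T.1 → (β ∈ T.1 ↔ β' ∈ T.1) := by
  have self : ∀ β, β = close ρ₁ 0 φ → ∃ β' ∈ cl φ ρ₂, ∀ T : MCS L Th,
      boxPlus δ ∈ T.1 → (β ∈ T.1 ↔ β' ∈ T.1) := by
    rintro β rfl
    exact ⟨_, close_mem_cl φ ρ₂, close_congr h hδ φ ρ₁ ρ₂ hρ₁ hρ₂ h₁ h₂ H⟩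
  induction φ generalizing ρ₁ ρ₂ with
  | top => exact self
  | var p => exact self
  | bvar i => exact self
  | neg φ ih =>
    rintro β (hβ | hβ)
    · exact self β hβ
    · obtain ⟨β', h3, h4⟩ := ih ρ₁ ρ₂ hρ₁ hρ₂ (h.neg_mem.1 h₁) (h.neg_mem.1 h₂) H (by
        rintro β rfl
        exact ⟨_, close_mem_cl φ ρ₂, close_congr h hδ φ ρ₁ ρ₂ hρ₁ hρ₂ (h.neg_mem.1 h₁)
          (h.neg_mem.1 h₂) H⟩) β hβ
      exact ⟨β', .inr h3, h4⟩
  | wedge φ ψ ih1 ih2 =>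
    have h₁' := h.wedge_mem.1 h₁
    have h₂' := h.wedge_mem.1 h₂
    rintro β (hβ | hβ | hβ)
    · exact self β hβ
    · obtain ⟨β', h3, h4⟩ := ih1 ρ₁ ρ₂ hρ₁ hρ₂ h₁'.1 h₂'.1 H (by
        rintro β rfl
        exact ⟨_, close_mem_cl φ ρ₂, close_congr h hδ φ ρ₁ ρ₂ hρ₁ hρ₂ h₁'.1 h₂'.1 H⟩) β hβ
      exact ⟨β', .inr (.inl h3), h4⟩
    · obtain ⟨β', h3, h4⟩ := ih2 ρ₁ ρ₂ hρ₁ hρ₂ h₁'.2 h₂'.2 H (by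
        rintro β rfl
        exact ⟨_, close_mem_cl ψ ρ₂, close_congr h hδ ψ ρ₁ ρ₂ hρ₁ hρ₂ h₁'.2 h₂'.2 H⟩) β hβ
      exact ⟨β', .inr (.inr h3), h4⟩
  | dia φ ih =>
    rintro β (hβ | hβ)
    · exact self β hβ
    · obtain ⟨β', h3, h4⟩ := ih ρ₁ ρ₂ hρ₁ hρ₂ (h.dia_mem.1 h₁) (h.dia_mem.1 h₂) H (by
        rintro β rfl
        exact ⟨_, close_mem_cl φ ρ₂, close_congr h hδ φ ρ₁ ρ₂ hρ₁ hρ₂ (h.dia_mem.1 h₁)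
          (h.dia_mem.1 h₂) H⟩) β hβ
      exact ⟨β', .inr h3, h4⟩
  | nu φ ih =>
    rintro β (hβ | hβ)
    · exact self β hβ
    · have H' : ∀ i, ∀ T : MCS L Th, boxPlus δ ∈ T.1 →
          (cons (nu (close ρ₁ 1 φ)) ρ₁ i ∈ T.1 ↔ cons (nu (close ρ₂ 1 φ)) ρ₂ i ∈ T.1) := by
        intro i
        cases i with
        | zero => exact close_congr h hδ (nu φ) ρ₁ ρ₂ hρ₁ hρ₂ h₁ h₂ H
        | succ i => exact H i
      have h₁' := h.natural.close_cons_mem hρ₁ h₁ h₁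
      have h₂' := h.natural.close_cons_mem hρ₂ h₂ h₂
      obtain ⟨β', h3, h4⟩ := ih _ _ (cons_mem h₁ hρ₁) (cons_mem h₂ hρ₂) h₁' h₂' H' (by
        rintro β rfl
        exact ⟨_, close_mem_cl φ _, close_congr h hδ φ _ _ (cons_mem h₁ hρ₁)
          (cons_mem h₂ hρ₂) h₁' h₂' H'⟩) β hβ
      exact ⟨β', .inr h3, h4⟩

/-- A property of points that depends on the truth of finitely many formulas only is definable. -/
theorem exists_definition {Ξ : Set (Fm P)} (hfin : Ξ.Finite) (hΞ : Ξ ⊆ L)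
    (Q : MCS L Th → Prop) (hQ : ∀ A B, (∀ ξ ∈ Ξ, ξ ∈ A.1 ↔ ξ ∈ B.1) → Q A → Q B) :
    ∃ κ ∈ L, ∀ T : MCS L Th, κ ∈ T.1 ↔ Q T := by
  induction Ξ, hfin using Set.Finite.induction_on generalizing Q with
  | empty =>
    by_cases hc : ∃ A, Q A
    · obtain ⟨A, hA⟩ := hc
      exact ⟨top, h.top_mem, fun T => iff_of_true (mem_top h.1 T) (hQ A T (by simp) hA)⟩
    · exact ⟨bot, h.bot_mem, fun T => iff_of_false
        (fun h1 => (mem_neg T h.top_mem).1 h1 (mem_top h.1 T)) fun h1 => hc ⟨T, h1⟩⟩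
  | @insert ξ Ξ _ _ ih =>
    have hξ : ξ ∈ L := hΞ (Set.mem_insert _ _)
    have hΞ' := (Set.subset_insert _ _).trans hΞ
    -- Split by the truth value `q` of `ξ`: whether some point with `Q`, with this value of `ξ`,
    -- agrees with `T` on the smaller set depends on the smaller set alone.
    have aux : ∀ q : Prop, ∃ κ ∈ L, ∀ T : MCS L Th, κ ∈ T.1 ↔
        ∃ A, Q A ∧ (ξ ∈ A.1 ↔ q) ∧ ∀ η ∈ Ξ, η ∈ A.1 ↔ η ∈ T.1 := fun q =>
      ih hΞ' _ fun A B hAB ⟨C, h1, h2, h3⟩ =>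
        ⟨C, h1, h2, fun η hη => (h3 η hη).trans (hAB η hη)⟩
    obtain ⟨κ₁, h1, h1'⟩ := aux True
    obtain ⟨κ₂, h2, h2'⟩ := aux False
    have hn := h.neg_mem.2 hξ
    refine ⟨vee (wedge ξ κ₁) (wedge (neg ξ) κ₂), h.vee_mem.2 ⟨h.wedge_mem.2 ⟨hξ, h1⟩,
      h.wedge_mem.2 ⟨hn, h2⟩⟩, fun T => ?_⟩
    rw [mem_vee h.1 T (h.wedge_mem.2 ⟨hξ, h1⟩) (h.wedge_mem.2 ⟨hn, h2⟩), mem_wedge h.1,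
      mem_wedge h.1, mem_neg T hξ, h1', h2']
    constructor
    · rintro (⟨h3, A, h4, h5, h6⟩ | ⟨h3, A, h4, h5, h6⟩)
      · refine hQ A T (fun η hη => ?_) h4
        rcases hη with rfl | hη
        · tauto
        · exact h6 η hη
      · refine hQ A T (fun η hη => ?_) h4
        rcases hη with rfl | hη
        · tauto
        · exact h6 η hη
    · intro h3
      by_cases h4 : ξ ∈ T.1
      · exact .inl ⟨h4, T, h3, by simp [h4], by simp⟩
      · exact .inr ⟨h4, T, h3, by simp [h4], by simp⟩

end MCS

/-! ### The truth lemma for the final submodel -/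

namespace MCS
variable {P : Type u} {L Th : Set (Fm P)}

/-- The final submodel of the canonical model, for a set `Δ` of formulas. -/
abbrev FinalWorld (L Th Δ : Set (Fm P)) : Type u := {T : MCS L Th // Final Δ T}

/-- The accessibility relation of the final submodel. -/
def finalRel {Δ : Set (Fm P)} (x y : FinalWorld L Th Δ) : Prop := rel x.1 y.1

/-- The valuation of the final submodel. -/
def finalVal (L Th Δ : Set (Fm P)) (p : P) : Set (FinalWorld L Th Δ) :=
  {x | var p ∈ Δ ∧ var p ∈ x.1.1}

/-- Every formula in `Γ` that is true at a point of `N` is true at a final point above it. -/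
def HasFinal (Δ Γ : Set (Fm P)) (N : Set (MCS L Th)) : Prop :=
  ∀ β ∈ Γ, ∀ T ∈ N, β ∈ T.1 → ∃ S, le T S ∧ Final Δ S ∧ β ∈ S.1

/-- The truth lemma for `φ` in the final submodel: on an up-set `N`, where the loose bound
variables are interpreted by the formulas `ρ i`. -/
def TruthLemma (L Th Δ : Set (Fm P)) (φ : Fm P) : Prop :=
  ∀ (k : ℕ) (ρ : ℕ → Fm P) (N : Set (MCS L Th)) (e : ℕ → Set (FinalWorld L Th Δ)),
    IsFormulaAt k φ → (∀ i, ρ i ∈ L) → close ρ 0 φ ∈ L → (∀ p, Occurs p φ → var p ∈ Δ) →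
    (∀ T ∈ N, ∀ S, le T S → S ∈ N) → HasFinal Δ (cl φ ρ) N →
    (∀ i < k, ∀ x : FinalWorld L Th Δ, x.1 ∈ N → (x ∈ e i ↔ ρ i ∈ x.1.1)) →
    (∀ i, k ≤ i → e i = ∅) →
    ∀ x : FinalWorld L Th Δ, x.1 ∈ N →
      (x ∈ eval finalRel (finalVal L Th Δ) e φ ↔ close ρ 0 φ ∈ x.1.1)

variable (h : IsMuNormal L Th) {Δ : Set (Fm P)} (hΔ : Δ ⊆ L) (hfin : Δ.Finite)
include h hΔ

/-- A successor `S` with `φ` may fail to be final and is replaced by a final point above it with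
`φ`. If that point is `x` itself, which need not see itself, then `S` lies in the cluster of `x` and
is final too. -/
theorem TruthLemma.dia {φ : Fm P} (ih : TruthLemma L Th Δ φ) : TruthLemma L Th Δ (dia φ) := by
  intro k ρ N e hφ hρ hL hvar hN hgood he he' x hx
  have hL' := h.dia_mem.1 hL
  have ih' := ih k ρ N e hφ hρ hL' hvar hN (fun β hβ => hgood β (.inr hβ)) he he'
  rw [close, mem_dia h.1 x.1 hL']
  constructor
  · rintro ⟨y, hxy, hy⟩
    exact ⟨y.1, hxy, (ih' y (hN _ hx _ (.inr hxy))).1 hy⟩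
  · rintro ⟨S, hxS, hS⟩
    have hSN := hN _ hx _ (.inr hxS)
    obtain ⟨U, hSU, hU, hU'⟩ := hgood _ (.inr (close_mem_cl φ ρ)) S hSN hS
    rcases le_trans h (.inr hxS) hSU with hxU | hxU
    · have hSx : le S x.1 := hxU ▸ hSU
      have hSf := x.2.of_same h hΔ (.inr hxS) hSx
      exact ⟨⟨S, hSf⟩, hxS, (ih' ⟨S, hSf⟩ hSN).2 hS⟩
    · exact ⟨⟨U, hU⟩, hxU, (ih' ⟨U, hU⟩ (hN _ hSN _ hSU)).2 hU'⟩

omit hΔ in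
/-- In the final submodel, points of one cluster that satisfy the same formulas of `Ξ` cannot be
distinguished, if the valuation and the environment are determined by `Ξ` in this cluster. -/
theorem eval_invariant_cluster (T : MCS L Th) (Ξ : Set (Fm P)) (e : ℕ → Set (FinalWorld L Th Δ))
    (hΞ : Δ ⊆ Ξ)
    (he : ∀ i, ∀ x y : FinalWorld L Th Δ, le T x.1 → le x.1 T → le T y.1 → le y.1 T →
      (∀ ξ ∈ Ξ, ξ ∈ x.1.1 ↔ ξ ∈ y.1.1) → x ∈ e i → y ∈ e i)
    {φ : Fm P} {k : ℕ} (hφ : IsFormulaAt k φ) {x y : FinalWorld L Th Δ}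
    (h1 : le T x.1) (h2 : le x.1 T) (h3 : le T y.1) (h4 : le y.1 T)
    (hxy : ∀ ξ ∈ Ξ, ξ ∈ x.1.1 ↔ ξ ∈ y.1.1)
    (hx : x ∈ eval finalRel (finalVal L Th Δ) e φ) :
    y ∈ eval finalRel (finalVal L Th Δ) e φ := by
  let C : FinalWorld L Th Δ → Prop := fun x => le T x.1 ∧ le x.1 T
  let Z : FinalWorld L Th Δ → FinalWorld L Th Δ → Prop := fun x y =>
    x = y ∨ (C x ∧ C y ∧ ∀ ξ ∈ Ξ, ξ ∈ x.1.1 ↔ ξ ∈ y.1.1)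
  have Zsymm : ∀ {x y}, Z x y → Z y x := by
    rintro x y (rfl | ⟨h1, h2, h3⟩)
    · exact .inl rfl
    · exact .inr ⟨h2, h1, fun ξ hξ => (h3 ξ hξ).symm⟩
  have Ztrans : ∀ {x y z}, Z x y → Z y z → Z x z := by
    rintro x y z (rfl | ⟨h1, h2, h3⟩) h'
    · exact h'
    rcases h' with rfl | ⟨h1', h2', h3'⟩
    · exact .inr ⟨h1, h2, h3⟩
    · exact .inr ⟨h1, h2', fun ξ hξ => (h3 ξ hξ).trans (h3' ξ hξ)⟩
  let f : FinalWorld L Th Δ → Set (FinalWorld L Th Δ) := fun x => {y | Z x y}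
  have hf : ∀ {x y}, Z x y → f x = f y := fun hxy =>
    Set.ext fun z => ⟨fun hz => Ztrans (Zsymm hxy) hz, fun hz => Ztrans hxy hz⟩
  have hf' : ∀ {x y}, f x = f y → Z x y := fun {x y} hxy => by
    have : y ∈ f y := .inl rfl
    rw [← hxy] at this
    exact this
  refine eval_invariant finalRel f ?_ _ ?_ e ?_ φ k hφ x y (hf (.inr ⟨⟨h1, h2⟩, ⟨h3, h4⟩, hxy⟩)) hx
  -- Distinct points of the cluster see each other, so `x` inherits the successors of `x₀` by weak
  -- transitivity. The exception is `y₀ = x`, where `x` may be irreflexive; then `x₀`, which is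
  -- equivalent to `x`, takes the place of `y₀`.
  · intro x₀ x y₀ hx hR
    have hZ := hf' hx
    rcases hZ with rfl | ⟨hC₀, hC, -⟩
    · exact ⟨y₀, hR, rfl⟩
    rcases le_trans h hC.2 hC₀.1 with hxx | hxx
    · exact ⟨y₀, by rw [Subtype.ext hxx]; exact hR, rfl⟩
    by_cases hy : y₀ = x
    · exact ⟨x₀, hxx, hy ▸ hx⟩
    · exact ⟨y₀, (rel_trans h hxx hR).resolve_left fun hc => hy (Subtype.ext hc.symm), rfl⟩
  · rintro p x y hxy ⟨hp, hx⟩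
    rcases hf' hxy with rfl | ⟨-, -, h3⟩
    · exact ⟨hp, hx⟩
    · exact ⟨hp, (h3 _ (hΞ hp)).1 hx⟩
  · intro i x y hxy hx
    rcases hf' hxy with rfl | ⟨h1, h2, h3⟩
    · exact hx
    · exact he i x y h1.1 h1.2 h2.1 h2.2 h3 hx

include hfin

/-- The induction on the depth of a point for greatest fixed points. -/
theorem TruthLemma.mem_nu {θ : Fm P} (ih : TruthLemma L Th Δ θ) {k : ℕ} {ρ : ℕ → Fm P}
    {N : Set (MCS L Th)} {e : ℕ → Set (FinalWorld L Th Δ)} (hφ : IsFormulaAt k (nu θ))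
    (hρ : ∀ i, ρ i ∈ L) (hL : nu (close ρ 1 θ) ∈ L) (hvar : ∀ p, Occurs p θ → var p ∈ Δ)
    (hN : ∀ T ∈ N, ∀ S, le T S → S ∈ N) (hgood : HasFinal Δ (cl (nu θ) ρ) N)
    (he : ∀ i < k, ∀ x : FinalWorld L Th Δ, x.1 ∈ N → (x ∈ e i ↔ ρ i ∈ x.1.1))
    (he' : ∀ i, k ≤ i → e i = ∅) {X : Set (FinalWorld L Th Δ)}
    (hX : X ⊆ eval finalRel (finalVal L Th Δ) (push X e) θ)
    (x : FinalWorld L Th Δ) (hxN : x.1 ∈ N) (hxX : x ∈ X) : nu (close ρ 1 θ) ∈ x.1.1 := by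
  -- This number measures depth: by `ncard_lt` it is smaller at strictly later points.
  induction hn : {ψ ∈ Δ | plus ψ ∈ x.1.1}.ncard using Nat.strong_induction_on generalizing x with
  | _ n IH =>
  subst hn
  obtain ⟨T, hTf⟩ := x
  obtain ⟨ψ, hψ, hψT, hψfin⟩ := id hTf
  have hψL := hΔ hψ
  have hψL' := (plus_mem_iff h).2 hψL
  set ν := nu (close ρ 1 θ) with hν
  -- Agreement on `Ξ` fixes the valuation, the values of the `k` loose variables, and the membership
  -- in `ν`.
  set Ξ : Set (Fm P) := insert ν (Δ ∪ ρ '' Set.Iio k) with hΞdef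
  have hΞfin : Ξ.Finite := (hfin.union ((Set.finite_Iio k).image ρ)).insert _
  have hΞL : Ξ ⊆ L := Set.insert_subset hL (Set.union_subset hΔ (by
    rintro _ ⟨i, -, rfl⟩; exact hρ i))
  -- `κ` collects the `Ξ`-types that are realised by points of `X` in the cluster of `T`.
  obtain ⟨κ, hκ, hκ'⟩ := exists_definition h hΞfin hΞL
    (fun U => ∃ S : FinalWorld L Th Δ, S ∈ X ∧ le T S.1 ∧ le S.1 T ∧
      ∀ ξ ∈ Ξ, ξ ∈ S.1.1 ↔ ξ ∈ U.1)
    fun A B hAB ⟨S, h1, h2, h3, h4⟩ => ⟨S, h1, h2, h3, fun ξ hξ => (h4 ξ hξ).trans (hAB ξ hξ)⟩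
  have hwL : wedge (plus ψ) κ ∈ L := h.wedge_mem.2 ⟨hψL', hκ⟩
  -- Above `T`, the conjunct `plus ψ` holds exactly in the cluster of `T`. So `χ` is `ν` at strictly
  -- later points, and in the cluster of `T` it adds the types realised in `X`.
  set χ := vee ν (wedge (plus ψ) κ) with hχdef
  have hχ : χ ∈ L := h.vee_mem.2 ⟨hL, hwL⟩
  have mem_χ : ∀ U : MCS L Th, χ ∈ U.1 ↔ ν ∈ U.1 ∨ (plus ψ ∈ U.1 ∧
      ∃ S : FinalWorld L Th Δ, S ∈ X ∧ le T S.1 ∧ le S.1 T ∧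
        ∀ ξ ∈ Ξ, ξ ∈ S.1.1 ↔ ξ ∈ U.1) := fun U => by
    rw [hχdef, mem_vee h.1 U hL hwL, mem_wedge h.1, hκ']
  have later : ∀ U, le T U → ¬ le U T → (χ ∈ U.1 ↔ ν ∈ U.1) := fun U h1 h2 => by
    rw [mem_χ]
    exact or_iff_left fun h3 => h2 (hψfin U h1 h3.1)
  -- `X` is enlarged so that above `T` it is defined by `χ`. At strictly later points `X` is
  -- contained in `ν` by the induction on depth.
  set X' : Set (FinalWorld L Th Δ) := X ∪ {U | le T U.1 ∧ χ ∈ U.1.1} with hX'def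
  have hX' : ∀ U : FinalWorld L Th Δ, le T U.1 → (U ∈ X' ↔ χ ∈ U.1.1) := by
    intro U hU
    refine ⟨fun h1 => ?_, fun h1 => .inr ⟨hU, h1⟩⟩
    rcases h1 with h1 | h1
    · rw [mem_χ]
      by_cases h2 : le U.1 T
      · exact .inr ⟨plus_anti h hψL h2 hψT, U, h1, hU, h2, fun _ _ => Iff.rfl⟩
      · exact .inl (IH _ (ncard_lt h hΔ hfin hTf hU h2) U (hN T hxN _ hU) h1 rfl)
    · exact h1.2
  have hχρ := cons_mem hχ hρ
  have hθχ : close (cons χ ρ) 0 θ ∈ L := h.natural.close_cons_mem hρ hL hχ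
  have hθν : close (cons ν ρ) 0 θ ∈ L := h.natural.close_cons_mem hρ hL hL
  -- The closure for `χ` need not be contained in `Δ`. Points of the cluster of `T` are final
  -- themselves; strictly above, `χ` and `ν` are equivalent from there on, and the assumption on the
  -- closure for `ν` applies.
  have hgood' : HasFinal Δ (cl θ (cons χ ρ)) {U | le T U} := by
    intro β hβ U hU hβU
    by_cases h1 : le U T
    · exact ⟨U, .inl rfl, hTf.of_same h hΔ hU h1, hβU⟩
    have hδ : iff ν χ ∈ L := h.iff_mem.2 ⟨hL, hχ⟩
    have hmem : ∀ V : MCS L Th, boxPlus (iff ν χ) ∈ V.1 → (χ ∈ V.1 ↔ ν ∈ V.1) := fun V hV =>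
      ((mem_iff h.1 V hL hχ).1 ((mem_boxPlus h hδ).1 hV V (.inl rfl))).symm
    obtain ⟨β', h2, h3⟩ := cl_congr h hδ θ (cons χ ρ) (cons ν ρ) hχρ (cons_mem hL hρ) hθχ hθν
      (fun i V hV => by
        cases i with
        | zero => exact hmem V hV
        | succ i => exact Iff.rfl) β hβ
    have hUδ : boxPlus (iff ν χ) ∈ U.1 := (mem_boxPlus h hδ).2 fun V hV =>
      (mem_iff h.1 V hL hχ).2 (later V (le_trans h hU hV) fun hc => h1 (le_trans h hV hc)).symm
    obtain ⟨V, h4, h5, h6⟩ := hgood β' (.inr h2) U (hN T hxN _ hU) ((h3 U hUδ).1 hβU)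
    exact ⟨V, h4, h5, (h3 V (boxPlus_mono h hδ h4 hUδ)).2 h6⟩
  have hIH := ih (k + 1) (cons χ ρ) {U | le T U} (push X' e) hφ.1 hχρ hθχ hvar
    (fun U hU V hV => le_trans h hU hV) hgood'
    (fun i hi U hU => by
      cases i with
      | zero => exact hX' U hU
      | succ i => exact he i (by omega) U (hN T hxN _ hU))
    (fun i hi => by
      cases i with
      | zero => omega
      | succ i => exact he' i (by omega))
  have hstep : ∀ V, le T V → χ ∈ V.1 → close (cons χ ρ) 0 θ ∈ V.1 := by
    intro V hV hχV
    rcases (mem_χ V).1 hχV with h1 | ⟨h1, S, h2, h3, h4, h5⟩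
    · have h2 := mem_inst_of_mem_nu h h1
      rw [inst_close h hρ] at h2
      refine close_mono h h.top_mem θ true _ _ (cons_mem hL hρ) hχρ hθν hθχ (fun i => ?_) V
        ((mem_boxPlus h h.top_mem).2 fun U _ => mem_top h.1 U) h2
      cases i with
      | zero => exact ⟨fun U _ hU => (mem_χ U).2 (.inl hU), .inl hφ.2⟩
      | succ i => exact ⟨fun U _ hU => hU, .inr fun U _ hU => hU⟩
    -- `V` has the type of some `S ∈ X` in the same cluster. As `S` satisfies `θ` for `X`, hence for
    -- `X'`, so does `V`, and the truth lemma for `θ` turns this into `θ(χ) ∈ V`.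
    · have hVT := hψfin V hV h1
      have hVf := hTf.of_same h hΔ hV hVT
      have hS := eval_push_mono finalRel (finalVal L Th Δ) e hφ.2
        (Set.subset_union_left : X ⊆ X') (hX h2)
      refine (hIH ⟨V, hVf⟩ hV).1 (eval_invariant_cluster h T Ξ (push X' e)
        (Set.subset_union_left.trans (Set.subset_insert _ _)) ?_ hφ.1 h3 h4 hV hVT h5 hS)
      intro i x y hx hx' hy hy' hxy hxi
      cases i with
      | zero =>
        refine (hX' y hy).2 ((mem_χ _).2 ?_)
        rcases (mem_χ _).1 ((hX' x hx).1 hxi) with h6 | ⟨h6, S', h7, h8, h9, h10⟩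
        · exact .inl ((hxy ν (Set.mem_insert _ _)).1 h6)
        · exact .inr ⟨plus_anti h hψL hy' hψT, S', h7, h8, h9,
            fun ξ hξ => (h10 ξ hξ).trans (hxy ξ hξ)⟩
      | succ i =>
        by_cases hi : i < k
        · exact (he i hi y (hN T hxN _ hy)).2 ((hxy _ (.inr (.inr ⟨i, hi, rfl⟩))).1
            ((he i hi x (hN T hxN _ hx)).1 hxi))
        -- `Ξ` contains no formula for these indices; the emptiness of their values makes them
        -- invariant.
        · have : x ∈ e i := hxi
          rw [he' i (by omega)] at this
          exact this.elim
  -- The implication `χ ⇒ θ(χ)` holds above `T` only, so it serves as the parameter of the local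
  -- induction rule.
  have hδ : imp χ (close (cons χ ρ) 0 θ) ∈ L := h.imp_mem.2 ⟨hχ, hθχ⟩
  refine mem_nu_of_local h hχ hδ hL (fun V hV hχV => ?_)
    ((mem_boxPlus h hδ).2 fun V hV => (mem_imp h.1 V hχ hθχ).2 (hstep V hV))
    ((hX' ⟨T, hTf⟩ (.inl rfl)).1 (.inl hxX))
  have hwχ : wedge χ (boxPlus (imp χ (close (cons χ ρ) 0 θ))) ∈ L :=
    h.wedge_mem.2 ⟨hχ, (boxPlus_mem_iff h).2 hδ⟩
  rw [inst_close h hρ]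
  refine close_mono h hδ θ true _ _ hχρ (cons_mem hwχ hρ) hθχ
    (h.natural.close_cons_mem hρ hL hwχ) (fun i => ?_) V hV
    ((mem_imp h.1 V hχ hθχ).1 ((mem_boxPlus h hδ).1 hV V (.inl rfl)) hχV)
  cases i with
  | zero => exact ⟨fun U hU hU' => (mem_wedge h.1 U).2 ⟨hU', hU⟩, .inl hφ.2⟩
  | succ i => exact ⟨fun U _ hU => hU, .inr fun U _ hU => hU⟩

/-- One inclusion is `TruthLemma.mem_nu`. For the other, the points of `N` that contain the
fixed-point formula form a post-fixed point by the unfolding axiom. -/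
theorem TruthLemma.nu {θ : Fm P} (ih : TruthLemma L Th Δ θ) : TruthLemma L Th Δ (nu θ) := by
  intro k ρ N e hφ hρ hL hvar hN hgood he he' x hx
  constructor
  · rintro ⟨X, hX, hxX⟩
    exact ih.mem_nu h hΔ hfin hφ hρ hL hvar hN hgood he he' hX x hx hxX
  · intro hxν
    refine ⟨{y | y.1 ∈ N ∧ Fm.nu (close ρ 1 θ) ∈ y.1.1}, fun y hy => ?_, ⟨hx, hxν⟩⟩
    have h1 := mem_inst_of_mem_nu h hy.2
    rw [inst_close h hρ] at h1
    refine (ih (k + 1) (cons (Fm.nu (close ρ 1 θ)) ρ) N _ hφ.1 (cons_mem hL hρ)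
      (h.natural.close_cons_mem hρ hL hL) hvar hN (fun β hβ => hgood β (.inr hβ)) (fun i hi z hz => ?_)
      (fun i hi => ?_) y hy.1).2 h1
    · cases i with
      | zero => exact ⟨fun h2 => h2.2, fun h2 => ⟨hz, h2⟩⟩
      | succ i => exact he i (by omega) z hz
    · cases i with
      | zero => omega
      | succ i => exact he' i (by omega)

theorem truthLemma (φ : Fm P) : TruthLemma L Th Δ φ := by
  induction φ with
  | top =>
    intro k ρ N e _ _ _ _ _ _ _ _ x _
    exact iff_of_true trivial (mem_top h.1 x.1)
  | var p =>
    intro k ρ N e _ _ _ hvar _ _ _ _ x _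
    exact ⟨fun h1 => h1.2, fun h1 => ⟨hvar p rfl, h1⟩⟩
  | bvar i =>
    intro k ρ N e hφ _ _ _ _ _ he _ x hx
    exact he i hφ x hx
  | neg φ ih =>
    intro k ρ N e hφ hρ hL hvar hN hgood he he' x hx
    have hL' := h.neg_mem.1 hL
    rw [close, mem_neg x.1 hL', ← ih k ρ N e hφ hρ hL' hvar hN
      (fun β hβ => hgood β (.inr hβ)) he he' x hx]
    rfl
  | wedge φ ψ ih1 ih2 =>
    intro k ρ N e hφ hρ hL hvar hN hgood he he' x hx
    have hL' := h.wedge_mem.1 hL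
    rw [close, mem_wedge h.1, ← ih1 k ρ N e hφ.1 hρ hL'.1 (fun p hp => hvar p (.inl hp)) hN
      (fun β hβ => hgood β (.inr (.inl hβ))) he he' x hx,
      ← ih2 k ρ N e hφ.2 hρ hL'.2 (fun p hp => hvar p (.inr hp)) hN
      (fun β hβ => hgood β (.inr (.inr hβ))) he he' x hx]
    rfl
  | dia φ ih => exact ih.dia h hΔ
  | nu φ ih => exact ih.nu h hΔ hfin

/-- An unprovable formula is refuted in a final submodel. -/
theorem exists_not_mem_eval {φ : Fm P} (hφ : φ ∈ L) (hφ' : φ ∉ Th)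
    (hΔφ : cl (neg φ) (fun _ => top) ⊆ Δ) :
    ∃ x : FinalWorld L Th Δ, x ∉ eval finalRel (finalVal L Th Δ) (fun _ => ∅) φ := by
  obtain ⟨T, hT⟩ : ∃ T : MCS L Th, φ ∉ T.1 := by
    by_contra hc
    push Not at hc
    exact hφ' (thm_of_forall_mem h.1 hφ hc)
  have hcl : close (fun _ => top) 0 φ = φ :=
    close_eq_self _ φ 0 (h.natural.isFormula φ hφ)
  have hmem : neg φ ∈ Δ := by
    have := hΔφ (close_mem_cl (neg φ) _)
    rwa [close, hcl] at this
  obtain ⟨S, -, hS, hS'⟩ := exists_final h hΔ hmem ((mem_neg T hφ).2 hT)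
  refine ⟨⟨S, hS⟩, ?_⟩
  have hsub : cl φ (fun _ => top) ⊆ Δ := (Set.subset_insert _ _).trans hΔφ
  rw [truthLemma h hΔ hfin φ 0 (fun _ => top) Set.univ (fun _ => ∅) (h.natural.isFormula φ hφ)
    (fun _ => h.top_mem) (by rwa [hcl]) (fun p hp => hsub (var_mem_cl hp _)) (by simp)
    (fun β hβ U _ hβU => exists_final h hΔ (hsub hβ) hβU) (by simp) (by simp) _ trivial, hcl]
  exact (mem_neg S hφ).1 hS'

end MCS

/-! ### Counting formulas -/

namespace Fm
variable {P : Type u}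

/-- A formula in postfix notation. -/
def postfixCode : Fm P → List (P ⊕ ℕ)
  | top => [.inr 0]
  | var p => [.inl p]
  | bvar i => [.inr (i + 5)]
  | neg φ => postfixCode φ ++ [.inr 1]
  | wedge φ ψ => postfixCode φ ++ (postfixCode ψ ++ [.inr 2])
  | dia φ => postfixCode φ ++ [.inr 3]
  | nu φ => postfixCode φ ++ [.inr 4]

/-- One step of the evaluation of postfix notation on a stack. -/
def stackStep : List (Fm P) → P ⊕ ℕ → List (Fm P)
  | st, .inl p => var p :: st
  | st, .inr 0 => top :: st
  | φ :: st, .inr 1 => neg φ :: st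
  | ψ :: φ :: st, .inr 2 => wedge φ ψ :: st
  | φ :: st, .inr 3 => dia φ :: st
  | φ :: st, .inr 4 => nu φ :: st
  | st, .inr (i + 5) => bvar i :: st
  | st, _ => st

theorem foldl_postfixCode (φ : Fm P) (st : List (Fm P)) :
    (postfixCode φ).foldl stackStep st = φ :: st := by
  induction φ generalizing st with
  | top => rfl
  | var p => rfl
  | bvar i => cases st with
    | nil => rfl
    | cons a st => cases st <;> rfl
  | neg φ ih => simp [postfixCode, ih, stackStep]
  | wedge φ ψ ih1 ih2 => simp [postfixCode, ih1, ih2, stackStep]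
  | dia φ ih => simp [postfixCode, ih, stackStep]
  | nu φ ih => simp [postfixCode, ih, stackStep]

theorem postfixCode_injective : Function.Injective (postfixCode (P := P)) := fun φ ψ h => by
  have := foldl_postfixCode φ []
  rw [h, foldl_postfixCode ψ []] at this
  exact (List.cons.inj this).1.symm

instance [Countable P] : Countable (Fm P) := postfixCode_injective.countable

theorem mk_le [Infinite P] : Cardinal.mk (Fm P) ≤ Cardinal.mk P := by
  refine (Cardinal.mk_le_of_injective postfixCode_injective).trans ?_
  rw [Cardinal.mk_list_eq_mk, Cardinal.mk_sum, Cardinal.lift_uzero, Cardinal.mk_nat,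
    Cardinal.lift_aleph0, Cardinal.add_eq_left (Cardinal.aleph0_le_mk P) (Cardinal.aleph0_le_mk P)]

/-- There are no more formulas than variables, so the variables can name all formulas of `L`. This
is what makes canonicity over `P` applicable to the larger language. -/
theorem exists_surjection [Infinite P] {L : Set (Fm P)} (hL : L.Nonempty) :
    ∃ s : P → Fm P, (∀ p, s p ∈ L) ∧ ∀ φ ∈ L, ∃ p, s p = φ := by
  obtain ⟨f⟩ := Cardinal.le_def L P |>.1 ((Cardinal.mk_set_le L).trans mk_le)
  have := hL.to_subtype
  refine ⟨fun p => (Function.invFun f p).1, fun p => Subtype.mem _, fun φ hφ => ?_⟩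
  exact ⟨f ⟨φ, hφ⟩, congrArg Subtype.val (Function.leftInverse_invFun f.injective ⟨φ, hφ⟩)⟩

end Fm

/-! ### The canonical frame of the fixed-point logic inside that of `Λ` -/

namespace MCS
variable {P : Type u} [Nonempty P] {Λ L : Set (Fm P)} (hΛ : IsNormalLogic Λ)
  (hL : IsNaturalSublanguage L) {s : P → Fm P} (hs : ∀ p, s p ∈ L)

include hΛ hL hs in
theorem isTheory_pullback (T : MCS L (muLogic Λ L)) :
    IsTheory Λ {φ | IsModal φ ∧ subst s φ ∈ T.1} := by
  rw [isTheory_iff_isMCS hΛ]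
  have hn := hL.isNormalIn hΛ
  refine ⟨fun φ h => h.1, fun φ h => ⟨hΛ.isModal φ h, T.2.thm (.ax φ s h hs)⟩, ?_, ?_⟩
  · intro φ hφ
    have := mem_neg T (hL.subst_mem_of_isModal hφ hs)
    exact ⟨fun h1 h2 => this.1 h1.2 h2.2, fun h1 => ⟨hφ, this.2 fun h2 => h1 ⟨hφ, h2⟩⟩⟩
  · intro φ hφ ψ hψ
    have := mem_wedge hn T (φ := subst s φ) (ψ := subst s ψ)
    exact ⟨fun h1 => ⟨⟨hφ, (this.1 h1.2).1⟩, ⟨hψ, (this.1 h1.2).2⟩⟩,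
      fun h1 => ⟨⟨hφ, hψ⟩, this.2 ⟨h1.1.2, h1.2.2⟩⟩⟩

/-- The embedding of the canonical frame of `muLogic Λ L` into that of `Λ`. -/
def pullback (T : MCS L (muLogic Λ L)) : CanonicalWorld Λ :=
  ⟨{φ | IsModal φ ∧ subst s φ ∈ T.1}, isTheory_pullback hΛ hL hs T⟩

variable (hs' : ∀ φ ∈ L, ∃ p, s p = φ)
include hs'

/-- Every formula of `L` is named by a variable, so the variables in the pullback recover the whole
point. -/
theorem pullback_injective : Function.Injective (pullback hΛ hL hs) := by
  intro T S h
  refine ext_mem fun φ hφ hφT => ?_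
  obtain ⟨p, rfl⟩ := hs' φ hφ
  have : var p ∈ (pullback hΛ hL hs T).1 := ⟨trivial, hφT⟩
  rw [h] at this
  exact this.2

theorem canonicalRel_pullback {T S : MCS L (muLogic Λ L)} :
    canonicalRel Λ (pullback hΛ hL hs T) (pullback hΛ hL hs S) ↔ rel T S := by
  constructor
  · intro h φ hφ
    obtain ⟨p, rfl⟩ := hs' φ ((hL.isNormalIn hΛ).box_mem.1 (T.2.sub hφ))
    exact (h (var p) ⟨trivial, hφ⟩).2
  · exact fun h φ hφ => ⟨hφ.1, h _ hφ.2⟩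

/-- The image of the embedding is closed under successors. If `χ'` and `χ` name the same formula,
then `□(χ' ⇒ χ)` belongs to the pullback of `T`. So membership in its successor `Γ` depends only on
the formula named, and `Γ` comes from a maximal consistent subset of `L`. -/
theorem exists_pullback_eq {T : MCS L (muLogic Λ L)} {Γ : CanonicalWorld Λ}
    (h : canonicalRel Λ (pullback hΛ hL hs T) Γ) : ∃ S, pullback hΛ hL hs S = Γ := by
  have hn := hL.isNormalIn hΛ
  have hΓ := (isTheory_iff_isMCS hΛ).1 Γ.2
  let G : MCS {φ | IsModal φ} Λ := ⟨Γ.1, hΓ⟩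
  have key : ∀ χ χ', IsModal χ → χ' ∈ Γ.1 → subst s χ' = subst s χ → χ ∈ Γ.1 := by
    intro χ χ' hχ hχ' heq
    have h1 : IsModal χ' := hΓ.sub hχ'
    have hLχ := hL.subst_mem_of_isModal hχ hs
    have h2 : imp χ' χ ∈ Γ.1 := by
      refine h _ ⟨⟨h1, hχ⟩, T.2.thm (.nec _ (hn.imp_mem.2 ⟨heq ▸ hLχ, hLχ⟩)
        (.taut _ (hn.imp_mem.2 ⟨heq ▸ hLχ, hLχ⟩) fun b => ?_))⟩
      show boolEval b (imp (subst s χ') (subst s χ))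
      simp [heq]
    exact (mem_imp hΛ.isNormalIn G h1 hχ).1 h2 hχ'
  have mem : ∀ χ, IsModal χ → (subst s χ ∈ subst s '' Γ.1 ↔ χ ∈ Γ.1) := fun χ hχ =>
    ⟨fun ⟨χ', h1, h2⟩ => key χ χ' hχ h1 h2, fun h1 => ⟨χ, h1, rfl⟩⟩
  refine ⟨⟨subst s '' Γ.1, ?_, ?_, ?_, ?_⟩, Subtype.ext (Set.ext fun χ => ?_)⟩
  · rintro _ ⟨χ, hχ, rfl⟩
    exact hL.subst_mem_of_isModal (hΓ.sub hχ) hs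
  · intro φ hφ
    obtain ⟨p, rfl⟩ := hs' φ (hn.sub hφ)
    exact ⟨var p, h (var p) ⟨trivial, T.2.thm (hn.nec _ hφ)⟩, rfl⟩
  · intro φ hφ
    obtain ⟨p, rfl⟩ := hs' φ hφ
    exact (mem (neg (var p)) trivial).trans ((hΓ.neg (var p) trivial).trans
      (not_congr (mem (var p) trivial)).symm)
  · intro φ hφ ψ hψ
    obtain ⟨p, rfl⟩ := hs' φ hφ
    obtain ⟨q, rfl⟩ := hs' ψ hψ
    exact (mem (wedge (var p) (var q)) ⟨trivial, trivial⟩).trans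
      ((hΓ.wedge (var p) trivial (var q) trivial).trans
        (and_congr (mem (var p) trivial) (mem (var q) trivial)).symm)
  · exact ⟨fun h1 => (mem χ h1.1).1 h1.2, fun h1 => ⟨hΓ.sub h1, (mem χ (hΓ.sub h1)).2 h1⟩⟩

end MCS

/-! ### Completeness and the finite model property -/

namespace IsCanonicalCofinalSubframeLogic
variable {P : Type u} [Infinite P] {Λ L : Set (Fm P)} (hΛ : IsCanonicalCofinalSubframeLogic Λ)
  (hL : IsNaturalSublanguage L)
include hΛ hL

open MCS

/-- Since `⊤ ∈ Δ`, every point has a final point above it. As the embedded frame is closed under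
successors, the embedded final points are therefore cofinal in the canonical frame of `Λ`. -/
theorem isFrameOf_finalRel {Δ : Set (Fm P)} (hΔ : Δ ⊆ L) (htop : top ∈ Δ) :
    IsFrameOf Λ (finalRel (L := L) (Th := muLogic Λ L) (Δ := Δ)) := by
  have h := hL.isMuNormal hΛ.normal
  obtain ⟨s, hs, hs'⟩ := exists_surjection ⟨_, hL.top_mem⟩
  let g : FinalWorld L (muLogic Λ L) Δ → CanonicalWorld Λ :=
    fun x => pullback hΛ.normal hL hs x.1
  have hg : Function.Injective g := fun x y hxy =>
    Subtype.ext (pullback_injective hΛ.normal hL hs hs' hxy)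
  have hcof : IsCofinalIn (canonicalRel Λ) (Set.range g) := by
    rintro Γ ⟨_, ⟨y, rfl⟩, hyΓ⟩
    obtain ⟨S, rfl⟩ := exists_pullback_eq hΛ.normal hL hs hs' hyΓ
    obtain ⟨V, hSV, hV, -⟩ := exists_final h hΔ htop (mem_top h.1 S)
    refine ⟨_, ⟨⟨V, hV⟩, rfl⟩, hSV.imp (congrArg _) fun h1 => ?_⟩
    exact (canonicalRel_pullback hΛ.normal hL hs hs').2 h1
  have hfr := hΛ.cofinalSubframe _ _ hΛ.canonical _ hcof
  let e : FinalWorld L (muLogic Λ L) Δ ≃ Set.range g := Equiv.ofInjective g hg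
  have he : ∀ u v : Set.range g, canonicalRel Λ u.1 v.1 ↔ finalRel (e.symm u) (e.symm v) := by
    intro u v
    obtain ⟨x, rfl⟩ := e.surjective u
    obtain ⟨y, rfl⟩ := e.surjective v
    simp only [Equiv.symm_apply_apply]
    exact canonicalRel_pullback hΛ.normal hL hs hs'
  refine hfr.map (fun φ hφ => (hΛ.normal.isModal φ hφ).isFormulaAt 0) e.symm e.symm.surjective
    (fun u v => (he u v).1) fun u y hy => ⟨e y, (he _ _).2 ?_, e.symm_apply_apply y⟩
  rwa [e.symm_apply_apply]

/-- Completeness for finite frames. -/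
theorem complete {φ : Fm P} (hφ : φ ∈ L)
    (H : ∀ (W : Type u) (R : W → W → Prop), Finite W → IsFrameOf Λ R → ValidOn R φ) :
    φ ∈ muLogic Λ L := by
  by_contra hn
  have h := hL.isMuNormal hΛ.normal
  set Δ : Set (Fm P) := insert top (cl (neg φ) fun _ => top) with hΔdef
  have hcl : close (fun _ => top) 0 φ = φ := close_eq_self _ φ 0 (hL.isFormula φ hφ)
  have hΔ : Δ ⊆ L := Set.insert_subset hL.top_mem
    (cl_subset hL _ _ (fun _ => hL.top_mem) (by rw [close, hcl]; exact hL.neg_mem φ hφ))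
  have hfin : Δ.Finite := (finite_cl _ _).insert _
  obtain ⟨x, hx⟩ := exists_not_mem_eval h hΔ hfin hφ hn (Set.subset_insert _ _)
  have hfr := hΛ.isFrameOf_finalRel hL hΔ (Set.mem_insert _ _)
  have : Finite Δ := hfin
  -- The colour of a point is the set of formulas of `Δ` that it contains.
  obtain ⟨W, R, f, hW, hf, forth, back, hτ⟩ := exists_finite_quotient
    (finalRel (L := L) (Th := muLogic Λ L) (Δ := Δ)) (fun x => {ψ : Δ | ψ.1 ∈ x.1.1})
    (fun {x y z} h1 h2 => (rel_trans h h1 h2).imp_left Subtype.ext)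
    (fun x => {ψ ∈ Δ | plus ψ ∈ x.1.1}.ncard)
    (fun {x y} h1 h2 => ncard_lt h hΔ hfin x.2 (.inr h1) fun hc => by
      rcases hc with hc | hc
      · have := Subtype.ext hc
        subst this
        exact h2 h1
      · exact h2 hc)
    Δ.ncard (fun x => Set.ncard_le_ncard (fun _ h => h.1) hfin)
  -- Only variables in `Δ` have a nonempty value, and the colour decides these; so the valuation
  -- descends to the quotient.
  have hval : ∀ p, f ⁻¹' (f '' finalVal L (muLogic Λ L) Δ p) = finalVal L (muLogic Λ L) Δ p := by
    refine fun p => Set.Subset.antisymm ?_ (Set.subset_preimage_image f _)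
    rintro y ⟨z, hz, hzy⟩
    exact ⟨hz.1, ((Set.ext_iff.1 (hτ z y hzy)) ⟨var p, hz.1⟩).1 hz.2⟩
  have := eval_preimage finalRel R f forth back (fun p => f '' finalVal L (muLogic Λ L) Δ p) φ 0
    (fun _ => ∅) (hL.isFormula φ hφ)
  simp only [hval, Set.preimage_empty] at this
  rw [this] at hx
  exact hx (H W R hW (hfr.map (fun φ hφ => (hΛ.normal.isModal φ hφ).isFormulaAt 0) f hf forth back)
    _ (f x))

theorem hasFMP : HasFMP (muLogic Λ L) L := fun _ hφ =>
  ⟨fun h _ _ _ hR => hR _ h, fun H => hΛ.complete hL hφ fun W R hW hR =>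
    H W R hW (hR.muLogic hΛ.normal hΛ.wk4 hL)⟩

end IsCanonicalCofinalSubframeLogic

/-! ### The modal part of the fixed-point logic -/

section Canonical
variable {P : Type u} {Λ : Set (Fm P)}

/-- A point of the canonical model as a maximal consistent set. -/
def CanonicalWorld.toMCS (hΛ : IsNormalLogic Λ) (T : CanonicalWorld Λ) : MCS {φ | IsModal φ} Λ :=
  ⟨T.1, (isTheory_iff_isMCS hΛ).1 T.2⟩

/-- A maximal consistent set as a point of the canonical model. -/
def MCS.toCanonicalWorld (hΛ : IsNormalLogic Λ) (T : MCS {φ | IsModal φ} Λ) : CanonicalWorld Λ :=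
  ⟨T.1, (isTheory_iff_isMCS hΛ).2 T.2⟩

/-- The truth lemma for the canonical model. -/
theorem mem_eval_canonical (hΛ : IsNormalLogic Λ) {φ : Fm P} (hφ : IsModal φ)
    (e : ℕ → Set (CanonicalWorld Λ)) (T : CanonicalWorld Λ) :
    T ∈ eval (canonicalRel Λ) (fun p => {S | var p ∈ S.1}) e φ ↔ φ ∈ T.1 := by
  have hn := hΛ.isNormalIn
  induction φ generalizing T with
  | top => exact iff_of_true trivial (MCS.mem_top hn (T.toMCS hΛ))
  | var p => rfl
  | bvar i => exact hφ.elim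
  | neg φ ih => exact (not_congr (ih hφ T)).trans (MCS.mem_neg (T.toMCS hΛ) hφ).symm
  | wedge φ ψ ih1 ih2 =>
    exact (and_congr (ih1 hφ.1 T) (ih2 hφ.2 T)).trans (MCS.mem_wedge hn (T.toMCS hΛ)).symm
  | dia φ ih =>
    refine Iff.trans ?_ (MCS.mem_dia hn (T.toMCS hΛ) hφ).symm
    constructor
    · rintro ⟨S, h1, h2⟩
      exact ⟨S.toMCS hΛ, h1, (ih hφ S).1 h2⟩
    · rintro ⟨S, h1, h2⟩
      exact ⟨S.toCanonicalWorld hΛ, h1, (ih hφ _).2 h2⟩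
  | nu φ ih => exact hφ.elim

theorem mem_of_validOn_canonicalRel (hΛ : IsNormalLogic Λ) {φ : Fm P} (hφ : IsModal φ)
    (h : ValidOn (canonicalRel Λ) φ) : φ ∈ Λ :=
  MCS.thm_of_forall_mem hΛ.isNormalIn hφ fun T =>
    (mem_eval_canonical hΛ hφ _ (T.toCanonicalWorld hΛ)).1 (h _ _)

/-- The modal formulas in `muLogic Λ L` are those of `Λ`. -/
theorem muLogic_inter_isModal [Nonempty P] {L : Set (Fm P)}
    (hΛ : IsCanonicalCofinalSubframeLogic Λ) (hL : IsNaturalSublanguage L)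
    (hvar : ∀ p : P, var p ∈ L) : muLogic Λ L ∩ {φ | IsModal φ} = Λ := by
  refine Set.Subset.antisymm (fun φ hφ => ?_) fun φ hφ => ⟨?_, hΛ.normal.isModal φ hφ⟩
  -- Soundness is applied to the canonical frame of `Λ`, a `Λ`-frame on which only members of `Λ`
  -- are valid among modal formulas.
  · exact mem_of_validOn_canonicalRel hΛ.normal hφ.2
      (hΛ.canonical.muLogic hΛ.normal hΛ.wk4 hL φ hφ.1)
  · have := MuProvable.ax (L := L) φ var hφ hvar
    rwa [subst_var] at this

end Canonical

/-! ### At most continuum many normal logics -/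

namespace Fm
variable {P : Type u} {Q : Type v}

/-- Renaming of the propositional variables. -/
def map (f : P → Q) : Fm P → Fm Q
  | top => top
  | var p => var (f p)
  | bvar i => bvar i
  | neg φ => neg (map f φ)
  | wedge φ ψ => wedge (map f φ) (map f ψ)
  | dia φ => dia (map f φ)
  | nu φ => nu (map f φ)

theorem map_map_eq_subst (f : P → Q) (g : Q → P) (φ : Fm P) :
    map g (map f φ) = subst (fun p => var (g (f p))) φ := by
  induction φ with
  | top => rfl
  | var p => rfl
  | bvar i => rfl
  | neg φ ih => simp [map, subst, ih]
  | wedge φ ψ ih1 ih2 => simp [map, subst, ih1, ih2]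
  | dia φ ih => simp [map, subst, ih]
  | nu φ ih => simp [map, subst, ih]

theorem subst_subst_var (f : P → P) (σ : P → Fm P) (φ : Fm P)
    (h : ∀ p, Occurs p φ → σ (f p) = var p) : subst σ (subst (fun p => var (f p)) φ) = φ := by
  induction φ with
  | top => rfl
  | var p => exact h p rfl
  | bvar i => rfl
  | neg φ ih => simp [subst, ih h]
  | wedge φ ψ ih1 ih2 =>
    simp [subst, ih1 fun p hp => h p (.inl hp), ih2 fun p hp => h p (.inr hp)]
  | dia φ ih => simp [subst, ih h]
  | nu φ ih => simp [subst, ih h]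

theorem finite_occurs (φ : Fm P) : {p | Occurs p φ}.Finite := by
  induction φ with
  | top => exact Set.finite_empty
  | var p => exact (Set.finite_singleton p).subset fun q hq => (hq : p = q).symm
  | bvar i => exact Set.finite_empty
  | neg φ ih => exact ih
  | wedge φ ψ ih1 ih2 => exact ih1.union ih2
  | dia φ ih => exact ih
  | nu φ ih => exact ih

end Fm

/-- A normal logic is determined by its formulas over countably many variables. -/
theorem IsNormalLogic.eq_of_map {P : Type u} {ι : ℕ → P} (hι : Function.Injective ι)
    {Λ Λ' : Set (Fm P)} (h : IsNormalLogic Λ) (h' : IsNormalLogic Λ')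
    (H : ∀ φ : Fm ℕ, Fm.map ι φ ∈ Λ ↔ Fm.map ι φ ∈ Λ') : Λ = Λ' := by
  have key : ∀ φ : Fm P, ∃ ψ : Fm ℕ, ∀ Λ : Set (Fm P), IsNormalLogic Λ →
      (φ ∈ Λ ↔ Fm.map ι ψ ∈ Λ) := by
    intro φ
    -- Only finitely many variables occur in `φ`. They are renamed injectively into `ℕ`, and uniform
    -- substitution undoes the renaming.
    obtain ⟨f, hf⟩ := Set.countable_iff_exists_injOn.1 (finite_occurs φ).countable
    refine ⟨Fm.map f φ, fun Λ hΛ => ?_⟩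
    rw [map_map_eq_subst]
    constructor
    · exact fun h1 => hΛ.unifSubst φ h1 _ fun p => trivial
    · intro h1
      rcases isEmpty_or_nonempty P with hP | hP
      · exact isEmptyElim (ι 0)
      have h2 := hΛ.unifSubst _ h1
        (fun p => var (Function.invFunOn (fun p => ι (f p)) {p | Occurs p φ} p)) fun p => trivial
      rw [subst_subst_var] at h2
      · exact h2
      · have hinj : Set.InjOn (fun p => ι (f p)) {p | Occurs p φ} :=
          fun a ha b hb hab => hf ha hb (hι hab)
        exact fun p hp => congrArg var (hinj.leftInvOn_invFunOn hp)
  ext φ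
  obtain ⟨ψ, hψ⟩ := key φ
  rw [hψ Λ h, hψ Λ' h', H]

theorem mk_isNormalLogic_le {P : Type u} [Infinite P] (p : Set (Fm P) → Prop)
    (hp : ∀ Λ, p Λ → IsNormalLogic Λ) :
    Cardinal.mk {Λ : Set (Fm P) // p Λ} ≤ Cardinal.continuum := by
  let f : {Λ : Set (Fm P) // p Λ} → ULift.{u} (Set (Fm ℕ)) :=
    fun Λ => ⟨{φ | Fm.map (Infinite.natEmbedding P) φ ∈ Λ.1}⟩
  have hf : Function.Injective f := fun Λ Λ' h =>
    Subtype.ext (IsNormalLogic.eq_of_map (Infinite.natEmbedding P).injective (hp _ Λ.2) (hp _ Λ'.2)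
      fun φ => Set.ext_iff.1 (congrArg ULift.down h) φ)
  refine (Cardinal.mk_le_of_injective hf).trans ?_
  rw [Cardinal.mk_uLift, Cardinal.mk_set, ← Cardinal.lift_continuum.{u, 0}, Cardinal.lift_le,
    ← Cardinal.two_power_aleph0]
  exact Cardinal.power_le_power_left two_ne_zero Cardinal.mk_le_aleph0

/-! ### Diagram formulas -/

section Diagram
variable {P : Type u} {W : Type v}

/-- The point `x` sees a copy of a configuration: points `y 0, …, y (N - 1)`, pairwise different,
with arrows where `pos` holds and without arrows where `nr` holds. -/
def Copy (R : W → W → Prop) (x : W) (N : ℕ) (pos nr : ℕ → ℕ → Prop) (y : ℕ → W) : Prop :=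
  (∀ i < N, R x (y i)) ∧ ∀ i < N, ∀ j < N, (i ≠ j → y i ≠ y j) ∧ (nr i j → ¬ R (y i) (y j)) ∧
    (pos i j → R (y i) (y j))

/-- A configuration of sets of points seen from `x`. -/
def SetCopy (R : W → W → Prop) (x : W) (N : ℕ) (pos nr : ℕ → ℕ → Prop) (V : ℕ → Set W) : Prop :=
  (∀ i < N, ∃ y, R x y ∧ y ∈ V i) ∧ ∀ i < N, ∀ j < N, ∀ y, R x y → y ∈ V i →
    (i ≠ j → y ∉ V j) ∧ (nr i j → ∀ z, R y z → z ∉ V j) ∧ (pos i j → ∃ z, R y z ∧ z ∈ V j)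

namespace Fm

theorem isModal_bigWedge {l : List (Fm P)} : IsModal (bigWedge l) ↔ ∀ φ ∈ l, IsModal φ := by
  induction l with
  | nil => simp [bigWedge, IsModal]
  | cons a l ih => simp [bigWedge, IsModal, ih]

open Classical in
/-- The part of the diagram formula that concerns two variables. -/
noncomputable def diagramEntry (v : ℕ → P) (pos nr : ℕ → ℕ → Prop) (i j : ℕ) : Fm P :=
  box (imp (var (v i)) (bigWedge
    [if i ≠ j then neg (var (v j)) else top, if nr i j then neg (dia (var (v j))) else top,
      if pos i j then dia (var (v j)) else top]))

/-- The formula that is refuted where a configuration is seen. -/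
noncomputable def diagram (v : ℕ → P) (N : ℕ) (pos nr : ℕ → ℕ → Prop) : Fm P :=
  neg (wedge (bigWedge ((List.range N).map fun i => dia (var (v i))))
    (bigWedge ((List.range N).map fun i => bigWedge ((List.range N).map fun j =>
      diagramEntry v pos nr i j))))

theorem isModal_diagram (v : ℕ → P) (N : ℕ) (pos nr : ℕ → ℕ → Prop) :
    IsModal (diagram v N pos nr) := by
  refine ⟨isModal_bigWedge.2 ?_, isModal_bigWedge.2 ?_⟩
  · simp only [List.mem_map]
    rintro _ ⟨i, -, rfl⟩
    trivial
  · simp only [List.mem_map]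
    rintro _ ⟨i, -, rfl⟩
    refine isModal_bigWedge.2 ?_
    simp only [List.mem_map]
    rintro _ ⟨j, -, rfl⟩
    refine ⟨trivial, isModal_bigWedge.2 ?_⟩
    simp only [List.mem_cons, List.not_mem_nil, or_false, forall_eq_or_imp, forall_eq]
    refine ⟨?_, ?_, ?_⟩ <;> split_ifs <;> trivial

theorem mem_eval_ite (R : W → W → Prop) (val : P → Set W) (e : ℕ → Set W) (x : W) (c : Prop)
    [Decidable c] (φ : Fm P) :
    x ∈ eval R val e (if c then φ else top) ↔ (c → x ∈ eval R val e φ) := by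
  by_cases h : c
  · simp [h]
  · rw [if_neg h]
    exact iff_of_true trivial fun hc => (h hc).elim

theorem mem_eval_diagram (R : W → W → Prop) (val : P → Set W) (e : ℕ → Set W) (x : W)
    (v : ℕ → P) (N : ℕ) (pos nr : ℕ → ℕ → Prop) : x ∈ eval R val e (diagram v N pos nr) ↔
      ¬ SetCopy R x N pos nr fun i => val (v i) := by
  rw [diagram, mem_eval_neg, mem_eval_wedge, mem_eval_bigWedge, mem_eval_bigWedge, SetCopy]
  simp only [List.mem_map, List.mem_range, forall_exists_index, and_imp,
    forall_apply_eq_imp_iff₂, mem_eval_bigWedge, diagramEntry, mem_eval_box, mem_eval_imp,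
    List.mem_cons, List.not_mem_nil, or_false, forall_eq_or_imp, forall_eq, mem_eval_ite,
    mem_eval_dia, mem_eval_neg, not_exists, not_and]
  rfl

end Fm

/-- The clause for `pos` concerns every visible point of `V i`, whereas the copy provides arrows
from `y i` only; hence the uniqueness assumption. -/
theorem Copy.setCopy {R : W → W → Prop} {x : W} {N : ℕ} {pos nr : ℕ → ℕ → Prop} {y : ℕ → W}
    (h : Copy R x N pos nr y) {V : ℕ → Set W} (hV : ∀ i < N, y i ∈ V i)
    (hd : ∀ i < N, ∀ j < N, i ≠ j → ∀ z ∈ V i, z ∉ V j)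
    (hnr : ∀ i < N, ∀ j < N, nr i j → ∀ z ∈ V i, ∀ z' ∈ V j, ¬ R z z')
    (hpos : ∀ i < N, ∀ j < N, pos i j → ∀ z ∈ V i, R x z → z = y i) :
    SetCopy R x N pos nr V := by
  refine ⟨fun i hi => ⟨y i, h.1 i hi, hV i hi⟩, fun i hi j hj z hxz hz => ⟨fun hij =>
    hd i hi j hj hij z hz, fun hn z' hzz' hz' => hnr i hi j hj hn z hz z' hz' hzz', fun hp => ?_⟩⟩
  rw [hpos i hi j hj hp z hz hxz]
  exact ⟨y j, (h.2 i hi j hj).2.2 hp, hV j hj⟩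

/-- A frame that validates the diagram formula has no copies of the configuration. -/
theorem not_copy_of_validOn {R : W → W → Prop} {v : ℕ → P} (hv : Function.Injective v) {N : ℕ}
    {pos nr : ℕ → ℕ → Prop} (h : ValidOn R (diagram v N pos nr)) (x : W) (y : ℕ → W) :
    ¬ Copy R x N pos nr y := by
  intro hc
  -- Each variable `v i` is true exactly at `y i`.
  refine (mem_eval_diagram R (fun p => {z | ∃ i, v i = p ∧ z = y i}) _ x v N pos nr).1 (h _ x)
    (hc.setCopy (fun i _ => ⟨i, rfl, rfl⟩) ?_ ?_ ?_)
  · rintro i hi j hj hij z ⟨i', h1, rfl⟩ ⟨j', h2, h3⟩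
    rw [hv h1, hv h2] at h3
    exact (hc.2 i hi j hj).1 hij h3
  · rintro i hi j hj hij z ⟨i', h1, rfl⟩ z' ⟨j', h2, rfl⟩
    rw [hv h1, hv h2]
    exact (hc.2 i hi j hj).2.1 hij
  · rintro i hi j hj hij z ⟨i', h1, rfl⟩ -
    rw [hv h1]

variable {Λ : Set (Fm P)}

/-- Finitely many points of the canonical model are separated by formulas. -/
theorem exists_separation (hΛ : IsNormalLogic Λ) {N : ℕ} {nr : ℕ → ℕ → Prop}
    {y : ℕ → CanonicalWorld Λ} (hd : ∀ i < N, ∀ j < N, i ≠ j → y i ≠ y j)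
    (hnr : ∀ i < N, ∀ j < N, nr i j → ¬ canonicalRel Λ (y i) (y j)) :
    ∃ π : ℕ → Fm P, (∀ i, IsModal (π i)) ∧ (∀ i < N, π i ∈ (y i).1) ∧
      (∀ i < N, ∀ j < N, i ≠ j → ∀ T : CanonicalWorld Λ, π i ∈ T.1 → π j ∉ T.1) ∧
      ∀ i < N, ∀ j < N, nr i j → ∀ T S : CanonicalWorld Λ, π i ∈ T.1 → π j ∈ S.1 →
        ¬ canonicalRel Λ T S := by
  have hn := hΛ.isNormalIn
  have h1 : ∀ i j, ∃ χ, IsModal χ ∧ (i < N → j < N → i ≠ j → χ ∈ (y i).1 ∧ χ ∉ (y j).1) := by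
    intro i j
    by_cases hij : i < N ∧ j < N ∧ i ≠ j
    · by_contra hc
      push Not at hc
      have he : (y i).toMCS hΛ ≠ (y j).toMCS hΛ := fun he =>
        hd i hij.1 j hij.2.1 hij.2.2 (Subtype.ext (congrArg (fun T => T.1) he))
      refine he (MCS.ext_mem fun χ hχ hχi => ?_)
      by_contra hχj
      obtain ⟨-, -, -, h⟩ := hc χ hχ
      exact hχj (h hχi)
    · exact ⟨top, trivial, fun a b c => (hij ⟨a, b, c⟩).elim⟩
  have h2 : ∀ i j, ∃ χ, IsModal χ ∧ (i < N → j < N → nr i j → box χ ∈ (y i).1 ∧ χ ∉ (y j).1) := by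
    intro i j
    by_cases hij : i < N ∧ j < N ∧ nr i j
    · have := hnr i hij.1 j hij.2.1 hij.2.2
      simp only [canonicalRel, not_forall] at this
      obtain ⟨χ, h3, h4⟩ := this
      exact ⟨χ, hn.box_mem.1 (((y i).toMCS hΛ).2.sub h3), fun _ _ _ => ⟨h3, h4⟩⟩
    · exact ⟨top, trivial, fun a b c => (hij ⟨a, b, c⟩).elim⟩
  choose χ hχ hχ' using h1
  choose η hη hη' using h2
  classical
  -- Each separating formula goes positively into the conjunction for one point of the pair and
  -- negatively into that for the other. So the separation extends to all points that satisfy the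
  -- conjunctions.
  let a : ℕ → ℕ → Fm P := fun i j => bigWedge
    [if i ≠ j then χ i j else top, if i ≠ j then neg (χ j i) else top,
      if nr i j then box (η i j) else top, if nr j i then neg (η j i) else top]
  let π : ℕ → Fm P := fun i => bigWedge ((List.range N).map (a i))
  have memπ : ∀ i (T : CanonicalWorld Λ), π i ∈ T.1 ↔ ∀ j < N,
      (i ≠ j → χ i j ∈ T.1) ∧ (i ≠ j → χ j i ∉ T.1) ∧ (nr i j → box (η i j) ∈ T.1) ∧
        (nr j i → η j i ∉ T.1) := by
    intro i T
    have hT : T.1 = (T.toMCS hΛ).1 := rfl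
    have hite : ∀ (c : Prop) [Decidable c] (φ : Fm P),
        (if c then φ else top) ∈ T.1 ↔ (c → φ ∈ T.1) := by
      intro c _ φ
      by_cases hc : c
      · simp [hc]
      · rw [if_neg hc]
        exact iff_of_true (MCS.mem_top hn (T.toMCS hΛ)) fun h => (hc h).elim
    have hneg : ∀ φ, IsModal φ → (neg φ ∈ T.1 ↔ φ ∉ T.1) := fun φ hφ =>
      MCS.mem_neg (T.toMCS hΛ) hφ
    simp only [π, a]
    rw [hT, MCS.mem_bigWedge hn]
    simp only [List.mem_map, List.mem_range, forall_exists_index, and_imp,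
      forall_apply_eq_imp_iff₂, MCS.mem_bigWedge hn, List.mem_cons, List.not_mem_nil, or_false,
      forall_eq_or_imp, forall_eq]
    rw [← hT]
    simp only [hite, hneg _ (hχ _ _), hneg _ (hη _ _)]
  refine ⟨π, fun i => isModal_bigWedge.2 ?_, fun i hi => (memπ i _).2 fun j hj => ⟨?_, ?_, ?_, ?_⟩,
    fun i hi j hj hij T hT hT' => ?_, fun i hi j hj hij T S hT hS hTS => ?_⟩
  · simp only [List.mem_map, List.mem_range]
    rintro _ ⟨j, -, rfl⟩
    refine isModal_bigWedge.2 ?_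
    simp only [List.mem_cons, List.not_mem_nil, or_false, forall_eq_or_imp, forall_eq]
    refine ⟨?_, ?_, ?_, ?_⟩ <;> split_ifs <;> first | trivial | exact hχ _ _ | exact hη _ _
  · exact fun hij => (hχ' i j hi hj hij).1
  · exact fun hij => (hχ' j i hj hi hij.symm).2
  · exact fun hij => (hη' i j hi hj hij).1
  · exact fun hij => (hη' j i hj hi hij).2
  · exact ((memπ j T).1 hT' i hi).2.1 hij.symm (((memπ i T).1 hT j hj).1 hij)
  · exact ((memπ j S).1 hS i hi).2.2.2 hij (hTS _ (((memπ i T).1 hT j hj).2.2.1 hij))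

/-- Definable sets of the canonical model of a logic with a diagram formula. -/
theorem not_setCopy_canonical (hΛ : IsNormalLogic Λ) {v : ℕ → P} (hv : Function.Injective v)
    {N : ℕ} {pos nr : ℕ → ℕ → Prop} (h : diagram v N pos nr ∈ Λ) {π : ℕ → Fm P}
    (hπ : ∀ i, IsModal (π i)) (T : CanonicalWorld Λ) :
    ¬ SetCopy (canonicalRel Λ) T N pos nr fun i => {S | π i ∈ S.1} := by
  -- `π i` is substituted for `v i`; the arbitrary values at other variables do no harm, as they do
  -- not occur in the diagram.
  let σ : P → Fm P := fun p => π (Function.invFun v p)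
  have h1 := hΛ.unifSubst _ h σ fun p => hπ _
  have h2 := (mem_eval_canonical hΛ (hΛ.isModal _ h1) (fun _ => ∅) T).2
    (((isTheory_iff_isMCS hΛ).1 T.2).thm h1)
  rw [eval_subst _ _ _ _ (isModal_diagram v N pos nr), mem_eval_diagram] at h2
  have h3 : (fun i => eval (canonicalRel Λ) (fun p => {S | var p ∈ S.1}) (fun _ => ∅) (σ (v i))) =
      fun i => {S | π i ∈ S.1} := by
    funext i
    ext S
    rw [mem_eval_canonical hΛ (hπ _)]
    simp [Function.leftInverse_invFun hv i]
  rwa [h3] at h2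

end Diagram

/-! ### Frames of width two -/

section Width
variable {P : Type u} {W : Type v}

/-- No point sees three incomparable points. -/
def WidthTwo (R : W → W → Prop) : Prop :=
  ∀ (x : W) (y : ℕ → W), ¬ Copy R x 3 (fun _ _ => False) (fun i j => i ≠ j) y

theorem WidthTwo.eq {R : W → W → Prop} (h : WidthTwo R) {x a b c : W} (ha : R x a) (hb : R x b)
    (hc : R x c) (hab : ¬ R a b) (hba : ¬ R b a) (hac : ¬ R a c) (hca : ¬ R c a) (hbc : ¬ R b c)
    (hcb : ¬ R c b) (hac' : a ≠ c) (hbc' : b ≠ c) : a = b := by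
  by_contra hne
  refine h x (fun i => if i = 0 then a else if i = 1 then b else c) ⟨fun i hi => ?_,
    fun i hi j hj => ?_⟩
  · interval_cases i <;> simpa
  · interval_cases i <;> interval_cases j <;> simp_all [eq_comm]

theorem validOn_of_widthTwo {R : W → W → Prop} (h : WidthTwo R) (v : ℕ → P) :
    ValidOn R (diagram v 3 (fun _ _ => False) fun i j => i ≠ j) := by
  intro val x
  rw [mem_eval_diagram]
  rintro ⟨h1, h2⟩
  have : Nonempty W := ⟨x⟩
  choose! y hy hy' using h1
  exact h x y ⟨hy, fun i hi j hj => ⟨fun hij hc => (h2 i hi j hj _ (hy i hi) (hy' i hi)).1 hij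
    (hc ▸ hy' j hj), fun hij hR => (h2 i hi j hj _ (hy i hi) (hy' i hi)).2.1 hij _ hR (hy' j hj),
    False.elim⟩⟩

variable {Λ : Set (Fm P)}

theorem widthTwo_canonicalRel (hΛ : IsNormalLogic Λ) {v : ℕ → P} (hv : Function.Injective v)
    (h : diagram v 3 (fun _ _ => False) (fun i j => i ≠ j) ∈ Λ) : WidthTwo (canonicalRel Λ) := by
  intro x y hc
  obtain ⟨π, h1, h2, h3, h4⟩ := exists_separation hΛ (fun i hi j hj => (hc.2 i hi j hj).1)
    fun i hi j hj => (hc.2 i hi j hj).2.1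
  exact not_setCopy_canonical hΛ hv h h1 x (hc.setCopy h2 h3
    (fun i hi j hj hij T hT S hS => h4 i hi j hj hij T S hT hS) fun _ _ _ _ => False.elim)

/-- Every point of the strict order `lt` on `{0, …, N - 1}` has an incomparable mate. -/
def HasMates (N : ℕ) (lt : ℕ → ℕ → Prop) : Prop :=
  ∀ i < N, ¬ lt i i ∧ ∃ m < N, i ≠ m ∧ ¬ lt i m ∧ ¬ lt m i

/-- A refutation only gives that `y i` sees some `z` in the set of `j`. Both `z` and `y j` are
unrelated to each other and to the point of the mate of `j`, so width two forces `z = y j`, and the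
chosen points form a copy. -/
theorem validOn_of_not_copy {R : W → W → Prop} (hR : ∀ x y z, R x y → R y z → R x z)
    (hw : WidthTwo R) {N : ℕ} {lt : ℕ → ℕ → Prop} (hm : HasMates N lt)
    (h : ∀ x y, ¬ Copy R x N lt (fun i j => ¬ lt i j) y) (v : ℕ → P) :
    ValidOn R (diagram v N lt fun i j => ¬ lt i j) := by
  intro val x
  rw [mem_eval_diagram]
  rintro ⟨h1, h2⟩
  have : Nonempty W := ⟨x⟩
  choose! y hy hy' using h1
  refine h x y ⟨hy, fun i hi j hj => ⟨fun hij hc => (h2 i hi j hj _ (hy i hi) (hy' i hi)).1 hij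
    (hc ▸ hy' j hj), fun hij hR => (h2 i hi j hj _ (hy i hi) (hy' i hi)).2.1 hij _ hR (hy' j hj),
    fun hij => ?_⟩⟩
  obtain ⟨z, hz, hz'⟩ := (h2 i hi j hj _ (hy i hi) (hy' i hi)).2.2 hij
  have hxz := hR _ _ _ (hy i hi) hz
  obtain ⟨hjj, m, hmN, hjm, hjm', hmj⟩ := hm j hj
  have e1 := (h2 j hj j hj z hxz hz').2.1 hjj
  have e2 := (h2 j hj j hj _ (hy j hj) (hy' j hj)).2.1 hjj
  have e3 := h2 j hj m hmN z hxz hz'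
  have e4 := h2 j hj m hmN _ (hy j hj) (hy' j hj)
  have e5 := (h2 m hmN j hj _ (hy m hmN) (hy' m hmN)).2.1 hmj
  have : y j = z := hw.eq (hy j hj) hxz (hy m hmN) (fun hc => e2 _ hc hz')
    (fun hc => e1 _ hc (hy' j hj)) (fun hc => e4.2.1 hjm' _ hc (hy' m hmN))
    (fun hc => e5 _ hc (hy' j hj)) (fun hc => e3.2.1 hjm' _ hc (hy' m hmN))
    (fun hc => e5 _ hc hz') (fun hc => e4.1 hjm (hc ▸ hy' m hmN))
    (fun hc => e3.1 hjm (hc ▸ hy' m hmN))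
  rwa [this]

/-- Separating formulas define neighbourhoods of the points of a copy. By width two and the mates,
the root sees only one point in each of them, so the definable sets realise the configuration that
the diagram formula forbids. -/
theorem not_copy_canonicalRel (hΛ : IsNormalLogic Λ) (hw : WidthTwo (canonicalRel Λ)) {v : ℕ → P}
    (hv : Function.Injective v) {N : ℕ} {lt : ℕ → ℕ → Prop} (hm : HasMates N lt)
    (h : diagram v N lt (fun i j => ¬ lt i j) ∈ Λ) (x : CanonicalWorld Λ)
    (y : ℕ → CanonicalWorld Λ) : ¬ Copy (canonicalRel Λ) x N lt (fun i j => ¬ lt i j) y := by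
  intro hc
  obtain ⟨π, h1, h2, h3, h4⟩ := exists_separation hΛ (fun i hi j hj => (hc.2 i hi j hj).1)
    fun i hi j hj => (hc.2 i hi j hj).2.1
  refine not_setCopy_canonical hΛ hv h h1 x (hc.setCopy h2 h3
    (fun i hi j hj hij T hT S hS => h4 i hi j hj hij T S hT hS) fun i hi _ _ _ z hz hxz => ?_)
  obtain ⟨hii, m, hmN, him, him', hmi⟩ := hm i hi
  have hym := h2 m hmN
  have hyi := h2 i hi
  exact hw.eq hxz (hc.1 i hi) (hc.1 m hmN) (h4 i hi i hi hii _ _ hz hyi)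
    (h4 i hi i hi hii _ _ hyi hz) (h4 i hi m hmN him' _ _ hz hym) (h4 m hmN i hi hmi _ _ hym hz)
    (h4 i hi m hmN him' _ _ hyi hym) (h4 m hmN i hi hmi _ _ hym hyi)
    (fun hc' => h3 i hi m hmN him z hz (hc' ▸ hym))
    ((hc.2 i hi m hmN).1 him)

theorem canonicalRel_trans (hΛ : IsNormalLogic Λ) (h4 : ContainsK4 Λ) {T S U : CanonicalWorld Λ}
    (h1 : canonicalRel Λ T S) (h2 : canonicalRel Λ S U) : canonicalRel Λ T U := by
  have hn := hΛ.isNormalIn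
  intro φ hφ
  by_contra hc
  have hm : IsModal φ := hn.box_mem.1 ((T.toMCS hΛ).2.sub hφ)
  have e1 := (MCS.mem_neg (U.toMCS hΛ) hm).2 hc
  have e2 : dia (dia (neg φ)) ∈ (T.toMCS hΛ).1 :=
    (MCS.mem_dia hn (T.toMCS hΛ) (φ := dia (neg φ)) hm).2 ⟨S.toMCS hΛ, h1,
      (MCS.mem_dia hn (S.toMCS hΛ) (φ := neg φ) hm).2 ⟨U.toMCS hΛ, h2, e1⟩⟩
  have e3 := (MCS.mem_imp hn (T.toMCS hΛ) (φ := dia (dia (neg φ))) (ψ := dia (neg φ)) hm hm).1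
    ((T.toMCS hΛ).2.thm (h4 (neg φ) hm)) e2
  obtain ⟨V, hV, hV'⟩ := (MCS.mem_dia hn (T.toMCS hΛ) (φ := neg φ) hm).1 e3
  exact (MCS.mem_neg V hm).1 hV' (hV φ hφ)

end Width

/-! ### Fork orders -/

/-- The strict order of width two on `{0, …, n + 6}` whose incomparability graph is the path
`2, 3, …, n + 4` with the two further neighbours `0, 1` of `2` and `n + 5, n + 6` of `n + 4`. -/
def ForkLt (n i j : ℕ) : Prop :=
  i < j ∧ ¬ (j = i + 1 ∧ i ≠ 0 ∧ i ≠ n + 5) ∧ ¬ (i = 0 ∧ j = 2) ∧ ¬ (i = n + 4 ∧ j = n + 6)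

theorem hasMates_forkLt (n : ℕ) : HasMates (n + 7) (ForkLt n) := by
  intro i hi
  refine ⟨by unfold ForkLt; omega, ?_⟩
  rcases Nat.eq_zero_or_pos i with rfl | h
  · exact ⟨2, by unfold ForkLt; omega⟩
  by_cases h' : i ≤ n + 4
  · exact ⟨i + 1, by unfold ForkLt; omega⟩
  · exact ⟨n + 4, by unfold ForkLt; omega⟩

/-- Different fork orders do not embed into each other. -/
theorem eq_of_forkLt_embedding {m n : ℕ} (f : ℕ → ℕ) (hf : ∀ i < m + 7, f i < n + 7)
    (hinj : ∀ i < m + 7, ∀ j < m + 7, i ≠ j → f i ≠ f j)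
    (hlt : ∀ i < m + 7, ∀ j < m + 7, ForkLt m i j ↔ ForkLt n (f i) (f j)) : m = n := by
  have adj : ∀ i < m + 7, ∀ j < m + 7, i ≠ j → ¬ ForkLt m i j → ¬ ForkLt m j i →
      f i ≠ f j ∧ ¬ ForkLt n (f i) (f j) ∧ ¬ ForkLt n (f j) (f i) := fun i hi j hj hij h1 h2 =>
    ⟨hinj i hi j hj hij, fun h => h1 ((hlt i hi j hj).2 h), fun h => h2 ((hlt j hj i hi).2 h)⟩
  -- Only the two branching vertices of the incomparability graph have three neighbours.
  have deg : ∀ a b c d : ℕ, b ≠ c → b ≠ d → c ≠ d → a < n + 7 → b < n + 7 → c < n + 7 → d < n + 7 →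
      (a ≠ b ∧ ¬ ForkLt n a b ∧ ¬ ForkLt n b a) → (a ≠ c ∧ ¬ ForkLt n a c ∧ ¬ ForkLt n c a) →
      (a ≠ d ∧ ¬ ForkLt n a d ∧ ¬ ForkLt n d a) → a = 2 ∨ a = n + 4 := by
    intro a b c d
    unfold ForkLt
    omega
  have h2 : f 2 = 2 ∨ f 2 = n + 4 :=
    deg _ (f 0) (f 1) (f 3) (hinj _ (by omega) _ (by omega) (by omega))
      (hinj _ (by omega) _ (by omega) (by omega)) (hinj _ (by omega) _ (by omega) (by omega))
      (hf _ (by omega)) (hf _ (by omega)) (hf _ (by omega)) (hf _ (by omega))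
      (adj _ (by omega) _ (by omega) (by omega) (by unfold ForkLt; omega) (by unfold ForkLt; omega))
      (adj _ (by omega) _ (by omega) (by omega) (by unfold ForkLt; omega) (by unfold ForkLt; omega))
      (adj _ (by omega) _ (by omega) (by omega) (by unfold ForkLt; omega) (by unfold ForkLt; omega))
  have hk : f (m + 4) = 2 ∨ f (m + 4) = n + 4 :=
    deg _ (f (m + 3)) (f (m + 5)) (f (m + 6)) (hinj _ (by omega) _ (by omega) (by omega))
      (hinj _ (by omega) _ (by omega) (by omega)) (hinj _ (by omega) _ (by omega) (by omega))
      (hf _ (by omega)) (hf _ (by omega)) (hf _ (by omega)) (hf _ (by omega))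
      (adj _ (by omega) _ (by omega) (by omega) (by unfold ForkLt; omega) (by unfold ForkLt; omega))
      (adj _ (by omega) _ (by omega) (by omega) (by unfold ForkLt; omega) (by unfold ForkLt; omega))
      (adj _ (by omega) _ (by omega) (by omega) (by unfold ForkLt; omega) (by unfold ForkLt; omega))
  -- The embedding preserves the order, so it cannot exchange the two branching vertices.
  have h2k : f 2 < f (m + 4) := ((hlt 2 (by omega) (m + 4) (by omega)).1 (by
    unfold ForkLt; omega)).1
  have e2 : f 2 = 2 := by omega
  have ek : f (m + 4) = n + 4 := by omega
  -- The other neighbours `0` and `1` of `2` are leaves, but the image of `3` needs a second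
  -- neighbour.
  have e3 : f 3 = 3 := by
    have a := adj 2 (by omega) 3 (by omega) (by omega) (by unfold ForkLt; omega)
      (by unfold ForkLt; omega)
    have b := adj 3 (by omega) 4 (by omega) (by omega) (by unfold ForkLt; omega)
      (by unfold ForkLt; omega)
    have c := hinj 2 (by omega) 4 (by omega) (by omega)
    have d := hf 4 (by omega)
    rw [e2] at a c
    unfold ForkLt at a b
    omega
  -- An inner vertex of the path has two neighbours, one of which is already taken, so the embedding
  -- moves along the path one vertex at a time. It cannot reach `n + 4` before `i = m + 4`, by
  -- injectivity.
  have path : ∀ i, 3 ≤ i → i ≤ m + 4 → i ≤ n + 4 ∧ f (i - 1) = i - 1 ∧ f i = i := by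
    intro i hi
    induction i, hi using Nat.le_induction with
    | base => exact fun _ => ⟨by omega, e2, e3⟩
    | succ i hi ih =>
      intro hi'
      obtain ⟨h1, h3, h4⟩ := ih (by omega)
      have h5 : f i ≠ f (m + 4) := hinj _ (by omega) _ (by omega) (by omega)
      have h6 := adj i (by omega) (i + 1) (by omega) (by omega) (by unfold ForkLt; omega)
        (by unfold ForkLt; omega)
      have h7 := hinj (i - 1) (by omega) (i + 1) (by omega) (by omega)
      refine ⟨by omega, by simpa using h4, ?_⟩
      rw [h4] at h6
      rw [h3] at h7
      unfold ForkLt at h6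
      omega
  have := (path (m + 4) (by omega) le_rfl).2.2
  omega

/-- The fork order, as a frame with a root `0`. -/
def forkRel (n : ℕ) (a b : ULift.{u} ℕ) : Prop :=
  (a.down = 0 ∧ 1 ≤ b.down ∧ b.down ≤ n + 7) ∨
    (1 ≤ a.down ∧ 1 ≤ b.down ∧ b.down ≤ n + 7 ∧ ForkLt n (a.down - 1) (b.down - 1))

theorem forkRel_trans (n : ℕ) (a b c : ULift.{u} ℕ) (h1 : forkRel n a b) (h2 : forkRel n b c) :
    forkRel n a c := by
  unfold forkRel ForkLt at *
  omega

/-- The incomparability graph is a tree and so contains no triangle. -/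
theorem widthTwo_forkRel (n : ℕ) : WidthTwo (forkRel.{u} n) := by
  rintro x y ⟨h1, h2⟩
  have d : ∀ i < 3, 1 ≤ (y i).down ∧ (y i).down ≤ n + 7 := fun i hi => by
    have := h1 i hi
    unfold forkRel at this
    omega
  have key : ∀ i < 3, ∀ j < 3, i ≠ j → (y i).down ≠ (y j).down ∧
      ¬ ForkLt n ((y i).down - 1) ((y j).down - 1) := fun i hi j hj hij =>
    ⟨fun hc => (h2 i hi j hj).1 hij (ULift.ext _ _ hc), fun hc => (h2 i hi j hj).2.1 hij
      (.inr ⟨(d i hi).1, (d j hj).1, (d j hj).2, hc⟩)⟩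
  have d0 := d 0 (by omega)
  have d1 := d 1 (by omega)
  have d2 := d 2 (by omega)
  have k01 := key 0 (by omega) 1 (by omega) (by omega)
  have k02 := key 0 (by omega) 2 (by omega) (by omega)
  have k12 := key 1 (by omega) 2 (by omega) (by omega)
  have k10 := key 1 (by omega) 0 (by omega) (by omega)
  have k20 := key 2 (by omega) 0 (by omega) (by omega)
  have k21 := key 2 (by omega) 1 (by omega) (by omega)
  unfold ForkLt at *
  omega

/-- No point of the frame sees a copy of the fork order number `n`. -/
def OmitsFork {W : Type v} (R : W → W → Prop) (n : ℕ) : Prop :=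
  ∀ x y, ¬ Copy R x (n + 7) (ForkLt n) (fun i j => ¬ ForkLt n i j) y

/-- A visible copy avoids the root, so after the shift by one it is an embedding of fork orders, and
`eq_of_forkLt_embedding` applies. -/
theorem omitsFork_forkRel_iff (m n : ℕ) : OmitsFork (forkRel.{u} n) m ↔ m ≠ n := by
  constructor
  · rintro h rfl
    refine h ⟨0⟩ (fun i => ⟨i + 1⟩) ⟨fun i hi => .inl ⟨rfl, ?_, ?_⟩, fun i hi j hj =>
      ⟨fun hij hc => hij ?_, fun hij hc => hij ?_, fun hij => .inr ⟨?_, ?_, ?_, ?_⟩⟩⟩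
    · simp
    · show i + 1 ≤ m + 7; omega
    · simpa using hc
    · rcases hc with hc | hc
      · exact absurd hc.1 (Nat.succ_ne_zero i)
      · exact hc.2.2.2
    · simp
    · simp
    · show j + 1 ≤ m + 7; omega
    · exact hij
  · rintro hmn x y ⟨h1, h2⟩
    have d : ∀ i < m + 7, 1 ≤ (y i).down ∧ (y i).down ≤ n + 7 := fun i hi => by
      have := h1 i hi
      unfold forkRel at this
      omega
    refine hmn (eq_of_forkLt_embedding (fun i => (y i).down - 1) (fun i hi => ?_)
      (fun i hi j hj hij hc => ?_) fun i hi j hj => ?_)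
    · have := d i hi
      show (y i).down - 1 < n + 7
      omega
    · have hi' := d i hi
      have hj' := d j hj
      refine (h2 i hi j hj).1 hij (ULift.ext _ _ ?_)
      have : (y i).down - 1 = (y j).down - 1 := hc
      omega
    · have hi' := d i hi
      have hj' := d j hj
      constructor
      · intro h3
        rcases (h2 i hi j hj).2.2 h3 with h4 | h4
        · omega
        · exact h4.2.2.2
      · intro h3
        by_contra h4
        exact (h2 i hi j hj).2.1 h4 (.inr ⟨hi'.1, hj'.1, hj'.2, h3⟩)

/-- Transitive frames of width two without copies of the fork orders in `S`. -/
structure IsForkFrame (S : Set ℕ) {W : Type v} (R : W → W → Prop) : Prop where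
  trans : ∀ x y z, R x y → R y z → R x z
  width : WidthTwo R
  omits : ∀ n ∈ S, OmitsFork R n

theorem Copy.of_restrict {W : Type v} {R : W → W → Prop} {U : Set W} {x : U} {N : ℕ}
    {pos nr : ℕ → ℕ → Prop} {y : ℕ → U} (h : Copy (fun a b : U => R a.1 b.1) x N pos nr y) :
    Copy R x.1 N pos nr fun i => (y i).1 :=
  ⟨h.1, fun i hi j hj => ⟨fun hij hc => (h.2 i hi j hj).1 hij (Subtype.ext hc),
    (h.2 i hi j hj).2⟩⟩

theorem IsForkFrame.restrict {S : Set ℕ} {W : Type v} {R : W → W → Prop} (h : IsForkFrame S R)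
    (U : Set W) : IsForkFrame S fun a b : U => R a.1 b.1 where
  trans := fun _ _ _ => h.trans _ _ _
  width := fun x _ hc => h.width x.1 _ hc.of_restrict
  omits := fun n hn x _ hc => h.omits n hn x.1 _ hc.of_restrict

/-! ### The logics of frames that omit fork orders -/

/-- The modal logic of a class of frames. -/
def logicOf {P : Type u} (K : ∀ W : Type u, (W → W → Prop) → Prop) : Set (Fm P) :=
  {φ | IsModal φ ∧ ∀ (W : Type u) (R : W → W → Prop), K W R → ValidOn R φ}

theorem isNormalLogic_logicOf {P : Type u} (K : ∀ W : Type u, (W → W → Prop) → Prop) :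
    IsNormalLogic (logicOf K : Set (Fm P)) where
  isModal := fun _ h => h.1
  taut := fun φ h1 h2 => ⟨h1, fun _ R _ val x => (eval_boolEval R val _ x φ).1 (h2 _)⟩
  distr := fun φ ψ h1 h2 => ⟨⟨⟨h1, h2⟩, h1, h2⟩, fun _ R _ val x => by
    simp only [mem_eval_imp, mem_eval_box]
    exact fun h3 h4 y hy => h3 y hy (h4 y hy)⟩
  dual := fun φ h => ⟨⟨⟨h, h⟩, h, h⟩, fun _ R _ val x => by
    simp only [mem_eval_iff, mem_eval_neg, mem_eval_box, mem_eval_dia]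
    push Not
    rfl⟩
  mp := fun φ ψ h1 h2 => ⟨h2.1.2, fun W R hR val x =>
    (mem_eval_imp ..).1 (h2.2 W R hR val x) (h1.2 W R hR val x)⟩
  nec := fun φ h => ⟨h.1, fun W R hR val x =>
    (mem_eval_box ..).2 fun y _ => h.2 W R hR val y⟩
  unifSubst := fun φ h σ hσ => ⟨h.1.subst hσ, fun W R hR val x => by
    rw [eval_subst R val σ φ h.1]
    exact h.2 W R hR _ x⟩

/-- The logic of the transitive frames of width two without the fork orders in `S`. -/
def forkLogic (P : Type u) (S : Set ℕ) : Set (Fm P) := logicOf fun _ R => IsForkFrame S R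

section ForkLogic
variable {P : Type u} (S : Set ℕ)

theorem containsK4_forkLogic : ContainsK4 (forkLogic P S) := fun φ hφ =>
  ⟨⟨hφ, hφ⟩, fun W R hR val x => by
    simp only [mem_eval_imp, mem_eval_dia]
    rintro ⟨y, hxy, z, hyz, hz⟩
    exact ⟨z, hR.trans _ _ _ hxy hyz, hz⟩⟩

theorem ContainsK4.containsWK4 {Λ : Set (Fm P)} (hΛ : IsNormalLogic Λ) (h : ContainsK4 Λ) :
    ContainsWK4 Λ := fun φ hφ =>
  hΛ.isNormalIn.of_taut_one (h φ hφ) ⟨hφ, hφ, hφ⟩ fun b => by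
    simp only [boolEval_imp, vee, boolEval_neg, boolEval_wedge]
    tauto

variable [Infinite P]

/-- The class is modally definable: its three conditions correspond to the transitivity axiom and to
diagram formulas, all of which lie in the logic. As the class is closed under restriction to
arbitrary subsets, cofinal subframes cause no difficulty. -/
theorem isForkFrame_of_isFrameOf {W : Type v} {R : W → W → Prop}
    (h : IsFrameOf (forkLogic P S) R) : IsForkFrame S R where
  trans := fun x y z hxy hyz => by
    have := h _ (containsK4_forkLogic S (var (Infinite.natEmbedding P 0)) trivial) (fun _ => {z}) x
    simp only [mem_eval_imp, mem_eval_dia] at this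
    obtain ⟨s, h1, h2⟩ := this ⟨y, hxy, z, hyz, rfl⟩
    exact h2 ▸ h1
  width := not_copy_of_validOn (Infinite.natEmbedding P).injective
    (h _ ⟨isModal_diagram _ _ _ _, fun _ _ hR => validOn_of_widthTwo hR.width _⟩)
  omits := fun n hn => not_copy_of_validOn (Infinite.natEmbedding P).injective
    (h _ ⟨isModal_diagram _ _ _ _, fun _ _ hR => validOn_of_not_copy hR.trans hR.width
      (hasMates_forkLt n) (hR.omits n hn) _⟩)

/-- Width two comes first, because the canonicity of the other diagram formulas depends on it. -/
theorem isForkFrame_canonicalRel : IsForkFrame S (canonicalRel (forkLogic P S)) := by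
  have hn : IsNormalLogic (forkLogic P S) := isNormalLogic_logicOf _
  have hw := widthTwo_canonicalRel hn (Infinite.natEmbedding P).injective
    ⟨isModal_diagram _ _ _ _, fun _ _ hR => validOn_of_widthTwo hR.width _⟩
  exact {
    trans := fun _ _ _ => canonicalRel_trans hn (containsK4_forkLogic S)
    width := hw
    omits := fun n hS => not_copy_canonicalRel hn hw (Infinite.natEmbedding P).injective
      (hasMates_forkLt n) ⟨isModal_diagram _ _ _ _, fun _ _ hR =>
        validOn_of_not_copy hR.trans hR.width (hasMates_forkLt n) (hR.omits n hS) _⟩ }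

theorem isCanonicalCofinalSubframeLogic_forkLogic :
    IsCanonicalCofinalSubframeLogic (forkLogic P S) where
  normal := isNormalLogic_logicOf _
  wk4 := (containsK4_forkLogic S).containsWK4 (isNormalLogic_logicOf _)
  canonical := fun _ hφ => hφ.2 _ _ (isForkFrame_canonicalRel S)
  cofinalSubframe := fun _ _ hR U _ _ hφ =>
    hφ.2 _ _ ((isForkFrame_of_isFrameOf S hR).restrict U)

omit S in
-- If `n ∈ S` but `n ∉ S'`, the fork order number `n` with a root is a frame for the logic of `S'`
-- and not for that of `S`.
theorem forkLogic_injective : Function.Injective (forkLogic P) := by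
  have key : ∀ S S' : Set ℕ, forkLogic P S = forkLogic P S' → S ⊆ S' := by
    intro S S' h n hn
    by_contra hn'
    have h1 : IsForkFrame S' (forkRel.{u} n) := ⟨forkRel_trans n, widthTwo_forkRel n,
      fun m hm => (omitsFork_forkRel_iff m n).2 fun hc => hn' (hc ▸ hm)⟩
    have h2 : IsFrameOf (forkLogic P S) (forkRel.{u} n) := fun φ hφ => by
      rw [h] at hφ
      exact hφ.2 _ _ h1
    exact (omitsFork_forkRel_iff n n).1 ((isForkFrame_of_isFrameOf S h2).omits n hn) rfl
  exact fun S S' h => Set.Subset.antisymm (key S S' h) (key S' S h.symm)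

end ForkLogic

/-! ### Cardinalities and the main theorem -/

theorem mk_canonicalCofinalSubframeLogic {P : Type u} [Infinite P] :
    Cardinal.mk {Λ : Set (Fm P) // IsCanonicalCofinalSubframeLogic Λ ∧ ContainsK4 Λ} =
      Cardinal.continuum := by
  refine le_antisymm (mk_isNormalLogic_le _ fun Λ h => h.1.normal) ?_
  let f : ULift.{u} (Set ℕ) →
      {Λ : Set (Fm P) // IsCanonicalCofinalSubframeLogic Λ ∧ ContainsK4 Λ} := fun S =>
    ⟨forkLogic P S.down, isCanonicalCofinalSubframeLogic_forkLogic _, containsK4_forkLogic _⟩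
  have hf : Function.Injective f := fun S S' h =>
    ULift.ext _ _ (forkLogic_injective (congrArg Subtype.val h))
  have := Cardinal.mk_le_of_injective hf
  rwa [Cardinal.mk_uLift, Cardinal.mk_set, Cardinal.mk_nat, Cardinal.two_power_aleph0,
    Cardinal.lift_continuum] at this

/-- The passage from `Λ` to its fixed-point logic is injective, because the modal formulas of the
latter give back `Λ`. -/
theorem mk_muLogic {P : Type u} [Infinite P] {L : Set (Fm P)} (hL : IsNaturalSublanguage L)
    (hvar : ∀ p : P, var p ∈ L) :
    Cardinal.mk {T : Set (Fm P) // ∃ Λ : Set (Fm P),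
      IsCanonicalCofinalSubframeLogic Λ ∧ ContainsK4 Λ ∧ T = muLogic Λ L} =
        Cardinal.continuum := by
  rw [← mk_canonicalCofinalSubframeLogic (P := P)]
  refine (Cardinal.mk_congr (Equiv.ofBijective (fun Λ => ⟨muLogic Λ.1 L, Λ.1, Λ.2.1, Λ.2.2, rfl⟩)
    ⟨fun Λ Λ' h => Subtype.ext ?_, ?_⟩)).symm
  · rw [← muLogic_inter_isModal Λ.2.1 hL hvar, ← muLogic_inter_isModal Λ'.2.1 hL hvar]
    exact congrArg (fun T => T.1 ∩ {φ | IsModal φ}) h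
  · rintro ⟨_, Λ, h1, h2, rfl⟩
    exact ⟨⟨Λ, h1, h2⟩, rfl⟩

theorem mainTheorem2 {P : Type u} [Infinite P] :
    (∀ Λ : Set (Fm P), IsCanonicalCofinalSubframeLogic Λ →
      ∀ L : Set (Fm P), IsNaturalSublanguage L →
        (∀ (W : Type u) (R : W → W → Prop), IsFrameOf Λ R → IsFrameOf (muLogic Λ L) R) ∧
        (∀ φ ∈ L,
          (∀ (W : Type u) (R : W → W → Prop), Finite W → IsFrameOf Λ R → ValidOn R φ) →
            φ ∈ muLogic Λ L) ∧
        HasFMP (muLogic Λ L) L) ∧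
    Cardinal.mk {Λ : Set (Fm P) // IsCanonicalCofinalSubframeLogic Λ ∧ ContainsK4 Λ} =
      Cardinal.continuum ∧
    (∀ L : Set (Fm P), IsNaturalSublanguage L → (∀ p : P, var p ∈ L) →
      Cardinal.mk {T : Set (Fm P) // ∃ Λ : Set (Fm P),
        IsCanonicalCofinalSubframeLogic Λ ∧ ContainsK4 Λ ∧ T = muLogic Λ L} =
      Cardinal.continuum) :=
  ⟨fun _ hΛ _ hL => ⟨fun _ _ hR => hR.muLogic hΛ.normal hΛ.wk4 hL,
      fun _ hφ H => hΛ.complete hL hφ H, hΛ.hasFMP hL⟩,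
    mk_canonicalCofinalSubframeLogic, fun _ hL hvar => mk_muLogic hL hvar⟩
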